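/- Let $0<\alpha<1$, $s\in\mathbb{R}$ and $t\neq 0$, and consider the Majda--Biello system \[ u_t+u_{xxx}+vv_x=0,\qquad v_t+\alpha v_{xxx}+(uv)_x=0,\qquad (u,v)|_{t=0}=(u_0,v_0),\qquad x\in\mathbb{R}, \] for real-valued $u,v$. Let $H^s=H^s(\mathbb{R})$ be the Sobolev space of real-valued functions (tempered distributions if $s<0$) with the norm $\|(1+|\xi|)^s\widehat f(\xi)\|_{L^2_\xi}$. Suppose that the solution map $\Phi_t:(u_0,v_0)\mapsto(u(t),v(t))$ is well defined on an open neighbourhood $U$ of $0$ in $H^s\times H^s$, with values in $H^s\times H^s$. This means that $\Phi_t$ is continuous on $U$ and that for every $(u_0,v_0)\in U$ whose components are Schwartz functions there is a solution $(u,v)\in C(I;H^1\times H^1)$ of the system in the sense of distributions in $x$, on the closed time interval $I$ between $0$ and $t$, with $(u(0),v(0))=(u_0,v_0)$ and $(u(t),v(t))=\Phi_t(u_0,v_0)$. (As Schwartz data are dense, the values at all other data in $U$ are determined by continuity.) If $\Phi_t$ is of class $C^2$ on $U$, as a map from $U\subset H^s\times H^s$ to $H^s\times H^s$, then $s\geq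 0$. -/

import Mathlib

open MeasureTheory TemperedDistribution
open scoped SchwartzMap

noncomputable section

namespace MajdaBiello

/-- A tempered distribution on the line is real if it takes real values on real test functions. -/
def IsReal (f : 𝓢'(ℝ, ℂ)) : Prop :=
  ∀ φ : 𝓢(ℝ, ℂ), (∀ x, (φ x).im = 0) → (f φ).im = 0

/-- The real tempered distributions that lie in the `L²`-based Sobolev space of order `s`, as a
real vector space. -/
def sobolevSubmodule (s : ℝ) : Submodule ℝ 𝓢'(ℝ, ℂ) where
  carrier := {f | MemSobolev s 2 f ∧ IsReal f}
  add_mem' := by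
    rintro f g ⟨hf, hf'⟩ ⟨hg, hg'⟩
    refine ⟨hf.add hg, fun φ hφ => ?_⟩
    have h : (f + g) φ = f φ + g φ := rfl
    rw [h, Complex.add_im, hf' φ hφ, hg' φ hφ, add_zero]
  zero_mem' := by
    refine ⟨memSobolev_fun_zero ℝ ℂ s 2, fun φ _ => ?_⟩
    have h : (0 : 𝓢'(ℝ, ℂ)) φ = 0 := rfl
    rw [h, Complex.zero_im]
  smul_mem' := by
    rintro c f ⟨hf, hf'⟩
    refine ⟨?_, fun φ hφ => ?_⟩
    · have h : c • f = (c : ℂ) • f := by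
        ext φ
        exact (Complex.coe_smul c (f φ)).symm
      rw [h]
      exact hf.smul (c : ℂ)
    · have h : (c • f) φ = c • f φ := rfl
      rw [h, Complex.smul_im, hf' φ hφ, smul_zero]

/-- The Sobolev space `Hˢ(ℝ)` of real-valued functions (distributions if `s < 0`). It is a type of
its own, so that it carries the topology of its norm (defined below) and not the topology of
tempered distributions. -/
def H (s : ℝ) : Type := sobolevSubmodule s

namespace H

variable {s : ℝ}

instance instAddCommGroup : AddCommGroup (H s) :=
  inferInstanceAs (AddCommGroup (sobolevSubmodule s))

instance instModule : Module ℝ (H s) :=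
  inferInstanceAs (Module ℝ (sobolevSubmodule s))

/-- The tempered distribution underlying an element of `Hˢ(ℝ)`. -/
def toDistr (f : H s) : 𝓢'(ℝ, ℂ) := Subtype.val f

theorem toDistr_injective : Function.Injective (toDistr (s := s)) := Subtype.val_injective

theorem toDistr_add (f g : H s) : (f + g).toDistr = f.toDistr + g.toDistr := rfl

theorem toDistr_smul (c : ℝ) (f : H s) : (c • f).toDistr = c • f.toDistr := rfl

theorem memSobolev (f : H s) : MemSobolev s 2 f.toDistr := f.2.1

theorem isReal (f : H s) : IsReal f.toDistr := f.2.2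

/-- The square integrable function `(1 - (2π)⁻²∂ₓ²)^{s/2} f`; its Fourier transform is the one of
`f` times a weight that is comparable to `(1 + |ξ|)ˢ`. -/
def bessel (f : H s) : Lp ℂ 2 (volume : Measure ℝ) := f.memSobolev.choose

theorem bessel_spec (f : H s) :
    besselPotential ℝ ℂ s f.toDistr = (f.bessel : 𝓢'(ℝ, ℂ)) := f.memSobolev.choose_spec

theorem lp_toDistr_injective : Function.Injective
    (fun f : Lp ℂ 2 (volume : Measure ℝ) => (f : 𝓢'(ℝ, ℂ))) :=
  LinearMap.ker_eq_bot.mp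
    (Lp.ker_toTemperedDistributionCLM_eq_bot (F := ℂ) (p := 2) (μ := (volume : Measure ℝ)))

/-- `bessel` as a linear map. -/
def besselₗ : H s →ₗ[ℝ] Lp ℂ 2 (volume : Measure ℝ) where
  toFun := bessel
  map_add' f g := by
    apply lp_toDistr_injective
    change ((f + g).bessel : 𝓢'(ℝ, ℂ)) = ((f.bessel + g.bessel : Lp ℂ 2 _) : 𝓢'(ℝ, ℂ))
    rw [← bessel_spec, toDistr_add, map_add, bessel_spec, bessel_spec,
      ← Lp.toTemperedDistributionCLM_apply, ← Lp.toTemperedDistributionCLM_apply,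
      ← Lp.toTemperedDistributionCLM_apply, map_add]
  map_smul' c f := by
    apply lp_toDistr_injective
    change ((c • f).bessel : 𝓢'(ℝ, ℂ)) = ((c • f.bessel : Lp ℂ 2 _) : 𝓢'(ℝ, ℂ))
    have h : c • f.toDistr = (c : ℂ) • f.toDistr := by
      ext φ
      exact (Complex.coe_smul c (f.toDistr φ)).symm
    have h' : c • f.bessel = (c : ℂ) • f.bessel := by
      ext1
      filter_upwards [Lp.coeFn_smul c f.bessel, Lp.coeFn_smul (c : ℂ) f.bessel] with x h1 h2
      rw [h1, h2]
      exact (Complex.coe_smul c _).symm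
    rw [← bessel_spec, toDistr_smul, h, h', map_smul, bessel_spec,
      ← Lp.toTemperedDistributionCLM_apply, ← Lp.toTemperedDistributionCLM_apply, map_smul]

theorem besselₗ_injective : Function.Injective (besselₗ (s := s)) := by
  intro f g h
  have h0 : f.bessel = g.bessel := h
  have h1 : besselPotential ℝ ℂ s f.toDistr = besselPotential ℝ ℂ s g.toDistr := by
    rw [bessel_spec, bessel_spec, h0]
  apply toDistr_injective
  rw [← besselPotential_neg_apply_eq_iff] at h1
  rw [← h1, besselPotential_besselPotential_apply]
  simp

/-- `Hˢ(ℝ)` is normed by `‖f‖ = ‖(1 - (2π)⁻²∂ₓ²)^{s/2} f‖_{L²}`. -/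
instance instNormedAddCommGroup : NormedAddCommGroup (H s) :=
  NormedAddCommGroup.induced (H s) (Lp ℂ 2 (volume : Measure ℝ)) besselₗ besselₗ_injective

instance instNormedSpace : NormedSpace ℝ (H s) :=
  NormedSpace.induced ℝ (H s) (Lp ℂ 2 (volume : Measure ℝ)) besselₗ

theorem norm_eq (f : H s) : ‖f‖ = ‖f.bessel‖ := rfl

/-- An element of `H¹(ℝ)` as a square integrable function. -/
def toL2 (f : H 1) : Lp ℂ 2 (volume : Measure ℝ) :=
  (memSobolev_zero_iff.mp (f.memSobolev.mono zero_le_one)).choose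

theorem toL2_spec (f : H 1) : f.toDistr = (f.toL2 : 𝓢'(ℝ, ℂ)) :=
  (memSobolev_zero_iff.mp (f.memSobolev.mono zero_le_one)).choose_spec

/-- The element of `Hˢ(ℝ)` is (given by) a Schwartz function. -/
def IsSchwartz (f : H s) : Prop := ∃ g : 𝓢(ℝ, ℂ), f.toDistr = (g : 𝓢'(ℝ, ℂ))

end H

/-- `(u, v)` is a solution in `C(I; H¹(ℝ) × H¹(ℝ))` of the Majda-Biello system
`u_t + u_xxx + v v_x = 0`, `v_t + α v_xxx + (u v)_x = 0` on the time interval `I`. The equations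
hold in the sense of distributions in `x`: for every test function `φ`,
`d/dτ ⟨u, φ⟩ = ⟨u, φ_xxx⟩ + ½ ⟨v², φ_x⟩` and `d/dτ ⟨v, φ⟩ = α ⟨v, φ_xxx⟩ + ⟨u v, φ_x⟩`. -/
structure IsSolution (α : ℝ) (I : Set ℝ) (u v : ℝ → H 1) : Prop where
  continuousOn_fst : ContinuousOn u I
  continuousOn_snd : ContinuousOn v I
  eq_fst : ∀ τ ∈ I, ∀ φ : 𝓢(ℝ, ℂ),
    HasDerivWithinAt (fun σ => (u σ).toDistr φ)
      ((u τ).toDistr ((SchwartzMap.derivCLM ℂ ℂ)^[3] φ)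
        + ∫ x, (1 / 2 : ℂ) * (v τ).toL2 x ^ 2 * deriv φ x) I τ
  eq_snd : ∀ τ ∈ I, ∀ φ : 𝓢(ℝ, ℂ),
    HasDerivWithinAt (fun σ => (v σ).toDistr φ)
      ((α : ℂ) * (v τ).toDistr ((SchwartzMap.derivCLM ℂ ℂ)^[3] φ)
        + ∫ x, (u τ).toL2 x * (v τ).toL2 x * deriv φ x) I τ

/-- `Φ` is the solution map `(u₀, v₀) ↦ (u(t), v(t))` at time `t` of the Majda-Biello system, for
initial data in the subset `U` of `Hˢ × Hˢ`: it is continuous in the topology of `Hˢ × Hˢ`, and for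
Schwartz initial data it gives the value at time `t` of a solution on the time interval between `0`
and `t`. (As Schwartz data are dense in `Hˢ × Hˢ`, for open `U` the values at the other data, whose
solutions need not have products `v²` and `u v` if `s < 0`, are determined by continuity.) -/
structure IsSolutionMap (α s t : ℝ) (U : Set (H s × H s)) (Φ : H s × H s → H s × H s) : Prop where
  continuousOn : ContinuousOn Φ U
  exists_solution : ∀ d ∈ U, d.1.IsSchwartz → d.2.IsSchwartz →
    ∃ u v : ℝ → H 1, IsSolution α (Set.uIcc 0 t) u v ∧
      (u 0).toDistr = d.1.toDistr ∧ (v 0).toDistr = d.2.toDistr ∧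
      (u t).toDistr = (Φ d).1.toDistr ∧ (v t).toDistr = (Φ d).2.toDistr

end MajdaBiello

end

/-!
A map of class `C²` near `0` has second differences of quadratic size,
`‖Φ x + Φ (-x) - 2 Φ 0‖ ≤ K ‖x‖²` (`exists_second_difference_le`). The proof shows that for the
solution map this second difference is governed by the second Picard iterate, which is not bounded
in `Hˢ` if `s < 0`.

*The second order term.* The solutions are only known to be continuous in time with values in `H¹`,
without bounds or uniqueness, so the expansion in the size `ε` of the data is not a matter of
iterating. It rests on the conservation of `‖u‖² + ‖v‖²` in `L²` (`IsSolution.conservation`), which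
is proved with a frequency cutoff at `N`: the flux through the cutoff is the integral of an exact
derivative up to `O(1/N)` (`norm_flux_le`). Let `S` be `ε` times the free evolution of the data. As
the norms of the solution and of `S` agree, their distance is controlled by their inner product,
and this one is nearly constant in time because in the interaction representation the solution
moves only through the nonlinearity. So the distance is `O(ε^{3/2})` in `L²`
(`IsSolution.nrm2_sub_free_sq_le`). Inserted into the product `u v`, this gives the derivative of
`v` in the interaction representation up to `O(ε^{5/2})`: it is `ε²` times the derivative of the
second Picard iterate (`IsSolution.norm_deriv_sub_le`). In the second difference the error
disappears as `ε → 0`, and what remains is a bilinear estimate for the second Picard iterate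
(`IsSolutionMap.exists_bilinear_bound`).

*Its failure.* Since `0 < α < 1`, there is `κ > 0` with `1 + α κ³ = α (1 + κ)³` (`exists_resonant`):
a wave of `u` at frequency `N` and a wave of `v` at frequency `κ N` interact resonantly, with output
in `v` at frequency `(1 + κ) N`. In windows of width `γ = c / N²` around these frequencies the phase
of the interaction stays bounded by `1` up to time `t`, so nothing cancels and the second Picard
iterate is at least of size `|t| N γ²` when it is tested with a bump in the output window
(`le_re_picard`, `le_re_picard_bumps`). The bilinear estimate bounds this by a multiple of
`N^{2s} N^{-s} γ^{3/2}`. As `N γ^{1/2} = c^{1/2}`, it follows that `|t| c^{1/2}` is at most a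
multiple of `Nˢ` for all `N ≥ 1`, which is false if `s < 0`.
-/

noncomputable section

namespace MajdaBiello

open FourierTransform
open scoped ContDiff ComplexConjugate

/-! ### Square integrable functions and the Fourier transform on `L¹ ∩ L²` -/

/-- The `L²` norm of a function on the line, as a real number (`0` if it is infinite). -/
def nrm2 (f : ℝ → ℂ) : ℝ := (eLpNorm f 2 volume).toReal

theorem nrm2_nonneg (f : ℝ → ℂ) : 0 ≤ nrm2 f := ENNReal.toReal_nonneg

theorem nrm2_coeFn (f : Lp ℂ 2 (volume : Measure ℝ)) : nrm2 f = ‖f‖ := (Lp.norm_def f).symm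

theorem nrm2_congr {f g : ℝ → ℂ} (h : f =ᵐ[volume] g) : nrm2 f = nrm2 g := by
  rw [nrm2, nrm2, eLpNorm_congr_ae h]

theorem nrm2_mono {f g : ℝ → ℂ} (hg : MemLp g 2 volume) (h : ∀ᵐ x, ‖f x‖ ≤ ‖g x‖) :
    nrm2 f ≤ nrm2 g :=
  ENNReal.toReal_mono hg.eLpNorm_ne_top (eLpNorm_mono_ae h)

theorem nrm2_const_mul (c : ℂ) (f : ℝ → ℂ) : nrm2 (fun x => c * f x) = ‖c‖ * nrm2 f := by
  have : (fun x => c * f x) = c • f := rfl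
  rw [nrm2, nrm2, this, eLpNorm_const_smul, ENNReal.toReal_mul]
  simp

theorem nrm2_sq {f : ℝ → ℂ} (hf : MemLp f 2 volume) : nrm2 f ^ 2 = ∫ x, ‖f x‖ ^ 2 := by
  rw [nrm2_congr hf.coeFn_toLp.symm, nrm2_coeFn, ← @inner_self_eq_norm_sq ℂ, L2.inner_def]
  have : ∫ x, inner ℂ (hf.toLp f x) (hf.toLp f x) = ((∫ x, ‖f x‖ ^ 2 : ℝ) : ℂ) := by
    rw [← integral_complex_ofReal]
    refine integral_congr_ae ?_
    filter_upwards [hf.coeFn_toLp] with x hx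
    rw [hx, inner_self_eq_norm_sq_to_K]
    norm_cast
  rw [this]
  simp

theorem nrm2_eq_sqrt {f : ℝ → ℂ} (hf : MemLp f 2 volume) : nrm2 f = √(∫ x, ‖f x‖ ^ 2) := by
  rw [← nrm2_sq hf, Real.sqrt_sq (nrm2_nonneg f)]

theorem integrable_mul_of_memLp {f g : ℝ → ℂ} (hf : MemLp f 2 volume) (hg : MemLp g 2 volume) :
    Integrable (fun x => f x * g x) := hf.integrable_mul hg

theorem integral_norm_mul_le {f g : ℝ → ℂ} (hf : MemLp f 2 volume) (hg : MemLp g 2 volume) :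
    ∫ x, ‖f x * g x‖ ≤ nrm2 f * nrm2 g := by
  have h := integral_mul_norm_le_Lp_mul_Lq (μ := (volume : Measure ℝ)) (f := f) (g := g)
    (p := 2) (q := 2) (by exact Real.HolderConjugate.two_two) (by simpa using hf)
    (by simpa using hg)
  simp only [norm_mul]
  refine h.trans (le_of_eq ?_)
  rw [nrm2_eq_sqrt hf, nrm2_eq_sqrt hg, Real.sqrt_eq_rpow, Real.sqrt_eq_rpow]
  norm_num

theorem norm_integral_mul_le {f g : ℝ → ℂ} (hf : MemLp f 2 volume) (hg : MemLp g 2 volume) :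
    ‖∫ x, f x * g x‖ ≤ nrm2 f * nrm2 g :=
  (norm_integral_le_integral_norm _).trans (integral_norm_mul_le hf hg)

theorem nrm2_add_le {f g : ℝ → ℂ} (hf : MemLp f 2 volume) (hg : MemLp g 2 volume) :
    nrm2 (fun x => f x + g x) ≤ nrm2 f + nrm2 g := by
  rw [nrm2, nrm2, nrm2, ← ENNReal.toReal_add hf.eLpNorm_ne_top hg.eLpNorm_ne_top]
  exact ENNReal.toReal_mono (ENNReal.add_ne_top.2 ⟨hf.eLpNorm_ne_top, hg.eLpNorm_ne_top⟩)
    (eLpNorm_add_le hf.1 hg.1 (by norm_num))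

/-- The Fourier transform is self-transposed on integrable functions. -/
theorem integral_fourier_mul {f g : ℝ → ℂ} (hf : Integrable f) (hg : Integrable g) :
    ∫ ξ, 𝓕 f ξ * g ξ = ∫ x, f x * 𝓕 g x := by
  have := VectorFourier.integral_fourierIntegral_smul_eq_flip (L := innerₗ ℝ)
    Real.continuous_fourierChar continuous_inner hf hg
  rwa [flip_innerₗ] at this

theorem norm_fourier_le (f : ℝ → ℂ) (ξ : ℝ) : ‖𝓕 f ξ‖ ≤ ∫ x, ‖f x‖ :=
  VectorFourier.norm_fourierIntegral_le_integral_norm _ _ _ _ _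

theorem continuous_fourier {f : ℝ → ℂ} (hf : Integrable f) : Continuous (𝓕 f) :=
  VectorFourier.fourierIntegral_continuous Real.continuous_fourierChar continuous_inner hf

/-- Two locally integrable functions that have the same integrals against all real-valued Schwartz
functions agree almost everywhere. -/
theorem ae_eq_of_forall_schwartz {f g : ℝ → ℂ} (hf : LocallyIntegrable f)
    (hg : LocallyIntegrable g)
    (h : ∀ ψ : 𝓢(ℝ, ℂ), (∀ x, conj (ψ x) = ψ x) → ∫ x, ψ x * f x = ∫ x, ψ x * g x) :
    f =ᵐ[volume] g := by
  refine ae_eq_of_integral_contDiff_smul_eq hf hg fun ψ hψ hψ' => ?_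
  have h1 : ContDiff ℝ ∞ (fun x => (ψ x : ℂ)) := Complex.ofRealCLM.contDiff.comp hψ
  have h2 : HasCompactSupport (fun x => (ψ x : ℂ)) :=
    hψ'.comp_left (g := Complex.ofReal) Complex.ofReal_zero
  simpa using h (h2.toSchwartzMap h1) (fun x => by simp)

/-- The `L²` Fourier transform of an integrable function is given by the Fourier integral. -/
theorem coeFn_fourier_ae (g : Lp ℂ 2 (volume : Measure ℝ)) (hg : Integrable g) :
    ((𝓕 g : Lp ℂ 2 (volume : Measure ℝ)) : ℝ → ℂ) =ᵐ[volume] 𝓕 (g : ℝ → ℂ) := by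
  refine ae_eq_of_forall_schwartz ((Lp.memLp _).locallyIntegrable (by norm_num))
    (continuous_fourier hg).locallyIntegrable fun ψ _ => ?_
  have h := congrArg (fun T : 𝓢'(ℝ, ℂ) => T ψ) (Lp.fourier_toTemperedDistribution_eq g)
  simp only [TemperedDistribution.fourier_apply, Lp.toTemperedDistribution_apply,
    smul_eq_mul] at h
  rw [← h, SchwartzMap.fourier_coe, integral_fourier_mul ψ.integrable hg]

theorem fourier_congr {f g : ℝ → ℂ} (h : f =ᵐ[volume] g) : 𝓕 f = 𝓕 g := by
  ext ξ
  rw [Real.fourier_eq', Real.fourier_eq']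
  refine integral_congr_ae ?_
  filter_upwards [h] with x hx
  rw [hx]

theorem fourier_ae_eq_toLp {a : ℝ → ℂ} (h1 : Integrable a) (h2 : MemLp a 2 volume) :
    𝓕 a =ᵐ[volume] (𝓕 (h2.toLp a) : Lp ℂ 2 (volume : Measure ℝ)) := by
  have h := coeFn_fourier_ae (h2.toLp a) (h1.congr h2.coeFn_toLp.symm)
  rw [fourier_congr h2.coeFn_toLp] at h
  exact h.symm

theorem memLp_fourier {a : ℝ → ℂ} (h1 : Integrable a) (h2 : MemLp a 2 volume) :
    MemLp (𝓕 a) 2 volume :=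
  (memLp_congr_ae (fourier_ae_eq_toLp h1 h2)).2 (Lp.memLp _)

/-- Plancherel's theorem on `L¹ ∩ L²`. -/
theorem nrm2_fourier {a : ℝ → ℂ} (h1 : Integrable a) (h2 : MemLp a 2 volume) :
    nrm2 (𝓕 a) = nrm2 a := by
  rw [nrm2_congr (fourier_ae_eq_toLp h1 h2), nrm2_coeFn, Lp.norm_fourier_eq, ← nrm2_coeFn,
    nrm2_congr h2.coeFn_toLp]

/-! ### Elements of `H¹` on the Fourier side -/

namespace H

/-- The Fourier transform of an element of `H¹(ℝ)`, as a square integrable function. -/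
def hat (f : H 1) : Lp ℂ 2 (volume : Measure ℝ) := 𝓕 f.toL2

theorem toDistr_apply (f : H 1) (φ : 𝓢(ℝ, ℂ)) : f.toDistr φ = ∫ x, φ x * f.toL2 x := by
  rw [toL2_spec, Lp.toTemperedDistribution_apply]
  rfl

theorem toDistr_fourier (f : H 1) (ψ : 𝓢(ℝ, ℂ)) :
    f.toDistr (𝓕 ψ) = ∫ ξ, ψ ξ * f.hat ξ := by
  rw [toL2_spec, ← TemperedDistribution.fourier_apply, Lp.fourier_toTemperedDistribution_eq,
    Lp.toTemperedDistribution_apply]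
  rfl

theorem toL2_eq_of_toDistr {f : H 1} {g : Lp ℂ 2 (volume : Measure ℝ)}
    (h : f.toDistr = (g : 𝓢'(ℝ, ℂ))) : f.toL2 = g :=
  lp_toDistr_injective (by simpa [← toL2_spec] using h)

theorem toL2_sub (f g : H 1) : (f - g).toL2 = f.toL2 - g.toL2 := by
  apply toL2_eq_of_toDistr
  have h : (f - g).toDistr = f.toDistr - g.toDistr := rfl
  rw [h, toL2_spec, toL2_spec, ← Lp.toTemperedDistributionCLM_apply,
    ← Lp.toTemperedDistributionCLM_apply, ← Lp.toTemperedDistributionCLM_apply, map_sub]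

theorem hat_sub (f g : H 1) : (f - g).hat = f.hat - g.hat := by
  rw [hat, toL2_sub, hat, hat]
  exact (Lp.fourierTransformₗᵢ ℝ ℂ).map_sub _ _

theorem norm_hat (f : H 1) : ‖f.hat‖ = ‖f.toL2‖ := Lp.norm_fourier_eq _

/-- The weight `(1 + ξ²)^{1/2}` of `H¹(ℝ)`. -/
def weight (ξ : ℝ) : ℝ := (1 + ‖ξ‖ ^ 2) ^ ((1 : ℝ) / 2)

theorem weight_eq (ξ : ℝ) : weight ξ = √(1 + ξ ^ 2) := by
  rw [weight, Real.sqrt_eq_rpow, Real.norm_eq_abs, sq_abs]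

theorem one_le_weight (ξ : ℝ) : 1 ≤ weight ξ := by
  rw [weight_eq, Real.one_le_sqrt]
  nlinarith

theorem abs_le_weight (ξ : ℝ) : |ξ| ≤ weight ξ := by
  rw [weight_eq]
  exact Real.abs_le_sqrt (by linarith)

theorem continuous_weight : Continuous weight := by
  have : weight = fun ξ => √(1 + ξ ^ 2) := funext weight_eq
  rw [this]; fun_prop

/-- The norm of `H¹(ℝ)` is a weighted `L²` norm of the Fourier transform. -/
theorem fourier_bessel_ae (f : H 1) :
    ((𝓕 f.bessel : Lp ℂ 2 (volume : Measure ℝ)) : ℝ → ℂ) =ᵐ[volume]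
      fun ξ => (weight ξ : ℂ) * f.hat ξ := by
  have hw : (fun ξ : ℝ => (((1 + ‖ξ‖ ^ 2) ^ ((1 : ℝ) / 2) : ℝ) : ℂ)).HasTemperateGrowth := by
    fun_prop
  have hloc : LocallyIntegrable (f.hat : ℝ → ℂ) := (Lp.memLp f.hat).locallyIntegrable (by norm_num)
  refine ae_eq_of_forall_schwartz ((Lp.memLp _).locallyIntegrable (by norm_num))
    ?_ fun ψ _ => ?_
  · rw [← locallyIntegrableOn_univ] at hloc ⊢
    refine hloc.continuousOn_mul (g := fun ξ => (weight ξ : ℂ)) ?_ isOpen_univ.isLocallyClosed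
    exact (Complex.continuous_ofReal.comp continuous_weight).continuousOn
  · have h := congrArg (fun T : 𝓢'(ℝ, ℂ) => T ψ)
      (fourier_besselPotential_eq_smulLeftCLM_fourier_apply 1 f.toDistr)
    simp only [bessel_spec] at h
    rw [Lp.fourier_toTemperedDistribution_eq, toL2_spec, Lp.fourier_toTemperedDistribution_eq,
      smulLeftCLM_apply_apply, Lp.toTemperedDistribution_apply,
      Lp.toTemperedDistribution_apply] at h
    simp only [smul_eq_mul] at h
    rw [h]
    refine integral_congr_ae (Filter.Eventually.of_forall fun ξ => ?_)
    simp only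
    rw [SchwartzMap.smulLeftCLM_apply_apply hw, smul_eq_mul, weight, hat]
    ring

theorem memLp_weight_hat (f : H 1) : MemLp (fun ξ => (weight ξ : ℂ) * f.hat ξ) 2 volume :=
  (memLp_congr_ae f.fourier_bessel_ae).1 (Lp.memLp _)

theorem nrm2_weight_hat (f : H 1) : nrm2 (fun ξ => (weight ξ : ℂ) * f.hat ξ) = ‖f‖ := by
  rw [← nrm2_congr f.fourier_bessel_ae, nrm2_coeFn, Lp.norm_fourier_eq, norm_eq]

theorem norm_hat_le (f : H 1) : ‖f.hat‖ ≤ ‖f‖ := by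
  rw [← nrm2_weight_hat, ← nrm2_coeFn]
  refine nrm2_mono f.memLp_weight_hat (Filter.Eventually.of_forall fun ξ => ?_)
  rw [norm_mul, Complex.norm_real, Real.norm_eq_abs,
    abs_of_pos (zero_lt_one.trans_le (one_le_weight ξ))]
  exact le_mul_of_one_le_left (norm_nonneg _) (one_le_weight ξ)

theorem aestronglyMeasurable_hat (f : H 1) : AEStronglyMeasurable (f.hat : ℝ → ℂ) volume :=
  (Lp.memLp f.hat).1

theorem norm_mul_hat_le (f : H 1) (ξ : ℝ) :
    ‖(ξ : ℂ) * f.hat ξ‖ ≤ ‖(weight ξ : ℂ) * f.hat ξ‖ := by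
  rw [norm_mul, norm_mul, Complex.norm_real, Complex.norm_real, Real.norm_eq_abs, Real.norm_eq_abs,
    abs_of_pos (zero_lt_one.trans_le (one_le_weight ξ))]
  exact mul_le_mul_of_nonneg_right (abs_le_weight ξ) (norm_nonneg _)

theorem memLp_mul_hat (f : H 1) : MemLp (fun ξ : ℝ => (ξ : ℂ) * f.hat ξ) 2 volume :=
  f.memLp_weight_hat.mono
    (Complex.continuous_ofReal.aestronglyMeasurable.mul f.aestronglyMeasurable_hat)
    (Filter.Eventually.of_forall f.norm_mul_hat_le)

theorem nrm2_mul_hat_le (f : H 1) : nrm2 (fun ξ : ℝ => (ξ : ℂ) * f.hat ξ) ≤ ‖f‖ := by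
  rw [← nrm2_weight_hat]
  exact nrm2_mono f.memLp_weight_hat (Filter.Eventually.of_forall f.norm_mul_hat_le)

theorem memLp_inv_weight : MemLp (fun ξ : ℝ => ((weight ξ)⁻¹ : ℂ)) 2 volume := by
  have hm : AEStronglyMeasurable (fun ξ => ((weight ξ)⁻¹ : ℂ)) volume := by
    have : Continuous (fun ξ => ((weight ξ)⁻¹ : ℂ)) := by
      refine (Complex.continuous_ofReal.comp continuous_weight).inv₀ fun ξ => ?_
      exact Complex.ofReal_ne_zero.2 (zero_lt_one.trans_le (one_le_weight ξ)).ne'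
    exact this.aestronglyMeasurable
  rw [memLp_two_iff_integrable_sq_norm hm]
  refine integrable_inv_one_add_sq.congr (Filter.Eventually.of_forall fun ξ => ?_)
  simp only [norm_inv, Complex.norm_real, Real.norm_eq_abs]
  rw [weight_eq, abs_of_nonneg (Real.sqrt_nonneg _), inv_pow, Real.sq_sqrt (by positivity)]

theorem inv_weight_mul (f : H 1) :
    (fun ξ : ℝ => ((weight ξ)⁻¹ : ℂ) * ((weight ξ : ℂ) * f.hat ξ)) = (f.hat : ℝ → ℂ) := by
  ext ξ
  have : (weight ξ : ℂ) ≠ 0 :=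
    Complex.ofReal_ne_zero.2 (zero_lt_one.trans_le (one_le_weight ξ)).ne'
  field_simp

/-- The Fourier transform of an element of `H¹(ℝ)` is integrable. -/
theorem integrable_hat (f : H 1) : Integrable (f.hat : ℝ → ℂ) := by
  have := integrable_mul_of_memLp memLp_inv_weight f.memLp_weight_hat
  rwa [inv_weight_mul] at this

/-- The constant in the embedding of `H¹(ℝ)` into the bounded functions. -/
def embConst : ℝ := nrm2 (fun ξ : ℝ => ((weight ξ)⁻¹ : ℂ))

theorem embConst_nonneg : 0 ≤ embConst := nrm2_nonneg _

theorem integral_norm_hat_le (f : H 1) : ∫ ξ, ‖f.hat ξ‖ ≤ embConst * ‖f‖ := by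
  have := integral_norm_mul_le memLp_inv_weight f.memLp_weight_hat
  rw [nrm2_weight_hat] at this
  refine le_trans (le_of_eq ?_) this
  conv_lhs => rw [← inv_weight_mul]

/-- The underlying function of an element of `H¹(ℝ)` is real-valued. -/
theorem toL2_conj_ae (f : H 1) : (fun x => conj (f.toL2 x)) =ᵐ[volume] f.toL2 := by
  have h : (fun x => (f.toL2 x).im) =ᵐ[volume] 0 := by
    have hloc : LocallyIntegrable (f.toL2 : ℝ → ℂ) :=
      (Lp.memLp f.toL2).locallyIntegrable (by norm_num)
    have hloc' : LocallyIntegrable (fun x => (f.toL2 x).im) := fun x =>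
      (hloc x).imp fun s hs => ⟨hs.1, hs.2.im⟩
    refine ae_eq_zero_of_integral_contDiff_smul_eq_zero hloc' fun ψ hψ hψ' => ?_
    have h1 : ContDiff ℝ ∞ (fun x => (ψ x : ℂ)) := Complex.ofRealCLM.contDiff.comp hψ
    have h2 : HasCompactSupport (fun x => (ψ x : ℂ)) :=
      hψ'.comp_left (g := Complex.ofReal) Complex.ofReal_zero
    have h3 := f.isReal (h2.toSchwartzMap h1) (fun x => by simp)
    rw [toDistr_apply] at h3
    have h4 := integral_im (μ := (volume : Measure ℝ)) (𝕜 := ℂ)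
      (f := fun x => (h2.toSchwartzMap h1) x * f.toL2 x)
      (integrable_mul_of_memLp ((h2.toSchwartzMap h1).memLp 2 volume) (Lp.memLp _))
    rw [show RCLike.im (∫ x, (h2.toSchwartzMap h1) x * f.toL2 x) = 0 from h3] at h4
    rw [← h4]
    refine integral_congr_ae (Filter.Eventually.of_forall fun x => ?_)
    simp
  filter_upwards [h] with x hx
  exact Complex.conj_eq_iff_im.2 hx

/-- The complex conjugate of the Fourier transform. As the element of `H¹(ℝ)` is real, the Fourier
transform of this is the element itself, so that the inverse transform is not needed. -/
def chat (f : H 1) (ξ : ℝ) : ℂ := conj (f.hat ξ)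

theorem norm_chat (f : H 1) (ξ : ℝ) : ‖f.chat ξ‖ = ‖f.hat ξ‖ := RCLike.norm_conj _

theorem aestronglyMeasurable_chat (f : H 1) : AEStronglyMeasurable f.chat volume :=
  Complex.continuous_conj.comp_aestronglyMeasurable f.aestronglyMeasurable_hat

theorem integrable_chat (f : H 1) : Integrable f.chat :=
  f.integrable_hat.congr' f.aestronglyMeasurable_chat
    (Filter.Eventually.of_forall fun ξ => (f.norm_chat ξ).symm)

theorem memLp_chat (f : H 1) : MemLp f.chat 2 volume :=
  (Lp.memLp f.hat).of_le f.aestronglyMeasurable_chat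
    (Filter.Eventually.of_forall fun ξ => (f.norm_chat ξ).le)

/-- Fourier inversion; being the Fourier transform of an integrable function, an element of `H¹(ℝ)`
is almost everywhere equal to a bounded continuous function. -/
theorem toL2_eq_fourier_chat (f : H 1) : f.toL2 =ᵐ[volume] 𝓕 f.chat := by
  refine ae_eq_of_forall_schwartz ((Lp.memLp _).locallyIntegrable (by norm_num))
    (continuous_fourier f.integrable_chat).locallyIntegrable fun ψ hψ => ?_
  have h1 : ∀ ξ, conj (𝓕 (ψ : ℝ → ℂ) ξ) = (𝓕⁻ ψ) ξ := by
    intro ξ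
    rw [SchwartzMap.fourierInv_coe, Real.fourier_eq', Real.fourierInv_eq', ← integral_conj]
    refine integral_congr_ae (Filter.Eventually.of_forall fun x => ?_)
    simp only [smul_eq_mul, map_mul, hψ, ← Complex.exp_conj, Complex.conj_ofReal, Complex.conj_I]
    congr 2
    push_cast
    ring
  have h2 : ∫ x, ψ x * f.toL2 x = ∫ ξ, (𝓕⁻ ψ) ξ * f.hat ξ := by
    rw [← toDistr_apply, ← toDistr_fourier, fourier_fourierInv_eq]
  rw [← integral_fourier_mul ψ.integrable f.integrable_chat]
  have h3 := congrArg conj h2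
  rw [← integral_conj, ← integral_conj] at h3
  calc ∫ x, ψ x * f.toL2 x = ∫ x, conj (ψ x * f.toL2 x) := by
        refine integral_congr_ae ?_
        filter_upwards [f.toL2_conj_ae] with x hx
        rw [map_mul, hψ, hx]
    _ = ∫ ξ, 𝓕 (ψ : ℝ → ℂ) ξ * f.chat ξ := by
        rw [h3]
        refine integral_congr_ae (Filter.Eventually.of_forall fun ξ => ?_)
        simp only
        rw [← h1, map_mul, Complex.conj_conj, chat]

theorem norm_fourier_chat_le (f : H 1) (x : ℝ) : ‖𝓕 f.chat x‖ ≤ embConst * ‖f‖ := by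
  refine (norm_fourier_le _ _).trans ?_
  simp only [norm_chat]
  exact f.integral_norm_hat_le

end H

/-! ### The interaction representation of a weak solution -/

/-- The symbol `exp(i r (2πξ)³)` of the Airy group. -/
def phase (r ξ : ℝ) : ℂ := Complex.exp (((r * (2 * Real.pi * ξ) ^ 3 : ℝ) : ℂ) * Complex.I)

theorem norm_phase (r ξ : ℝ) : ‖phase r ξ‖ = 1 := Complex.norm_exp_ofReal_mul_I _

theorem phase_zero (ξ : ℝ) : phase 0 ξ = 1 := by simp [phase]

theorem conj_phase (r ξ : ℝ) : conj (phase r ξ) = phase (-r) ξ := by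
  rw [phase, phase, ← Complex.exp_conj, map_mul, Complex.conj_ofReal, Complex.conj_I]
  congr 1
  push_cast
  ring

theorem phase_neg_mul (r ξ : ℝ) : phase (-r) ξ * phase r ξ = 1 := by
  rw [phase, phase, ← Complex.exp_add]
  convert Complex.exp_zero using 2
  push_cast
  ring

theorem contDiff_ofReal_cubic (a : ℝ) :
    ContDiff ℝ ∞ (fun ξ : ℝ => ((a * (2 * Real.pi * ξ) ^ 3 : ℝ) : ℂ)) :=
  Complex.ofRealCLM.contDiff.comp (f := fun ξ : ℝ => a * (2 * Real.pi * ξ) ^ 3) (by fun_prop)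

theorem contDiff_phase (r : ℝ) : ContDiff ℝ ∞ (phase r) := by
  unfold phase
  refine Complex.contDiff_exp.comp (ContDiff.mul (contDiff_ofReal_cubic r) contDiff_const)

theorem hasDerivAt_phase (r ξ : ℝ) :
    HasDerivAt (fun r => phase r ξ)
      (((2 * Real.pi * ξ) ^ 3 : ℝ) * Complex.I * phase r ξ) r := by
  have h : HasDerivAt (fun r : ℝ => ((r * (2 * Real.pi * ξ) ^ 3 : ℝ) : ℂ) * Complex.I)
      (((2 * Real.pi * ξ) ^ 3 : ℝ) * Complex.I) r := by
    refine HasDerivAt.mul_const (HasDerivAt.ofReal_comp ?_) _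
    simpa using (hasDerivAt_id r).mul_const ((2 * Real.pi * ξ) ^ 3)
  exact (h.cexp).congr_deriv (mul_comm _ _)

theorem norm_phase_sub_le (r r' ξ : ℝ) :
    ‖phase r ξ - phase r' ξ‖ ≤ |r - r'| * |(2 * Real.pi * ξ) ^ 3| := by
  have h := Convex.norm_image_sub_le_of_norm_hasDerivWithin_le (s := Set.univ) (x := r') (y := r)
    (C := |(2 * Real.pi * ξ) ^ 3|)
    (fun x _ => (hasDerivAt_phase x ξ).hasDerivWithinAt) (fun x _ => by
      rw [norm_mul, norm_mul, norm_phase, Complex.norm_real, Complex.norm_I, mul_one, mul_one,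
        Real.norm_eq_abs]) convex_univ trivial trivial
  rwa [Real.norm_eq_abs, mul_comm] at h

/-- Smooth functions with compact support. -/
structure IsTest (ψ : ℝ → ℂ) : Prop where
  contDiff : ContDiff ℝ ∞ ψ
  hasCompactSupport : HasCompactSupport ψ

namespace IsTest

variable {ψ : ℝ → ℂ}

/-- A smooth function with compact support as a Schwartz function. -/
def toSchwartz (h : IsTest ψ) : 𝓢(ℝ, ℂ) := h.hasCompactSupport.toSchwartzMap h.contDiff

@[simp]
theorem toSchwartz_apply (h : IsTest ψ) (x : ℝ) : h.toSchwartz x = ψ x := rfl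

theorem coe_toSchwartz (h : IsTest ψ) : ⇑h.toSchwartz = ψ := rfl

theorem continuous (h : IsTest ψ) : Continuous ψ := h.contDiff.continuous

theorem integrable (h : IsTest ψ) : Integrable ψ := h.toSchwartz.integrable

theorem memLp (h : IsTest ψ) : MemLp ψ 2 volume := h.toSchwartz.memLp 2 volume

theorem mul_left (h : IsTest ψ) {m : ℝ → ℂ} (hm : ContDiff ℝ ∞ m) :
    IsTest (fun ξ => m ξ * ψ ξ) :=
  ⟨hm.mul h.contDiff, h.hasCompactSupport.mul_left⟩

end IsTest

theorem contDiff_ofReal_mul_const (c : ℂ) : ContDiff ℝ ∞ (fun ξ : ℝ => c * (ξ : ℂ)) :=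
  contDiff_const.mul Complex.ofRealCLM.contDiff

/-- Multiplication by `-2πiξ`, the symbol of `∂ₓ` for the transposed Fourier transform. -/
theorem IsTest.derivCLM_fourier {ψ : ℝ → ℂ} (h : IsTest ψ) :
    SchwartzMap.derivCLM ℂ ℂ (𝓕 h.toSchwartz) =
      𝓕 (h.mul_left (contDiff_ofReal_mul_const (-2 * Real.pi * Complex.I))).toSchwartz := by
  ext x
  have h2 : Integrable (fun ξ : ℝ => ξ • ψ ξ) := by
    simpa using (h.mul_left (contDiff_ofReal_mul_const 1)).integrable
  rw [SchwartzMap.derivCLM_apply, SchwartzMap.fourier_coe, SchwartzMap.fourier_coe,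
    coe_toSchwartz, coe_toSchwartz, (Real.hasDerivAt_fourier h.integrable h2 x).deriv]
  rfl

/-- `f` solves `∂_σ f + c ∂ₓ³ f + ∂ₓ n = 0` in the sense of distributions in `x`. -/
structure WeakEvol (c : ℝ) (I : Set ℝ) (f : ℝ → H 1) (n : ℝ → ℝ → ℂ) : Prop where
  continuousOn : ContinuousOn f I
  integrable : ∀ τ ∈ I, Integrable (n τ)
  eq : ∀ τ ∈ I, ∀ φ : 𝓢(ℝ, ℂ), HasDerivWithinAt (fun σ => (f σ).toDistr φ)
    ((c : ℂ) * (f τ).toDistr ((SchwartzMap.derivCLM ℂ ℂ)^[3] φ) + ∫ x, n τ x * deriv φ x) I τ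

/-- The action of the Airy group on the Fourier side, on test functions. -/
theorem IsTest.phase_mul {ψ : ℝ → ℂ} (h : IsTest ψ) (r : ℝ) :
    IsTest (fun ξ => phase r ξ * ψ ξ) := h.mul_left (contDiff_phase r)

namespace WeakEvol

variable {c : ℝ} {I : Set ℝ} {f : ℝ → H 1} {n : ℝ → ℝ → ℂ}

/-- The Fourier transform of the equation, tested with `ψ`. -/
theorem hasDerivWithinAt_hat (h : WeakEvol c I f n) {ψ : ℝ → ℂ} (hψ : IsTest ψ) {τ : ℝ}
    (hτ : τ ∈ I) :
    HasDerivWithinAt (fun σ => ∫ ξ, ψ ξ * (f σ).hat ξ)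
      ((∫ ξ, ((c * (2 * Real.pi * ξ) ^ 3 : ℝ) * Complex.I * ψ ξ) * (f τ).hat ξ) +
        ∫ ξ, (-2 * Real.pi * Complex.I * ξ * ψ ξ) * 𝓕 (n τ) ξ) I τ := by
  have h1 := h.eq τ hτ (𝓕 hψ.toSchwartz)
  simp only [H.toDistr_fourier, Function.iterate_succ, Function.iterate_zero, Function.comp_apply,
    id_eq, IsTest.derivCLM_fourier, IsTest.toSchwartz_apply] at h1
  convert h1 using 1
  congr 1
  · rw [← integral_const_mul]
    refine integral_congr_ae (Filter.Eventually.of_forall fun ξ => ?_)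
    simp only
    push_cast
    linear_combination (c * 8 * Real.pi ^ 3 * ξ ^ 3 * ψ ξ * (f τ).hat ξ * Complex.I) *
      Complex.I_sq
  · have h2 : deriv ⇑(𝓕 hψ.toSchwartz : 𝓢(ℝ, ℂ)) =
        SchwartzMap.derivCLM ℂ ℂ (𝓕 hψ.toSchwartz) := rfl
    rw [h2, hψ.derivCLM_fourier, SchwartzMap.fourier_coe,
      ← integral_fourier_mul (h.integrable τ hτ) (SchwartzMap.integrable _)]
    refine integral_congr_ae (Filter.Eventually.of_forall fun ξ => ?_)
    simp only [IsTest.toSchwartz_apply]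
    ring

theorem hasDerivAt_integral_phase (c : ℝ) {ψ : ℝ → ℂ} (hψ : IsTest ψ) (w : H 1) (τ : ℝ) :
    HasDerivAt (fun σ => ∫ ξ, (phase (-(c * σ)) ξ * ψ ξ) * w.hat ξ)
      (∫ ξ, (-((c * (2 * Real.pi * ξ) ^ 3 : ℝ) : ℂ) * Complex.I * (phase (-(c * τ)) ξ * ψ ξ))
        * w.hat ξ) τ := by
  have hb : IsTest (fun ξ => ((c * (2 * Real.pi * ξ) ^ 3 : ℝ) : ℂ) * ψ ξ) :=
    hψ.mul_left (contDiff_ofReal_cubic c)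
  refine (hasDerivAt_integral_of_dominated_loc_of_deriv_le (μ := (volume : Measure ℝ))
    (F := fun σ ξ => (phase (-(c * σ)) ξ * ψ ξ) * w.hat ξ)
    (F' := fun σ ξ => (-((c * (2 * Real.pi * ξ) ^ 3 : ℝ) : ℂ) * Complex.I *
      (phase (-(c * σ)) ξ * ψ ξ)) * w.hat ξ)
    (bound := fun ξ => ‖(((c * (2 * Real.pi * ξ) ^ 3 : ℝ) : ℂ) * ψ ξ) * w.hat ξ‖)
    (s := Set.univ) Filter.univ_mem ?_ ?_ ?_ ?_ ?_ ?_).2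
  · exact Filter.Eventually.of_forall fun σ =>
      (integrable_mul_of_memLp (hψ.phase_mul _).memLp (Lp.memLp _)).1
  · exact integrable_mul_of_memLp (hψ.phase_mul _).memLp (Lp.memLp _)
  · have h1 : IsTest (fun ξ => -((c * (2 * Real.pi * ξ) ^ 3 : ℝ) : ℂ) * Complex.I *
        (phase (-(c * τ)) ξ * ψ ξ)) :=
      (hψ.phase_mul _).mul_left
        ((contDiff_ofReal_cubic c).neg.mul contDiff_const)
    exact (integrable_mul_of_memLp h1.memLp (Lp.memLp _)).1
  · refine Filter.Eventually.of_forall fun ξ σ _ => le_of_eq ?_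
    simp only [norm_mul, norm_neg, norm_phase, Complex.norm_I, one_mul, mul_one]
  · exact (integrable_mul_of_memLp hb.memLp (Lp.memLp _)).norm
  · refine Filter.Eventually.of_forall fun ξ σ _ => ?_
    have h1 : HasDerivAt (fun σ : ℝ => -(c * σ)) (-c) σ := by
      simpa using (hasDerivAt_id σ).const_mul (-c)
    have h2 := ((hasDerivAt_phase (-(c * σ)) ξ).scomp σ h1)
    have h3 := (h2.mul_const (ψ ξ)).mul_const (w.hat ξ)
    refine h3.congr_deriv ?_
    rw [Complex.real_smul]
    push_cast
    ring

/-- The product of the increments of the phase and of the solution is of higher order. -/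
theorem hasDerivWithinAt_increments (h : WeakEvol c I f n) {ψ : ℝ → ℂ} (hψ : IsTest ψ) {τ : ℝ}
    (hτ : τ ∈ I) :
    HasDerivWithinAt (fun σ => ∫ ξ, ((phase (-(c * σ)) ξ - phase (-(c * τ)) ξ) * ψ ξ) *
      ((f σ).hat ξ - (f τ).hat ξ)) 0 I τ := by
  have hb : IsTest (fun ξ => ((c * (2 * Real.pi * ξ) ^ 3 : ℝ) : ℂ) * ψ ξ) :=
    hψ.mul_left (contDiff_ofReal_cubic c)
  have hest : ∀ σ, ‖∫ ξ, ((phase (-(c * σ)) ξ - phase (-(c * τ)) ξ) * ψ ξ) *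
      ((f σ).hat ξ - (f τ).hat ξ)‖ ≤ |σ - τ| *
        (nrm2 (fun ξ => ((c * (2 * Real.pi * ξ) ^ 3 : ℝ) : ℂ) * ψ ξ) * ‖f σ - f τ‖) := by
    intro σ
    have hm : MemLp (fun ξ => (phase (-(c * σ)) ξ - phase (-(c * τ)) ξ) * ψ ξ) 2 volume :=
      (hψ.mul_left ((contDiff_phase _).sub (contDiff_phase _))).memLp
    have e1 : ∫ ξ, ((phase (-(c * σ)) ξ - phase (-(c * τ)) ξ) * ψ ξ) *
        ((f σ).hat ξ - (f τ).hat ξ) =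
        ∫ ξ, ((phase (-(c * σ)) ξ - phase (-(c * τ)) ξ) * ψ ξ) * (f σ - f τ).hat ξ := by
      refine integral_congr_ae ?_
      rw [H.hat_sub]
      filter_upwards [Lp.coeFn_sub (f σ).hat (f τ).hat] with ξ hξ
      rw [hξ, Pi.sub_apply]
    rw [e1]
    refine (norm_integral_mul_le hm (Lp.memLp _)).trans ?_
    rw [nrm2_coeFn, ← mul_assoc]
    refine mul_le_mul ?_ (H.norm_hat_le _) (norm_nonneg _)
      (mul_nonneg (abs_nonneg _) (nrm2_nonneg _))
    have e2 : |σ - τ| = ‖((σ - τ : ℝ) : ℂ)‖ := by rw [Complex.norm_real, Real.norm_eq_abs]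
    rw [e2, ← nrm2_const_mul]
    refine nrm2_mono (hb.mul_left contDiff_const).memLp (Filter.Eventually.of_forall fun ξ => ?_)
    rw [norm_mul, norm_mul, norm_mul, ← mul_assoc]
    refine mul_le_mul_of_nonneg_right ?_ (norm_nonneg _)
    refine (norm_phase_sub_le _ _ _).trans (le_of_eq ?_)
    rw [Complex.norm_real, Complex.norm_real, Real.norm_eq_abs, Real.norm_eq_abs, ← abs_mul,
      ← abs_mul, ← abs_neg]
    congr 1
    ring
  have hlim : Filter.Tendsto (fun σ => nrm2 (fun ξ => ((c * (2 * Real.pi * ξ) ^ 3 : ℝ) : ℂ) *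
      ψ ξ) * ‖f σ - f τ‖) (nhdsWithin τ I) (nhds 0) := by
    have h4 : Filter.Tendsto (fun σ => ‖f σ - f τ‖) (nhdsWithin τ I) (nhds 0) :=
      tendsto_iff_norm_sub_tendsto_zero.1 (h.continuousOn τ hτ)
    have h5 := h4.const_mul (nrm2 (fun ξ => ((c * (2 * Real.pi * ξ) ^ 3 : ℝ) : ℂ) * ψ ξ))
    rwa [mul_zero] at h5
  have h0 : ∫ ξ, ((phase (-(c * τ)) ξ - phase (-(c * τ)) ξ) * ψ ξ) *
      ((f τ).hat ξ - (f τ).hat ξ) = 0 :=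
    integral_eq_zero_of_ae (Filter.Eventually.of_forall fun ξ => by simp)
  rw [hasDerivWithinAt_iff_isLittleO, Asymptotics.isLittleO_iff]
  intro ε hε
  filter_upwards [hlim.eventually (gt_mem_nhds hε)] with σ hσ
  rw [h0, sub_zero, smul_zero, sub_zero, Real.norm_eq_abs, mul_comm ε]
  exact (hest σ).trans (mul_le_mul_of_nonneg_left hσ.le (abs_nonneg _))

/-- The Duhamel formula in differential form: in the interaction representation only the
nonlinearity is left in the equation. -/
theorem hasDerivWithinAt_interaction (h : WeakEvol c I f n) {ψ : ℝ → ℂ} (hψ : IsTest ψ) {τ : ℝ}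
    (hτ : τ ∈ I) :
    HasDerivWithinAt (fun σ => ∫ ξ, (phase (-(c * σ)) ξ * ψ ξ) * (f σ).hat ξ)
      (∫ ξ, (-2 * Real.pi * Complex.I * ξ * (phase (-(c * τ)) ξ * ψ ξ)) * 𝓕 (n τ) ξ) I τ := by
  have h1 := h.hasDerivWithinAt_hat (hψ.phase_mul (-(c * τ))) hτ
  have h2 := (hasDerivAt_integral_phase c hψ (f τ) τ).hasDerivWithinAt (s := I)
  have h3 := h.hasDerivWithinAt_increments hψ hτ
  have h4 := ((h1.add h2).add h3).sub_const (∫ ξ, (phase (-(c * τ)) ξ * ψ ξ) * (f τ).hat ξ)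
  -- the product rule: one factor varies at a time, up to the product of the increments
  have key : ∀ σ, ∫ ξ, (phase (-(c * σ)) ξ * ψ ξ) * (f σ).hat ξ =
      (∫ ξ, (phase (-(c * τ)) ξ * ψ ξ) * (f σ).hat ξ) +
      (∫ ξ, (phase (-(c * σ)) ξ * ψ ξ) * (f τ).hat ξ) +
      (∫ ξ, ((phase (-(c * σ)) ξ - phase (-(c * τ)) ξ) * ψ ξ) * ((f σ).hat ξ - (f τ).hat ξ)) -
      ∫ ξ, (phase (-(c * τ)) ξ * ψ ξ) * (f τ).hat ξ := by
    intro σ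
    have i1 := integrable_mul_of_memLp (hψ.phase_mul (-(c * τ))).memLp (Lp.memLp (f σ).hat)
    have i2 := integrable_mul_of_memLp (hψ.phase_mul (-(c * σ))).memLp (Lp.memLp (f τ).hat)
    have i3 := integrable_mul_of_memLp (hψ.phase_mul (-(c * τ))).memLp (Lp.memLp (f τ).hat)
    have i4 := integrable_mul_of_memLp (hψ.phase_mul (-(c * σ))).memLp (Lp.memLp (f σ).hat)
    have e : ∫ ξ, ((phase (-(c * σ)) ξ - phase (-(c * τ)) ξ) * ψ ξ) *
        ((f σ).hat ξ - (f τ).hat ξ) = ∫ ξ, ((phase (-(c * σ)) ξ * ψ ξ * (f σ).hat ξ -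
          phase (-(c * τ)) ξ * ψ ξ * (f σ).hat ξ) - (phase (-(c * σ)) ξ * ψ ξ * (f τ).hat ξ -
          phase (-(c * τ)) ξ * ψ ξ * (f τ).hat ξ)) :=
      integral_congr_ae (Filter.Eventually.of_forall fun ξ => by ring)
    have i5 : Integrable (fun ξ => phase (-(c * σ)) ξ * ψ ξ * (f σ).hat ξ -
        phase (-(c * τ)) ξ * ψ ξ * (f σ).hat ξ) := i4.sub i1
    have i6 : Integrable (fun ξ => phase (-(c * σ)) ξ * ψ ξ * (f τ).hat ξ -
        phase (-(c * τ)) ξ * ψ ξ * (f τ).hat ξ) := i2.sub i3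
    rw [e, integral_sub i5 i6, integral_sub i4 i1, integral_sub i2 i3]
    ring
  refine (h4.congr (fun σ _ => key σ) (key τ)).congr_deriv ?_
  rw [add_zero, add_right_comm, ← integral_add]
  · convert zero_add _
    refine integral_eq_zero_of_ae (Filter.Eventually.of_forall fun ξ => ?_)
    simp only [Pi.zero_apply]
    ring
  · have hb : IsTest (fun ξ => ((c * (2 * Real.pi * ξ) ^ 3 : ℝ) : ℂ) * Complex.I *
        (phase (-(c * τ)) ξ * ψ ξ)) := (hψ.phase_mul _).mul_left
      ((contDiff_ofReal_cubic c).mul contDiff_const)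
    exact integrable_mul_of_memLp hb.memLp (Lp.memLp _)
  · have hb : IsTest (fun ξ => -((c * (2 * Real.pi * ξ) ^ 3 : ℝ) : ℂ) * Complex.I *
        (phase (-(c * τ)) ξ * ψ ξ)) := (hψ.phase_mul _).mul_left
      ((contDiff_ofReal_cubic c).neg.mul contDiff_const)
    exact integrable_mul_of_memLp hb.memLp (Lp.memLp _)

end WeakEvol

/-! ### The energy identity with a frequency cutoff -/

section Hilbert

variable {E : Type*} [NormedAddCommGroup E] [InnerProductSpace ℂ E] {I : Set ℝ} {w g : ℝ → E}
  {D : Set E} {C : ℝ}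

/-- A curve in a Hilbert space whose weak derivative against a dense set of vectors is bounded is
Lipschitz continuous. -/
theorem norm_sub_le_of_weak_deriv (hI : Convex ℝ I) (hD : Dense D) (hg : ∀ τ ∈ I, ‖g τ‖ ≤ C)
    (hw : ∀ φ ∈ D, ∀ τ ∈ I,
      HasDerivWithinAt (fun σ => inner ℂ φ (w σ)) (inner ℂ φ (g τ)) I τ)
    {σ τ : ℝ} (hσ : σ ∈ I) (hτ : τ ∈ I) : ‖w σ - w τ‖ ≤ C * |σ - τ| := by
  have h1 : ∀ φ : E, ‖inner ℂ φ (w σ - w τ)‖ ≤ ‖φ‖ * (C * |σ - τ|) := by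
    intro φ
    refine hD.induction (P := fun φ => ‖inner ℂ φ (w σ - w τ)‖ ≤ ‖φ‖ * (C * |σ - τ|))
      (fun φ hφ => ?_) (isClosed_le (by fun_prop) (by fun_prop)) φ
    have h2 := Convex.norm_image_sub_le_of_norm_hasDerivWithin_le (C := ‖φ‖ * C) (hw φ hφ)
      (fun ρ hρ => (norm_inner_le_norm _ _).trans
        (mul_le_mul_of_nonneg_left (hg ρ hρ) (norm_nonneg _))) hI hτ hσ
    rw [inner_sub_right]
    rwa [Real.norm_eq_abs, mul_assoc] at h2
  rcases eq_or_lt_of_le (norm_nonneg (w σ - w τ)) with h0 | h0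
  · rw [← h0]
    exact mul_nonneg ((norm_nonneg _).trans (hg τ hτ)) (abs_nonneg _)
  · have h3 := h1 (w σ - w τ)
    rw [inner_self_eq_norm_sq_to_K, norm_pow, RCLike.norm_ofReal, abs_norm, sq] at h3
    exact le_of_mul_le_mul_left h3 h0

/-- A bounded weak derivative against a dense set of vectors is a weak derivative. -/
theorem hasDerivWithinAt_inner_of_weak_deriv (hI : Convex ℝ I) (hD : Dense D)
    (hg : ∀ τ ∈ I, ‖g τ‖ ≤ C)
    (hw : ∀ φ ∈ D, ∀ τ ∈ I,
      HasDerivWithinAt (fun σ => inner ℂ φ (w σ)) (inner ℂ φ (g τ)) I τ)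
    {τ : ℝ} (hτ : τ ∈ I) (φ : E) :
    HasDerivWithinAt (fun σ => inner ℂ φ (w σ)) (inner ℂ φ (g τ)) I τ := by
  have hC : 0 ≤ C := (norm_nonneg _).trans (hg τ hτ)
  rw [hasDerivWithinAt_iff_isLittleO, Asymptotics.isLittleO_iff]
  intro ε hε
  obtain ⟨ψ, hψD, hψ⟩ := hD.exists_dist_lt φ (ε := ε / (2 * (2 * C + 1))) (by positivity)
  have h1 := hw ψ hψD τ hτ
  rw [hasDerivWithinAt_iff_isLittleO, Asymptotics.isLittleO_iff] at h1
  filter_upwards [h1 (half_pos hε), self_mem_nhdsWithin] with σ hσ hσI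
  have h2 : inner ℂ φ (w σ) - inner ℂ φ (w τ) - (σ - τ) • inner ℂ φ (g τ) =
      (inner ℂ ψ (w σ) - inner ℂ ψ (w τ) - (σ - τ) • inner ℂ ψ (g τ)) +
        (inner ℂ (φ - ψ) (w σ - w τ) - (σ - τ) • inner ℂ (φ - ψ) (g τ)) := by
    simp only [inner_sub_left, inner_sub_right, smul_sub]
    ring
  rw [h2]
  have h3 : ‖inner ℂ (φ - ψ) (w σ - w τ)‖ ≤ ‖φ - ψ‖ * (C * |σ - τ|) :=
    (norm_inner_le_norm _ _).trans (mul_le_mul_of_nonneg_left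
      (norm_sub_le_of_weak_deriv hI hD hg hw hσI hτ) (norm_nonneg _))
  have h4 : ‖(σ - τ) • inner ℂ (φ - ψ) (g τ)‖ ≤ |σ - τ| * (‖φ - ψ‖ * C) := by
    rw [norm_smul, Real.norm_eq_abs]
    exact mul_le_mul_of_nonneg_left ((norm_inner_le_norm _ _).trans
      (mul_le_mul_of_nonneg_left (hg τ hτ) (norm_nonneg _))) (abs_nonneg _)
  rw [dist_eq_norm] at hψ
  have h5 : ‖φ - ψ‖ * (2 * C) ≤ ε / 2 := by
    have h6 : ‖φ - ψ‖ * (2 * (2 * C + 1)) < ε := (lt_div_iff₀ (by positivity)).1 hψ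
    nlinarith [norm_nonneg (φ - ψ)]
  have h7 := norm_add_le (inner ℂ ψ (w σ) - inner ℂ ψ (w τ) - (σ - τ) • inner ℂ ψ (g τ))
    (inner ℂ (φ - ψ) (w σ - w τ) - (σ - τ) • inner ℂ (φ - ψ) (g τ))
  have h8 := norm_sub_le (inner ℂ (φ - ψ) (w σ - w τ)) ((σ - τ) • inner ℂ (φ - ψ) (g τ))
  rw [Real.norm_eq_abs] at hσ ⊢
  nlinarith [abs_nonneg (σ - τ)]

/-- The norm of a weakly differentiable curve is differentiable, because a bounded weak derivative
makes the term `‖w σ - w τ‖²` in the expansion of `‖w σ‖²` of second order in `σ - τ`. -/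
theorem hasDerivWithinAt_norm_sq_of_weak_deriv (hI : Convex ℝ I) (hD : Dense D)
    (hg : ∀ τ ∈ I, ‖g τ‖ ≤ C)
    (hw : ∀ φ ∈ D, ∀ τ ∈ I,
      HasDerivWithinAt (fun σ => inner ℂ φ (w σ)) (inner ℂ φ (g τ)) I τ)
    {τ : ℝ} (hτ : τ ∈ I) :
    HasDerivWithinAt (fun σ => ‖w σ‖ ^ 2) (2 * (inner ℂ (w τ) (g τ)).re) I τ := by
  have h1 := hasDerivWithinAt_inner_of_weak_deriv hI hD hg hw hτ (w τ)
  have h2 : HasDerivWithinAt (fun σ => (inner ℂ (w τ) (w σ)).re) (inner ℂ (w τ) (g τ)).re I τ := by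
    exact Complex.reCLM.hasFDerivAt.comp_hasDerivWithinAt τ h1
  have hC : 0 ≤ C := (norm_nonneg _).trans (hg τ hτ)
  have h3 : HasDerivWithinAt (fun σ => ‖w σ - w τ‖ ^ 2) 0 I τ := by
    rw [hasDerivWithinAt_iff_isLittleO, Asymptotics.isLittleO_iff]
    intro ε hε
    have hlim : Filter.Tendsto (fun σ => C ^ 2 * |σ - τ|) (nhdsWithin τ I) (nhds 0) := by
      have : Continuous (fun σ => C ^ 2 * |σ - τ|) := by fun_prop
      have h := this.tendsto τ
      simp only [sub_self, abs_zero, mul_zero] at h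
      exact h.mono_left nhdsWithin_le_nhds
    filter_upwards [hlim.eventually (gt_mem_nhds hε), self_mem_nhdsWithin] with σ hσ hσI
    rw [sub_self, norm_zero, smul_zero, sub_zero, Real.norm_eq_abs, Real.norm_eq_abs,
      zero_pow two_ne_zero, sub_zero, abs_of_nonneg (sq_nonneg _)]
    have h4 := norm_sub_le_of_weak_deriv hI hD hg hw hσI hτ
    calc ‖w σ - w τ‖ ^ 2 ≤ (C * |σ - τ|) ^ 2 := by gcongr
      _ = C ^ 2 * |σ - τ| * |σ - τ| := by ring
      _ ≤ ε * |σ - τ| := mul_le_mul_of_nonneg_right hσ.le (abs_nonneg _)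
  have h5 := ((h2.const_mul 2).add h3).sub_const (‖w τ‖ ^ 2)
  have key : ∀ σ, ‖w σ‖ ^ 2 =
      2 * (inner ℂ (w τ) (w σ)).re + ‖w σ - w τ‖ ^ 2 - ‖w τ‖ ^ 2 := by
    intro σ
    have h6 := @norm_sub_sq ℂ E _ _ _ (w τ) (w σ)
    rw [norm_sub_rev, RCLike.re_eq_complex_re] at h6
    linarith
  refine (h5.congr (fun σ _ => key σ) (key τ)).congr_deriv ?_
  ring

end Hilbert

theorem IsTest.exists_bound {ψ : ℝ → ℂ} (h : IsTest ψ) : ∃ B, ∀ ξ, ‖ψ ξ‖ ≤ B :=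
  h.hasCompactSupport.exists_bound_of_continuous h.continuous

theorem IsTest.memLp_mul {ψ w : ℝ → ℂ} (h : IsTest ψ) (hw : MemLp w 2 volume) :
    MemLp (fun ξ => ψ ξ * w ξ) 2 volume := by
  obtain ⟨B, hB⟩ := h.exists_bound
  refine MemLp.of_le_mul (c := B) hw (h.continuous.aestronglyMeasurable.mul hw.1)
    (Filter.Eventually.of_forall fun ξ => ?_)
  rw [norm_mul]
  exact mul_le_mul_of_nonneg_right (hB ξ) (norm_nonneg _)

theorem IsTest.integrable_mul {ψ w : ℝ → ℂ} (h : IsTest ψ) (hw : MemLp w 2 volume) :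
    Integrable (fun ξ => ψ ξ * w ξ) := integrable_mul_of_memLp h.memLp hw

theorem IsTest.mul_schwartz {χ : ℝ → ℂ} (h : IsTest χ) (φ : 𝓢(ℝ, ℂ)) :
    IsTest (fun ξ => conj (φ ξ) * χ ξ) :=
  h.mul_left (Complex.conjCLE.contDiff.comp φ.smooth')

theorem IsTest.memLp_mul_fourier {ψ n : ℝ → ℂ} (h : IsTest ψ) (hn : Integrable n) :
    MemLp (fun ξ => ψ ξ * 𝓕 n ξ) 2 volume := by
  refine MemLp.of_le_mul (c := ∫ x, ‖n x‖) h.memLp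
    (h.continuous.mul (continuous_fourier hn)).aestronglyMeasurable
    (Filter.Eventually.of_forall fun ξ => ?_)
  rw [norm_mul, mul_comm]
  exact mul_le_mul_of_nonneg_right (norm_fourier_le _ _) (norm_nonneg _)

theorem IsTest.nrm2_mul_fourier_le {ψ n : ℝ → ℂ} (h : IsTest ψ) :
    nrm2 (fun ξ => ψ ξ * 𝓕 n ξ) ≤ (∫ x, ‖n x‖) * nrm2 ψ := by
  have h0 : 0 ≤ ∫ x, ‖n x‖ := integral_nonneg fun x => norm_nonneg _
  have e : (∫ x, ‖n x‖) * nrm2 ψ = nrm2 (fun ξ => ((∫ x, ‖n x‖ : ℝ) : ℂ) * ψ ξ) := by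
    rw [nrm2_const_mul, Complex.norm_real, Real.norm_eq_abs, abs_of_nonneg h0]
  rw [e]
  refine nrm2_mono (h.memLp.const_mul _) (Filter.Eventually.of_forall fun ξ => ?_)
  rw [norm_mul, norm_mul, mul_comm, Complex.norm_real, Real.norm_eq_abs, abs_of_nonneg h0]
  exact mul_le_mul_of_nonneg_right (norm_fourier_le _ _) (norm_nonneg _)

namespace WeakEvol

variable {c : ℝ} {I : Set ℝ} {f : ℝ → H 1} {n : ℝ → ℝ → ℂ}

/-- The derivative of the part of the `L²` norm that a real cutoff `χ` selects in frequency. In the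
interaction representation, which has the same norm, the linear part of the equation does not
contribute. -/
theorem hasDerivWithinAt_energy (h : WeakEvol c I f n) (hI : Convex ℝ I) {C : ℝ}
    (hC : ∀ τ ∈ I, ∫ x, ‖n τ x‖ ≤ C) {χ : ℝ → ℂ} (hχ : IsTest χ) (hχr : ∀ ξ, conj (χ ξ) = χ ξ)
    {τ : ℝ} (hτ : τ ∈ I) :
    HasDerivWithinAt (fun σ => nrm2 (fun ξ => χ ξ * (f σ).hat ξ) ^ 2)
      (2 * (∫ x, n τ x *
        𝓕 (fun ξ : ℝ => (-2 * Real.pi * Complex.I * ξ * (χ ξ ^ 2 * (f τ).chat ξ) : ℂ)) x).re)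
      I τ := by
  have hψ : IsTest (fun ξ : ℝ => -2 * Real.pi * Complex.I * ξ * χ ξ) :=
    hχ.mul_left (contDiff_ofReal_mul_const _)
  have hwm : ∀ σ, MemLp (fun ξ => phase (-(c * σ)) ξ * χ ξ * (f σ).hat ξ) 2 volume := fun σ =>
    (hχ.phase_mul _).memLp_mul (Lp.memLp _)
  have hψ' : ∀ σ, IsTest (fun ξ : ℝ => -2 * Real.pi * Complex.I * ξ * (phase (-(c * σ)) ξ * χ ξ)) :=
    fun σ => (hχ.phase_mul _).mul_left (contDiff_ofReal_mul_const _)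
  have hgm : ∀ σ, σ ∈ I → MemLp (fun ξ : ℝ => -2 * Real.pi * Complex.I * ξ *
      (phase (-(c * σ)) ξ * χ ξ) * 𝓕 (n σ) ξ) 2 volume := fun σ hσ =>
    (hψ' σ).memLp_mul_fourier (h.integrable σ hσ)
  -- the truncated curve in the interaction representation, and its weak derivative
  classical
  let w : ℝ → Lp ℂ 2 (volume : Measure ℝ) := fun σ => (hwm σ).toLp _
  let g : ℝ → Lp ℂ 2 (volume : Measure ℝ) := fun σ =>
    if hσ : σ ∈ I then (hgm σ hσ).toLp _ else 0
  have hg : ∀ σ ∈ I, ‖g σ‖ ≤ C * nrm2 (fun ξ : ℝ => -2 * Real.pi * Complex.I * ξ * χ ξ) := by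
    intro σ hσ
    simp only [g, dif_pos hσ]
    rw [← nrm2_coeFn, nrm2_congr (hgm σ hσ).coeFn_toLp]
    refine (hψ' σ).nrm2_mul_fourier_le.trans ?_
    refine mul_le_mul (hC σ hσ) ?_ (nrm2_nonneg _)
      ((integral_nonneg fun x => norm_nonneg _).trans (hC σ hσ))
    refine nrm2_mono hψ.memLp (Filter.Eventually.of_forall fun ξ => ?_)
    simp only [norm_mul, norm_phase, one_mul, le_refl]
  have hw : ∀ φ ∈ Set.range (SchwartzMap.toLpCLM ℝ (E := ℝ) ℂ 2 volume), ∀ ρ ∈ I,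
      HasDerivWithinAt (fun σ => inner ℂ φ (w σ)) (inner ℂ φ (g ρ)) I ρ := by
    rintro _ ⟨φ, rfl⟩ ρ hρ
    have h1 := h.hasDerivWithinAt_interaction (hχ.mul_schwartz φ) hρ
    have e1 : ∀ σ, inner ℂ (SchwartzMap.toLpCLM ℝ (E := ℝ) ℂ 2 volume φ) (w σ) =
        ∫ ξ, (phase (-(c * σ)) ξ * (conj (φ ξ) * χ ξ)) * (f σ).hat ξ := by
      intro σ
      rw [L2.inner_def]
      refine integral_congr_ae ?_
      filter_upwards [(hwm σ).coeFn_toLp, φ.coeFn_toLp 2 volume] with ξ h2 h3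
      simp only [w, SchwartzMap.toLpCLM_apply, RCLike.inner_apply]
      rw [h2, h3]
      ring
    have e2 : inner ℂ (SchwartzMap.toLpCLM ℝ (E := ℝ) ℂ 2 volume φ) (g ρ) =
        ∫ ξ, (-2 * Real.pi * Complex.I * ξ * (phase (-(c * ρ)) ξ * (conj (φ ξ) * χ ξ))) *
          𝓕 (n ρ) ξ := by
      rw [L2.inner_def]
      refine integral_congr_ae ?_
      filter_upwards [(hgm ρ hρ).coeFn_toLp, φ.coeFn_toLp 2 volume] with ξ h2 h3
      simp only [g, dif_pos hρ, SchwartzMap.toLpCLM_apply, RCLike.inner_apply]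
      rw [h2, h3]
      ring
    rw [e2]
    exact h1.congr (fun σ _ => e1 σ) (e1 ρ)
  have h1 := hasDerivWithinAt_norm_sq_of_weak_deriv hI
    (SchwartzMap.denseRange_toLpCLM (by norm_num)) hg hw hτ
  have e1 : ∀ σ, nrm2 (fun ξ => χ ξ * (f σ).hat ξ) ^ 2 = ‖w σ‖ ^ 2 := by
    intro σ
    rw [← nrm2_coeFn, nrm2_congr (hwm σ).coeFn_toLp, nrm2_sq (hwm σ),
      nrm2_sq (hχ.memLp_mul (Lp.memLp _))]
    simp only [norm_mul, norm_phase, one_mul]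
  refine (h1.congr (fun σ _ => e1 σ) (e1 τ)).congr_deriv ?_
  congr 2
  have hint : Integrable
      (fun ξ : ℝ => -2 * Real.pi * Complex.I * ξ * (χ ξ ^ 2 * (f τ).chat ξ)) := by
    have := (hψ.mul_left hχ.contDiff).integrable_mul (f τ).memLp_chat
    refine this.congr (Filter.Eventually.of_forall fun ξ => ?_)
    simp only
    ring
  rw [← integral_fourier_mul (h.integrable τ hτ) hint, L2.inner_def]
  refine integral_congr_ae ?_
  filter_upwards [(hwm τ).coeFn_toLp, (hgm τ hτ).coeFn_toLp] with ξ h2 h3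
  simp only [w, g, dif_pos hτ, RCLike.inner_apply]
  rw [h2, h3, map_mul, map_mul, conj_phase, hχr, H.chat]
  have h4 := phase_neg_mul (-(c * τ)) ξ
  linear_combination (-2 * Real.pi * Complex.I * ξ * χ ξ ^ 2 * conj ((f τ).hat ξ) *
    𝓕 (n τ) ξ) * h4

end WeakEvol

/-! ### Conservation of the `L²` norm -/

theorem memLp_bdd_mul {b F : ℝ → ℂ} {B : ℝ} (hbm : AEStronglyMeasurable b volume)
    (hb : ∀ x, ‖b x‖ ≤ B) (hF : MemLp F 2 volume) : MemLp (fun x => b x * F x) 2 volume := by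
  refine MemLp.of_le_mul (c := B) hF (hbm.mul hF.1) (Filter.Eventually.of_forall fun x => ?_)
  rw [norm_mul]
  exact mul_le_mul_of_nonneg_right (hb x) (norm_nonneg _)

theorem nrm2_bdd_mul_le {b F : ℝ → ℂ} {B : ℝ} (hb : ∀ x, ‖b x‖ ≤ B) (hF : MemLp F 2 volume) :
    nrm2 (fun x => b x * F x) ≤ B * nrm2 F := by
  have hB : 0 ≤ B := (norm_nonneg _).trans (hb 0)
  have e : B * nrm2 F = nrm2 (fun x => (B : ℂ) * F x) := by
    rw [nrm2_const_mul, Complex.norm_real, Real.norm_eq_abs, abs_of_nonneg hB]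
  rw [e]
  refine nrm2_mono (hF.const_mul _) (Filter.Eventually.of_forall fun x => ?_)
  rw [norm_mul, norm_mul, Complex.norm_real, Real.norm_eq_abs, abs_of_nonneg hB]
  exact mul_le_mul_of_nonneg_right (hb x) (norm_nonneg _)

theorem integrable_bdd_mul_mul {b F G : ℝ → ℂ} {B : ℝ} (hbm : AEStronglyMeasurable b volume)
    (hb : ∀ x, ‖b x‖ ≤ B) (hF : MemLp F 2 volume) (hG : MemLp G 2 volume) :
    Integrable (fun x => b x * F x * G x) :=
  integrable_mul_of_memLp (memLp_bdd_mul hbm hb hF) hG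

theorem norm_integral_bdd_mul_mul_le {b F G : ℝ → ℂ} {B : ℝ}
    (hbm : AEStronglyMeasurable b volume) (hb : ∀ x, ‖b x‖ ≤ B) (hF : MemLp F 2 volume)
    (hG : MemLp G 2 volume) :
    ‖∫ x, b x * F x * G x‖ ≤ B * nrm2 F * nrm2 G :=
  (norm_integral_mul_le (memLp_bdd_mul hbm hb hF) hG).trans
    (mul_le_mul_of_nonneg_right (nrm2_bdd_mul_le hb hF) (nrm2_nonneg _))

/-- A smooth real cutoff in frequency at the scale `N`. That `χ` is `1` at low frequencies enters
only through the bound of `1 - χ²` by `|ξ| / N`, which trades a derivative for a factor `1 / N`. -/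
structure IsCutoff (χ : ℝ → ℂ) (N : ℝ) : Prop extends IsTest χ where
  real : ∀ ξ, conj (χ ξ) = χ ξ
  norm_le : ∀ ξ, ‖χ ξ‖ ≤ 1
  norm_one_sub_sq_le : ∀ ξ, ‖1 - χ ξ ^ 2‖ ≤ |ξ| / N

theorem exists_isCutoff {N : ℝ} (hN : 0 < N) : ∃ χ, IsCutoff χ N := by
  let b : ContDiffBump (0 : ℝ) := ⟨N, N + 1, hN, by linarith⟩
  refine ⟨fun ξ => (b ξ : ℂ), ⟨?_, ?_⟩, ?_, ?_, ?_⟩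
  · exact Complex.ofRealCLM.contDiff.comp b.contDiff
  · exact b.hasCompactSupport.comp_left (g := Complex.ofReal) Complex.ofReal_zero
  · intro ξ
    exact Complex.conj_ofReal _
  · intro ξ
    rw [Complex.norm_real, Real.norm_eq_abs, abs_of_nonneg b.nonneg]
    exact b.le_one
  · intro ξ
    have e : ‖(1 : ℂ) - (b ξ : ℂ) ^ 2‖ = |1 - b ξ ^ 2| := by
      rw [← Real.norm_eq_abs, ← Complex.norm_real]
      push_cast
      rfl
    rw [e]
    rcases le_or_gt |ξ| N with h | h
    · have h1 : b ξ = 1 := b.one_of_mem_closedBall (by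
        rw [Metric.mem_closedBall, dist_zero_right, Real.norm_eq_abs]; exact h)
      rw [h1]
      simp only [one_pow, sub_self, abs_zero]
      positivity
    · have h1 : 1 ≤ |ξ| / N := by rw [le_div_iff₀ hN]; linarith
      have h2 : 0 ≤ b ξ := b.nonneg
      have h3 : b ξ ≤ 1 := b.le_one
      refine le_trans ?_ h1
      rw [abs_of_nonneg] <;> nlinarith

namespace IsCutoff

variable {χ : ℝ → ℂ} {N : ℝ} (h : IsCutoff χ N) (f : H 1)
include h

theorem norm_sq_le (ξ : ℝ) : ‖χ ξ ^ 2‖ ≤ 1 := by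
  rw [norm_pow]
  exact pow_le_one₀ (norm_nonneg _) (h.norm_le ξ)

theorem isTest_sq : IsTest (fun ξ => χ ξ ^ 2) := by
  have := h.toIsTest.mul_left h.contDiff
  simpa only [sq] using this

theorem integrable_sq_mul_chat : Integrable (fun ξ => χ ξ ^ 2 * f.chat ξ) :=
  h.isTest_sq.integrable_mul f.memLp_chat

theorem memLp_sq_mul_chat : MemLp (fun ξ => χ ξ ^ 2 * f.chat ξ) 2 volume :=
  h.isTest_sq.memLp_mul f.memLp_chat

theorem isTest_deriv : IsTest (fun ξ : ℝ => -2 * Real.pi * Complex.I * ξ * χ ξ ^ 2) :=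
  h.isTest_sq.mul_left (contDiff_ofReal_mul_const _)

theorem integrable_deriv :
    Integrable (fun ξ : ℝ => -2 * Real.pi * Complex.I * ξ * (χ ξ ^ 2 * f.chat ξ)) := by
  refine (h.isTest_deriv.integrable_mul f.memLp_chat).congr
    (Filter.Eventually.of_forall fun ξ => ?_)
  simp only
  ring

theorem memLp_deriv :
    MemLp (fun ξ : ℝ => -2 * Real.pi * Complex.I * ξ * (χ ξ ^ 2 * f.chat ξ)) 2 volume := by
  refine (memLp_congr_ae (Filter.Eventually.of_forall fun ξ => ?_)).1
    (h.isTest_deriv.memLp_mul f.memLp_chat)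
  ring

theorem hasDerivAt_fourier (x : ℝ) :
    HasDerivAt (𝓕 (fun ξ => χ ξ ^ 2 * f.chat ξ))
      (𝓕 (fun ξ : ℝ => (-2 * Real.pi * Complex.I * ξ * (χ ξ ^ 2 * f.chat ξ) : ℂ)) x) x := by
  refine Real.hasDerivAt_fourier (h.integrable_sq_mul_chat f) ?_ x
  have h1 : IsTest (fun ξ : ℝ => (1 : ℂ) * ξ * χ ξ ^ 2) :=
    h.isTest_sq.mul_left (contDiff_ofReal_mul_const 1)
  refine (h1.integrable_mul f.memLp_chat).congr (Filter.Eventually.of_forall fun ξ => ?_)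
  simp only [Complex.real_smul]
  ring

theorem nrm2_deriv_le :
    nrm2 (𝓕 (fun ξ : ℝ => (-2 * Real.pi * Complex.I * ξ * (χ ξ ^ 2 * f.chat ξ) : ℂ))) ≤
      2 * Real.pi * ‖f‖ := by
  rw [nrm2_fourier (h.integrable_deriv f) (h.memLp_deriv f)]
  have h1 : nrm2 (fun ξ : ℝ => (-2 * Real.pi * Complex.I) * ((ξ : ℂ) * f.hat ξ)) ≤
      2 * Real.pi * ‖f‖ := by
    rw [nrm2_const_mul]
    have e : ‖(-2 * Real.pi * Complex.I : ℂ)‖ = 2 * Real.pi := by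
      simp [abs_of_pos Real.pi_pos]
    rw [e]
    exact mul_le_mul_of_nonneg_left f.nrm2_mul_hat_le (by positivity)
  refine le_trans (nrm2_mono (f.memLp_mul_hat.const_mul _)
    (Filter.Eventually.of_forall fun ξ => ?_)) h1
  rw [show -2 * (Real.pi : ℂ) * Complex.I * ξ * (χ ξ ^ 2 * f.chat ξ) =
    χ ξ ^ 2 * ((-2 * Real.pi * Complex.I) * (ξ * f.chat ξ)) by ring, norm_mul]
  refine (mul_le_of_le_one_left (norm_nonneg _) (h.norm_sq_le ξ)).trans (le_of_eq ?_)
  simp only [norm_mul, H.norm_chat]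

theorem nrm2_one_sub_le (hN : 0 < N) :
    nrm2 (fun ξ => (1 - χ ξ ^ 2) * f.chat ξ) ≤ ‖f‖ / N := by
  have h1 : nrm2 (fun ξ : ℝ => ((N⁻¹ : ℝ) : ℂ) * ((ξ : ℂ) * f.hat ξ)) ≤ ‖f‖ / N := by
    rw [nrm2_const_mul, Complex.norm_real, Real.norm_eq_abs, abs_of_pos (inv_pos.2 hN),
      div_eq_inv_mul]
    exact mul_le_mul_of_nonneg_left f.nrm2_mul_hat_le (inv_pos.2 hN).le
  refine le_trans (nrm2_mono (f.memLp_mul_hat.const_mul _)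
    (Filter.Eventually.of_forall fun ξ => ?_)) h1
  rw [norm_mul, norm_mul, norm_mul, H.norm_chat, ← mul_assoc]
  refine mul_le_mul_of_nonneg_right ((h.norm_one_sub_sq_le ξ).trans (le_of_eq ?_)) (norm_nonneg _)
  rw [Complex.norm_real, Complex.norm_real, Real.norm_eq_abs, Real.norm_eq_abs,
    abs_of_pos (inv_pos.2 hN), div_eq_inv_mul]

theorem fourier_chat_sub (x : ℝ) :
    𝓕 f.chat x - 𝓕 (fun ξ => χ ξ ^ 2 * f.chat ξ) x =
      𝓕 (fun ξ : ℝ => ((1 - χ ξ ^ 2) * f.chat ξ : ℂ)) x := by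
  simp only [Real.fourier_eq]
  rw [← integral_sub]
  · refine integral_congr_ae (Filter.Eventually.of_forall fun ξ => ?_)
    simp only
    rw [← smul_sub]
    congr 1
    ring
  · exact (Real.fourierIntegral_convergent_iff x).2 f.integrable_chat
  · exact (Real.fourierIntegral_convergent_iff x).2 (h.integrable_sq_mul_chat f)

theorem integrable_one_sub : Integrable (fun ξ => (1 - χ ξ ^ 2) * f.chat ξ) := by
  refine (f.integrable_chat.sub (h.integrable_sq_mul_chat f)).congr
    (Filter.Eventually.of_forall fun ξ => ?_)
  simp only [Pi.sub_apply]
  ring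

theorem memLp_one_sub : MemLp (fun ξ => (1 - χ ξ ^ 2) * f.chat ξ) 2 volume := by
  refine (memLp_congr_ae (Filter.Eventually.of_forall fun ξ => ?_)).1
    (f.memLp_chat.sub (h.memLp_sq_mul_chat f))
  simp only [Pi.sub_apply]
  ring

theorem memLp_fourier_sub :
    MemLp (fun x => 𝓕 f.chat x - 𝓕 (fun ξ => χ ξ ^ 2 * f.chat ξ) x) 2 volume := by
  rw [funext (h.fourier_chat_sub f)]
  exact memLp_fourier (h.integrable_one_sub f) (h.memLp_one_sub f)

theorem nrm2_fourier_sub_le (hN : 0 < N) :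
    nrm2 (fun x => 𝓕 f.chat x - 𝓕 (fun ξ => χ ξ ^ 2 * f.chat ξ) x) ≤ ‖f‖ / N := by
  rw [funext (h.fourier_chat_sub f), nrm2_fourier (h.integrable_one_sub f) (h.memLp_one_sub f)]
  exact h.nrm2_one_sub_le f hN

theorem norm_fourier_le (x : ℝ) :
    ‖𝓕 (fun ξ => χ ξ ^ 2 * f.chat ξ) x‖ ≤ H.embConst * ‖f‖ := by
  refine (MajdaBiello.norm_fourier_le _ _).trans (le_trans ?_ f.integral_norm_hat_le)
  refine integral_mono (h.integrable_sq_mul_chat f).norm f.integrable_hat.norm fun ξ => ?_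
  simp only [norm_mul]
  rw [H.norm_chat]
  exact mul_le_of_le_one_left (norm_nonneg _) (h.norm_sq_le ξ)

end IsCutoff

/-- The energy flux of the two equations together through a frequency cutoff at `N` is of size
`1 / N`. It vanishes if the solution in the nonlinearity is cut off as well, because it is then the
integral of the derivative of `½ u v²`; each replacement of a factor by its cutoff costs `1 / N`. -/
theorem norm_flux_le {χ : ℝ → ℂ} {N : ℝ} (hN : 0 < N) (h : IsCutoff χ N) (f g : H 1) {M : ℝ}
    (hf : ‖f‖ ≤ M) (hg : ‖g‖ ≤ M) :
    ‖(∫ x, ((1 / 2 : ℂ) * g.toL2 x ^ 2) *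
        𝓕 (fun ξ : ℝ => (-2 * Real.pi * Complex.I * ξ * (χ ξ ^ 2 * f.chat ξ) : ℂ)) x) +
      ∫ x, (f.toL2 x * g.toL2 x) *
        𝓕 (fun ξ : ℝ => (-2 * Real.pi * Complex.I * ξ * (χ ξ ^ 2 * g.chat ξ) : ℂ)) x‖ ≤
      6 * Real.pi * H.embConst * M ^ 3 / N := by
  have hM : 0 ≤ M := (norm_nonneg _).trans hf
  have hπ := Real.pi_pos
  have hK := H.embConst_nonneg
  set u := 𝓕 f.chat with hu
  set v := 𝓕 g.chat with hv
  set G := 𝓕 (fun ξ => χ ξ ^ 2 * f.chat ξ) with hG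
  set J := 𝓕 (fun ξ => χ ξ ^ 2 * g.chat ξ) with hJ
  set G' := 𝓕 (fun ξ : ℝ => (-2 * Real.pi * Complex.I * ξ * (χ ξ ^ 2 * f.chat ξ) : ℂ)) with hG'
  set J' := 𝓕 (fun ξ : ℝ => (-2 * Real.pi * Complex.I * ξ * (χ ξ ^ 2 * g.chat ξ) : ℂ)) with hJ'
  have e1 : ∫ x, ((1 / 2 : ℂ) * g.toL2 x ^ 2) * G' x = ∫ x, ((1 / 2 : ℂ) * v x ^ 2) * G' x := by
    refine integral_congr_ae ?_
    filter_upwards [g.toL2_eq_fourier_chat] with x hx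
    rw [hx]
  have e2 : ∫ x, (f.toL2 x * g.toL2 x) * J' x = ∫ x, (u x * v x) * J' x := by
    refine integral_congr_ae ?_
    filter_upwards [f.toL2_eq_fourier_chat, g.toL2_eq_fourier_chat] with x hx hx'
    rw [hx, hx']
  have mG' : MemLp G' 2 volume := memLp_fourier (h.integrable_deriv f) (h.memLp_deriv f)
  have mJ' : MemLp J' 2 volume := memLp_fourier (h.integrable_deriv g) (h.memLp_deriv g)
  have nG' : nrm2 G' ≤ 2 * Real.pi * M :=
    (h.nrm2_deriv_le f).trans (mul_le_mul_of_nonneg_left hf (by positivity))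
  have nJ' : nrm2 J' ≤ 2 * Real.pi * M :=
    (h.nrm2_deriv_le g).trans (mul_le_mul_of_nonneg_left hg (by positivity))
  have mJ : MemLp J 2 volume := memLp_fourier (h.integrable_sq_mul_chat g) (h.memLp_sq_mul_chat g)
  have mu : MemLp (fun x => u x - G x) 2 volume := h.memLp_fourier_sub f
  have mv : MemLp (fun x => v x - J x) 2 volume := h.memLp_fourier_sub g
  have nu : nrm2 (fun x => u x - G x) ≤ M / N :=
    (h.nrm2_fourier_sub_le f hN).trans (by gcongr)
  have nv : nrm2 (fun x => v x - J x) ≤ M / N :=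
    (h.nrm2_fourier_sub_le g hN).trans (by gcongr)
  have cu : Continuous u := continuous_fourier f.integrable_chat
  have cv : Continuous v := continuous_fourier g.integrable_chat
  have cG : Continuous G := continuous_fourier (h.integrable_sq_mul_chat f)
  have cJ : Continuous J := continuous_fourier (h.integrable_sq_mul_chat g)
  have bu : ∀ x, ‖u x‖ ≤ H.embConst * M := fun x =>
    (f.norm_fourier_chat_le x).trans (by gcongr)
  have bv : ∀ x, ‖v x‖ ≤ H.embConst * M := fun x =>
    (g.norm_fourier_chat_le x).trans (by gcongr)
  have bG : ∀ x, ‖G x‖ ≤ H.embConst * M := fun x => (h.norm_fourier_le f x).trans (by gcongr)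
  have bJ : ∀ x, ‖J x‖ ≤ H.embConst * M := fun x => (h.norm_fourier_le g x).trans (by gcongr)
  have bvJ : ∀ x, ‖(1 / 2 : ℂ) * (v x + J x)‖ ≤ H.embConst * M := fun x => by
    rw [norm_mul]
    have := (norm_add_le (v x) (J x)).trans (add_le_add (bv x) (bJ x))
    have e : ‖(1 / 2 : ℂ)‖ = 1 / 2 := by norm_num
    rw [e]
    linarith
  have cvJ : Continuous (fun x => (1 / 2 : ℂ) * (v x + J x)) := continuous_const.mul (cv.add cJ)
  -- with both factors cut off, the flux is the integral of the derivative of `½ G J²`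
  have z1 : ∫ x, ((1 / 2 : ℂ) * J x * J x * G' x + G x * J x * J' x) = 0 := by
    have bJ2 : ∀ x, ‖(1 / 2 : ℂ) * J x‖ ≤ H.embConst * M := fun x => by
      rw [norm_mul]
      have e : ‖(1 / 2 : ℂ)‖ = 1 / 2 := by norm_num
      rw [e]
      linarith [bJ x, norm_nonneg (J x)]
    refine integral_eq_zero_of_hasDerivAt_of_integrable
      (f := fun x => (1 / 2 : ℂ) * G x * J x * J x) (fun x => ?_) ?_ ?_
    · have d1 := h.hasDerivAt_fourier f x
      have d2 := h.hasDerivAt_fourier g x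
      refine (((d1.const_mul (1 / 2 : ℂ)).mul d2).mul d2).congr_deriv ?_
      simp only [← hG, ← hJ, ← hG', ← hJ', Pi.mul_apply]
      ring
    · exact (integrable_bdd_mul_mul (continuous_const.mul cJ).aestronglyMeasurable bJ2 mJ mG').add
        (integrable_bdd_mul_mul cG.aestronglyMeasurable bG mJ mJ')
    · refine integrable_bdd_mul_mul (B := 1 / 2 * (H.embConst * M))
        (continuous_const.mul cG).aestronglyMeasurable (fun x => ?_) mJ mJ
      rw [norm_mul]
      have e : ‖(1 / 2 : ℂ)‖ = 1 / 2 := by norm_num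
      rw [e]
      linarith [bG x]
  have mv' : MemLp v 2 volume := memLp_fourier g.integrable_chat g.memLp_chat
  have bv2 : ∀ x, ‖(1 / 2 : ℂ) * v x‖ ≤ 1 / 2 * (H.embConst * M) := fun x => by
    rw [norm_mul]
    have e : ‖(1 / 2 : ℂ)‖ = 1 / 2 := by norm_num
    rw [e]
    linarith [bv x]
  have i1 : Integrable (fun x => ((1 / 2 : ℂ) * v x ^ 2) * G' x) := by
    have cv2 : Continuous (fun x => (1 / 2 : ℂ) * v x) := continuous_const.mul cv
    refine (integrable_bdd_mul_mul cv2.aestronglyMeasurable bv2 mv' mG').congr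
      (Filter.Eventually.of_forall fun x => ?_)
    simp only
    ring
  have i2 : Integrable (fun x => (u x * v x) * J' x) :=
    integrable_bdd_mul_mul cu.aestronglyMeasurable bu mv' mJ'
  have j1 := integrable_bdd_mul_mul cvJ.aestronglyMeasurable bvJ mv mG'
  have j2 := integrable_bdd_mul_mul cu.aestronglyMeasurable bu mv mJ'
  have j3 := integrable_bdd_mul_mul cJ.aestronglyMeasurable bJ mu mJ'
  have n1 := norm_integral_bdd_mul_mul_le cvJ.aestronglyMeasurable bvJ mv mG'
  have n2 := norm_integral_bdd_mul_mul_le cu.aestronglyMeasurable bu mv mJ'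
  have n3 := norm_integral_bdd_mul_mul_le cJ.aestronglyMeasurable bJ mu mJ'
  -- every summand on the right has a factor that is small in `L²`
  have e3 : (∫ x, ((1 / 2 : ℂ) * v x ^ 2) * G' x) + ∫ x, (u x * v x) * J' x =
      (∫ x, (1 / 2 : ℂ) * (v x + J x) * (v x - J x) * G' x) +
      (∫ x, u x * (v x - J x) * J' x) + ∫ x, J x * (u x - G x) * J' x := by
    have j4 : Integrable (fun x => (1 / 2 : ℂ) * (v x + J x) * (v x - J x) * G' x +
      u x * (v x - J x) * J' x) := j1.add j2
    have i5 : Integrable (fun x => ((1 / 2 : ℂ) * v x ^ 2) * G' x + (u x * v x) * J' x) :=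
      i1.add i2
    have j5 : Integrable (fun x => (1 / 2 : ℂ) * (v x + J x) * (v x - J x) * G' x +
      u x * (v x - J x) * J' x + J x * (u x - G x) * J' x) := j4.add j3
    rw [← integral_add i1 i2, ← integral_add j1 j2, ← integral_add j4 j3, ← sub_eq_zero,
      ← integral_sub i5 j5, ← z1]
    refine integral_congr_ae (Filter.Eventually.of_forall fun x => ?_)
    ring
  rw [e1, e2, e3]
  have bound : ∀ {a b : ℝ}, 0 ≤ a → 0 ≤ b → a ≤ M / N → b ≤ 2 * Real.pi * M →
      H.embConst * M * a * b ≤ 2 * Real.pi * H.embConst * M ^ 3 / N := by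
    intro a b ha hb ha' hb'
    calc H.embConst * M * a * b ≤ H.embConst * M * (M / N) * (2 * Real.pi * M) := by gcongr
      _ = 2 * Real.pi * H.embConst * M ^ 3 / N := by ring
  have b1 := n1.trans (bound (nrm2_nonneg _) (nrm2_nonneg _) nv nG')
  have b2 := n2.trans (bound (nrm2_nonneg _) (nrm2_nonneg _) nv nJ')
  have b3 := n3.trans (bound (nrm2_nonneg _) (nrm2_nonneg _) nu nJ')
  refine (norm_add_le _ _).trans ?_
  refine (add_le_add (norm_add_le _ _) le_rfl).trans ?_
  refine (add_le_add (add_le_add b1 b2) b3).trans (le_of_eq ?_)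
  ring

theorem integral_norm_mul_toL2_le (f g : H 1) :
    ∫ x, ‖f.toL2 x * g.toL2 x‖ ≤ ‖f.hat‖ * ‖g.hat‖ := by
  rw [H.norm_hat, H.norm_hat, ← nrm2_coeFn, ← nrm2_coeFn]
  exact integral_norm_mul_le (Lp.memLp _) (Lp.memLp _)

theorem integrable_mul_toL2 (f g : H 1) : Integrable (fun x => f.toL2 x * g.toL2 x) :=
  integrable_mul_of_memLp (Lp.memLp _) (Lp.memLp _)

theorem integrable_half_sq_toL2 (g : H 1) :
    Integrable (fun x => (1 / 2 : ℂ) * g.toL2 x ^ 2) := by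
  simpa only [sq] using (integrable_mul_toL2 g g).const_mul (1 / 2 : ℂ)

theorem integral_norm_half_sq_toL2_le (g : H 1) :
    ∫ x, ‖(1 / 2 : ℂ) * g.toL2 x ^ 2‖ ≤ ‖g.hat‖ ^ 2 := by
  have h := integral_norm_mul_toL2_le g g
  have e : ∀ x, ‖(1 / 2 : ℂ) * g.toL2 x ^ 2‖ = 1 / 2 * ‖g.toL2 x * g.toL2 x‖ := by
    intro x
    rw [norm_mul, sq]
    norm_num
  simp only [e]
  rw [integral_const_mul]
  have h0 : 0 ≤ ∫ x, ‖g.toL2 x * g.toL2 x‖ := integral_nonneg fun x => norm_nonneg _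
  rw [sq]
  linarith

/-- The cutoff at `N` changes the square of the `L²` norm by at most `1 / N`. -/
theorem IsCutoff.abs_sub_le {χ : ℝ → ℂ} {N : ℝ} (hN : 0 < N) (h : IsCutoff χ N) (f : H 1) :
    |‖f.hat‖ ^ 2 - nrm2 (fun ξ => χ ξ * f.hat ξ) ^ 2| ≤ ‖f‖ ^ 2 / N := by
  have hm := h.toIsTest.memLp_mul (Lp.memLp f.hat)
  have i1 : Integrable (fun ξ => ‖f.hat ξ‖ ^ 2) := (Lp.memLp f.hat).integrable_norm_pow two_ne_zero
  have i2 : Integrable (fun ξ => ‖χ ξ * f.hat ξ‖ ^ 2) := hm.integrable_norm_pow two_ne_zero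
  rw [← nrm2_coeFn, nrm2_sq (Lp.memLp f.hat), nrm2_sq hm, ← integral_sub i1 i2,
    ← Real.norm_eq_abs]
  have e : ∀ ξ, ‖f.hat ξ‖ ^ 2 - ‖χ ξ * f.hat ξ‖ ^ 2 ≤ ‖f.hat ξ * ((1 - χ ξ ^ 2) * f.chat ξ)‖ := by
    intro ξ
    have h1 : 1 - ‖χ ξ‖ ^ 2 ≤ ‖1 - χ ξ ^ 2‖ := by
      have := norm_sub_norm_le (1 : ℂ) (χ ξ ^ 2)
      rwa [norm_one, norm_pow] at this
    rw [norm_mul, norm_mul, norm_mul, H.norm_chat, mul_pow]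
    nlinarith [norm_nonneg (f.hat ξ), mul_nonneg (norm_nonneg (f.hat ξ)) (norm_nonneg (f.hat ξ))]
  have hI : ∫ ξ, ‖f.hat ξ * ((1 - χ ξ ^ 2) * f.chat ξ)‖ ≤ ‖f‖ * (‖f‖ / N) := by
    refine (integral_norm_mul_le (Lp.memLp _) (h.memLp_one_sub f)).trans ?_
    rw [nrm2_coeFn]
    exact mul_le_mul f.norm_hat_le (h.nrm2_one_sub_le f hN) (nrm2_nonneg _) (norm_nonneg _)
  refine (norm_integral_le_integral_norm _).trans (le_trans ?_ (hI.trans (le_of_eq (by ring))))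
  refine integral_mono (i1.sub i2).norm
    (integrable_mul_of_memLp (Lp.memLp _) (h.memLp_one_sub f)).norm fun ξ => ?_
  refine le_trans (le_of_eq ?_) (e ξ)
  rw [Real.norm_eq_abs, abs_of_nonneg]
  rw [norm_mul, mul_pow, sub_nonneg]
  exact mul_le_of_le_one_left (sq_nonneg _) (pow_le_one₀ (norm_nonneg _) (h.norm_le ξ))

namespace IsSolution

variable {α : ℝ} {I : Set ℝ} {u v : ℝ → H 1}

theorem weakEvol_fst (h : IsSolution α I u v) :
    WeakEvol 1 I u (fun τ x => (1 / 2 : ℂ) * (v τ).toL2 x ^ 2) where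
  continuousOn := h.continuousOn_fst
  integrable τ _ := integrable_half_sq_toL2 (v τ)
  eq τ hτ φ := by
    rw [Complex.ofReal_one, one_mul]
    exact h.eq_fst τ hτ φ

theorem weakEvol_snd (h : IsSolution α I u v) :
    WeakEvol α I v (fun τ x => (u τ).toL2 x * (v τ).toL2 x) where
  continuousOn := h.continuousOn_snd
  integrable τ _ := integrable_mul_toL2 (u τ) (v τ)
  eq τ hτ φ := h.eq_snd τ hτ φ

theorem exists_bound (h : IsSolution α I u v) (hI : IsCompact I) :
    ∃ M, 0 ≤ M ∧ ∀ τ ∈ I, ‖u τ‖ ≤ M ∧ ‖v τ‖ ≤ M := by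
  obtain ⟨A, hA⟩ := hI.exists_bound_of_continuousOn h.continuousOn_fst
  obtain ⟨B, hB⟩ := hI.exists_bound_of_continuousOn h.continuousOn_snd
  exact ⟨max 0 (max A B), le_max_left _ _, fun τ hτ =>
    ⟨(hA τ hτ).trans ((le_max_left _ _).trans (le_max_right _ _)),
      (hB τ hτ).trans ((le_max_right _ _).trans (le_max_right _ _))⟩⟩

/-- The `L²` norm of a solution in `C(I; H¹ × H¹)` is conserved. -/
theorem conservation (h : IsSolution α I u v) (hI : IsCompact I) (hI' : Convex ℝ I) {σ τ : ℝ}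
    (hσ : σ ∈ I) (hτ : τ ∈ I) :
    ‖(u σ).hat‖ ^ 2 + ‖(v σ).hat‖ ^ 2 = ‖(u τ).hat‖ ^ 2 + ‖(v τ).hat‖ ^ 2 := by
  obtain ⟨M, hM, hb⟩ := h.exists_bound hI
  have hhat : ∀ {f : H 1}, ‖f‖ ≤ M → ‖f.hat‖ ≤ M := fun {f} hf => f.norm_hat_le.trans hf
  set K : ℝ := 2 * (6 * Real.pi * H.embConst * M ^ 3) * |σ - τ| + 4 * M ^ 2 with hK
  -- all errors that the cutoff at `N` causes
  have key : ∀ N : ℝ, 0 < N → |(‖(u σ).hat‖ ^ 2 + ‖(v σ).hat‖ ^ 2) -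
      (‖(u τ).hat‖ ^ 2 + ‖(v τ).hat‖ ^ 2)| ≤ K / N := by
    intro N hN
    obtain ⟨χ, hχ⟩ := exists_isCutoff hN
    have d1 := fun ρ (hρ : ρ ∈ I) => h.weakEvol_fst.hasDerivWithinAt_energy hI' (C := M ^ 2)
      (fun ρ hρ => (integral_norm_half_sq_toL2_le (v ρ)).trans
        (pow_le_pow_left₀ (norm_nonneg _) (hhat (hb ρ hρ).2) 2)) hχ.toIsTest hχ.real hρ
    have d2 := fun ρ (hρ : ρ ∈ I) => h.weakEvol_snd.hasDerivWithinAt_energy hI' (C := M ^ 2)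
      (fun ρ hρ => (integral_norm_mul_toL2_le (u ρ) (v ρ)).trans (by
        rw [sq]
        exact mul_le_mul (hhat (hb ρ hρ).1) (hhat (hb ρ hρ).2) (norm_nonneg _) hM))
      hχ.toIsTest hχ.real hρ
    have d3 := Convex.norm_image_sub_le_of_norm_hasDerivWithin_le
      (C := 2 * (6 * Real.pi * H.embConst * M ^ 3 / N))
      (fun ρ hρ => (d1 ρ hρ).add (d2 ρ hρ)) (fun ρ hρ => by
        rw [← mul_add, ← Complex.add_re, norm_mul, Real.norm_eq_abs, Real.norm_eq_abs,
          abs_of_pos (zero_lt_two' ℝ)]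
        exact mul_le_mul_of_nonneg_left ((Complex.abs_re_le_norm _).trans
          (norm_flux_le hN hχ (u ρ) (v ρ) (hb ρ hρ).1 (hb ρ hρ).2)) zero_le_two) hI' hτ hσ
    have hq : ∀ {f : H 1}, ‖f‖ ≤ M →
        |‖f.hat‖ ^ 2 - nrm2 (fun ξ => χ ξ * f.hat ξ) ^ 2| ≤ M ^ 2 / N := fun {f} hf =>
      (hχ.abs_sub_le hN f).trans (by gcongr)
    have q1 := abs_le.1 (hq (hb σ hσ).1)
    have q2 := abs_le.1 (hq (hb σ hσ).2)
    have q3 := abs_le.1 (hq (hb τ hτ).1)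
    have q4 := abs_le.1 (hq (hb τ hτ).2)
    simp only [Pi.add_apply] at d3
    rw [Real.norm_eq_abs, Real.norm_eq_abs] at d3
    have q5 := abs_le.1 d3
    have e : K / N = 2 * (6 * Real.pi * H.embConst * M ^ 3 / N) * |σ - τ| + 4 * (M ^ 2 / N) := by
      rw [hK]; ring
    rw [e, abs_le]
    constructor <;> linarith [q1.1, q1.2, q2.1, q2.2, q3.1, q3.2, q4.1, q4.2, q5.1, q5.2]
  have hlim : Filter.Tendsto (fun N : ℝ => K / N) Filter.atTop (nhds 0) :=
    tendsto_const_nhds.div_atTop Filter.tendsto_id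
  have h0 := ge_of_tendsto hlim
    ((Filter.eventually_gt_atTop (0 : ℝ)).mono fun N hN => key N hN)
  exact sub_eq_zero.1 (abs_eq_zero.1 (le_antisymm h0 (abs_nonneg _)))

end IsSolution

/-! ### Small data: the second order expansion of the solution -/

theorem nrm2_sub_const_mul_sq (w : Lp ℂ 2 (volume : Measure ℝ)) {S : ℝ → ℂ}
    (hS : MemLp S 2 volume) (ε : ℝ) :
    nrm2 (fun ξ => w ξ - ε * S ξ) ^ 2 =
      ‖w‖ ^ 2 + ε ^ 2 * nrm2 S ^ 2 - 2 * ε * (∫ ξ, conj (S ξ) * w ξ).re := by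
  have e1 : nrm2 (fun ξ => w ξ - ε * S ξ) = ‖w - (ε : ℂ) • hS.toLp S‖ := by
    rw [← nrm2_coeFn]
    refine nrm2_congr ?_
    filter_upwards [Lp.coeFn_sub w ((ε : ℂ) • hS.toLp S), Lp.coeFn_smul (ε : ℂ) (hS.toLp S),
      hS.coeFn_toLp] with ξ h1 h2 h3
    rw [h1, Pi.sub_apply, h2, Pi.smul_apply, h3, smul_eq_mul]
  have e2 : inner ℂ (hS.toLp S) w = ∫ ξ, conj (S ξ) * w ξ := by
    rw [L2.inner_def]
    refine integral_congr_ae ?_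
    filter_upwards [hS.coeFn_toLp] with ξ h1
    rw [h1, RCLike.inner_apply, mul_comm]
  rw [e1, norm_sub_rev, @norm_sub_sq ℂ, inner_smul_left, e2, norm_smul, Complex.norm_real,
    ← nrm2_coeFn (hS.toLp S), nrm2_congr hS.coeFn_toLp, Complex.conj_ofReal,
    RCLike.re_eq_complex_re, Complex.re_ofReal_mul, mul_pow, Real.norm_eq_abs, sq_abs]
  ring

/-- The `L¹` norm of the derivative symbol times a test function. -/
def derivNorm (ψ : ℝ → ℂ) : ℝ := ∫ ξ : ℝ, ‖-2 * Real.pi * Complex.I * ξ * ψ ξ‖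

theorem derivNorm_nonneg (ψ : ℝ → ℂ) : 0 ≤ derivNorm ψ := integral_nonneg fun _ => norm_nonneg _

theorem derivNorm_phase (ψ : ℝ → ℂ) (r : ℝ) :
    derivNorm (fun ξ => phase r ξ * ψ ξ) = derivNorm ψ := by
  simp only [derivNorm, norm_mul, norm_phase, one_mul]

theorem IsTest.norm_integral_deriv_mul_le {ψ F : ℝ → ℂ} (h : IsTest ψ) {B : ℝ}
    (hF : ∀ ξ, ‖F ξ‖ ≤ B) :
    ‖∫ ξ : ℝ, (-2 * Real.pi * Complex.I * ξ * ψ ξ) * F ξ‖ ≤ derivNorm ψ * B := by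
  rw [derivNorm, ← integral_mul_const]
  refine norm_integral_le_of_norm_le
    ((h.mul_left (contDiff_ofReal_mul_const _)).integrable.norm.mul_const B)
    (Filter.Eventually.of_forall fun ξ => ?_)
  rw [norm_mul]
  exact mul_le_mul_of_nonneg_left (hF ξ) (norm_nonneg _)

theorem WeakEvol.norm_interaction_sub_le {c : ℝ} {I : Set ℝ} {f : ℝ → H 1} {n : ℝ → ℝ → ℂ}
    (h : WeakEvol c I f n) (hI : Convex ℝ I) {C : ℝ} (hC : ∀ τ ∈ I, ∫ x, ‖n τ x‖ ≤ C)
    {ψ : ℝ → ℂ} (hψ : IsTest ψ) {σ τ : ℝ} (hσ : σ ∈ I) (hτ : τ ∈ I) :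
    ‖(∫ ξ, (phase (-(c * σ)) ξ * ψ ξ) * (f σ).hat ξ) -
      ∫ ξ, (phase (-(c * τ)) ξ * ψ ξ) * (f τ).hat ξ‖ ≤ derivNorm ψ * C * |σ - τ| := by
  have := Convex.norm_image_sub_le_of_norm_hasDerivWithin_le (C := derivNorm ψ * C)
    (fun ρ hρ => h.hasDerivWithinAt_interaction hψ hρ) (fun ρ hρ => by
      rw [← derivNorm_phase ψ (-(c * ρ))]
      exact (hψ.phase_mul _).norm_integral_deriv_mul_le
        (fun ξ => (norm_fourier_le _ _).trans (hC ρ hρ))) hI hτ hσ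
  rwa [Real.norm_eq_abs] at this

/-- One equation's contribution to the distance between the solution and `ε` times the free
evolution of the real Fourier profile `A`. -/
theorem WeakEvol.nrm2_sub_sq_le {c : ℝ} {I : Set ℝ} {f : ℝ → H 1} {n : ℝ → ℝ → ℂ}
    (h : WeakEvol c I f n) (hI : Convex ℝ I) {C : ℝ} (hC : ∀ τ ∈ I, ∫ x, ‖n τ x‖ ≤ C)
    {A : ℝ → ℂ} (hA : IsTest A) (hAr : ∀ ξ, conj (A ξ) = A ξ) {ε : ℝ} (h0 : (0 : ℝ) ∈ I)
    (hf : (f 0).hat =ᵐ[volume] fun ξ => ε * A ξ) {σ : ℝ} (hσ : σ ∈ I) :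
    nrm2 (fun ξ => (f σ).hat ξ - ε * (phase (c * σ) ξ * A ξ)) ^ 2 ≤
      ‖(f σ).hat‖ ^ 2 - ‖(f 0).hat‖ ^ 2 + 2 * |ε| * (derivNorm A * C * |σ|) := by
  have e1 : nrm2 (fun ξ => phase (c * σ) ξ * A ξ) ^ 2 = nrm2 A ^ 2 := by
    rw [nrm2_sq (hA.phase_mul _).memLp, nrm2_sq hA.memLp]
    simp only [norm_mul, norm_phase, one_mul]
  have e2 : ∫ ξ, conj (phase (c * σ) ξ * A ξ) * (f σ).hat ξ =
      ∫ ξ, (phase (-(c * σ)) ξ * A ξ) * (f σ).hat ξ := by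
    simp only [map_mul, conj_phase, hAr]
  have e3 : ∫ ξ, (phase (-(c * 0)) ξ * A ξ) * (f 0).hat ξ = ((ε * nrm2 A ^ 2 : ℝ) : ℂ) := by
    rw [nrm2_sq hA.memLp, Complex.ofReal_mul, ← integral_complex_ofReal, ← integral_const_mul]
    refine integral_congr_ae ?_
    filter_upwards [hf] with ξ h1
    rw [h1, mul_zero, neg_zero, phase_zero]
    have h2 := RCLike.mul_conj (A ξ)
    rw [hAr] at h2
    push_cast
    rw [show (‖A ξ‖ : ℂ) ^ 2 = A ξ * A ξ from h2.symm]
    ring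
  have e4 : ‖(f 0).hat‖ ^ 2 = ε ^ 2 * nrm2 A ^ 2 := by
    rw [← nrm2_coeFn, nrm2_congr hf, nrm2_const_mul, Complex.norm_real, Real.norm_eq_abs, mul_pow,
      sq_abs]
  have h1 := h.norm_interaction_sub_le hI hC hA hσ h0
  rw [e3, sub_zero] at h1
  have h2 := (Complex.abs_re_le_norm _).trans h1
  rw [Complex.sub_re, Complex.ofReal_re] at h2
  rw [nrm2_sub_const_mul_sq _ (hA.phase_mul _).memLp, e1, e2, e4]
  set X := (∫ ξ, (phase (-(c * σ)) ξ * A ξ) * (f σ).hat ξ).re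
  have h3 : -(2 * ε * (X - ε * nrm2 A ^ 2)) ≤ 2 * |ε| * (derivNorm A * C * |σ|) := by
    refine (neg_le_abs _).trans ?_
    rw [abs_mul, abs_mul, abs_of_pos (zero_lt_two' ℝ)]
    exact mul_le_mul_of_nonneg_left h2 (by positivity)
  linarith

/-- The free evolution with the Fourier profile `A`, as a Schwartz function. -/
def IsTest.free {A : ℝ → ℂ} (hA : IsTest A) (r : ℝ) : 𝓢(ℝ, ℂ) :=
  𝓕⁻ (hA.phase_mul r).toSchwartz

theorem nrm2_toL2_sub (f : H 1) {S : ℝ → ℂ} (hS : IsTest S) (ε : ℝ) :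
    nrm2 (fun x => f.toL2 x - ε * (𝓕⁻ hS.toSchwartz : 𝓢(ℝ, ℂ)) x) =
      nrm2 (fun ξ => f.hat ξ - ε * S ξ) := by
  have e1 : nrm2 (fun x => f.toL2 x - ε * (𝓕⁻ hS.toSchwartz : 𝓢(ℝ, ℂ)) x) =
      ‖f.toL2 - (ε : ℂ) • (𝓕⁻ hS.toSchwartz : 𝓢(ℝ, ℂ)).toLp 2 volume‖ := by
    rw [← nrm2_coeFn]
    refine nrm2_congr ?_
    filter_upwards [Lp.coeFn_sub f.toL2 ((ε : ℂ) • (𝓕⁻ hS.toSchwartz : 𝓢(ℝ, ℂ)).toLp 2 volume),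
      Lp.coeFn_smul (ε : ℂ) ((𝓕⁻ hS.toSchwartz : 𝓢(ℝ, ℂ)).toLp 2 volume),
      (𝓕⁻ hS.toSchwartz : 𝓢(ℝ, ℂ)).coeFn_toLp 2 volume] with ξ h1 h2 h3
    rw [h1, Pi.sub_apply, h2, Pi.smul_apply, h3, smul_eq_mul]
  have e2 : nrm2 (fun ξ => f.hat ξ - ε * S ξ) =
      ‖f.hat - (ε : ℂ) • hS.toSchwartz.toLp 2 volume‖ := by
    rw [← nrm2_coeFn]
    refine nrm2_congr ?_
    filter_upwards [Lp.coeFn_sub f.hat ((ε : ℂ) • hS.toSchwartz.toLp 2 volume),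
      Lp.coeFn_smul (ε : ℂ) (hS.toSchwartz.toLp 2 volume),
      hS.toSchwartz.coeFn_toLp 2 volume] with ξ h1 h2 h3
    rw [h1, Pi.sub_apply, h2, Pi.smul_apply, h3, smul_eq_mul, IsTest.toSchwartz_apply]
  have e3 : f.hat - (ε : ℂ) • hS.toSchwartz.toLp 2 volume =
      Lp.fourierTransformₗᵢ ℝ ℂ
        (f.toL2 - (ε : ℂ) • (𝓕⁻ hS.toSchwartz : 𝓢(ℝ, ℂ)).toLp 2 volume) := by
    rw [map_sub, map_smul]
    have h1 : Lp.fourierTransformₗᵢ ℝ ℂ ((𝓕⁻ hS.toSchwartz : 𝓢(ℝ, ℂ)).toLp 2 volume) =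
        hS.toSchwartz.toLp 2 volume := by
      have h2 := SchwartzMap.toLp_fourier_eq (𝓕⁻ hS.toSchwartz : 𝓢(ℝ, ℂ))
      rwa [fourier_fourierInv_eq] at h2
    rw [h1]
    rfl
  rw [e1, e2, e3, LinearIsometryEquiv.norm_map]

theorem nrm2_fourierInv {S : ℝ → ℂ} (hS : IsTest S) :
    nrm2 (𝓕⁻ hS.toSchwartz : 𝓢(ℝ, ℂ)) = nrm2 S := by
  have h := nrm2_fourier (𝓕⁻ hS.toSchwartz : 𝓢(ℝ, ℂ)).integrable
    ((𝓕⁻ hS.toSchwartz : 𝓢(ℝ, ℂ)).memLp 2 volume)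
  rw [← SchwartzMap.fourier_coe, fourier_fourierInv_eq] at h
  exact h.symm

namespace IsSolution

variable {α : ℝ} {I : Set ℝ} {u v : ℝ → H 1} {A B : ℝ → ℂ} {ε : ℝ}

/-- The solution with data of size `ε` is the free evolution up to an error of size `ε^{3/2}` in
`L²`. By conservation of the `L²` norm it suffices to control the inner product of the two. -/
theorem nrm2_sub_free_sq_le (h : IsSolution α I u v) (hI : IsCompact I) (hI' : Convex ℝ I)
    (hA : IsTest A) (hAr : ∀ ξ, conj (A ξ) = A ξ) (hB : IsTest B) (hBr : ∀ ξ, conj (B ξ) = B ξ)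
    (h0 : (0 : ℝ) ∈ I) (hu : (u 0).hat =ᵐ[volume] fun ξ => ε * A ξ)
    (hv : (v 0).hat =ᵐ[volume] fun ξ => ε * B ξ) {σ : ℝ} (hσ : σ ∈ I) :
    nrm2 (fun ξ => (u σ).hat ξ - ε * (phase σ ξ * A ξ)) ^ 2 +
      nrm2 (fun ξ => (v σ).hat ξ - ε * (phase (α * σ) ξ * B ξ)) ^ 2 ≤
    2 * (derivNorm A + derivNorm B) * (nrm2 A ^ 2 + nrm2 B ^ 2) * |σ| * |ε| ^ 3 := by
  have e0 : ‖(u 0).hat‖ ^ 2 + ‖(v 0).hat‖ ^ 2 = ε ^ 2 * (nrm2 A ^ 2 + nrm2 B ^ 2) := by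
    rw [← nrm2_coeFn, ← nrm2_coeFn, nrm2_congr hu, nrm2_congr hv, nrm2_const_mul, nrm2_const_mul,
      Complex.norm_real, Real.norm_eq_abs, mul_pow, mul_pow, sq_abs]
    ring
  have hcons := fun τ (hτ : τ ∈ I) => h.conservation hI hI' hτ h0
  have h1 := h.weakEvol_fst.nrm2_sub_sq_le hI' (C := ε ^ 2 * (nrm2 A ^ 2 + nrm2 B ^ 2))
    (fun τ hτ => (integral_norm_half_sq_toL2_le (v τ)).trans (by
      rw [← e0, ← hcons τ hτ]
      linarith [sq_nonneg ‖(u τ).hat‖])) hA hAr h0 hu hσ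
  have h2 := h.weakEvol_snd.nrm2_sub_sq_le hI' (C := ε ^ 2 * (nrm2 A ^ 2 + nrm2 B ^ 2))
    (fun τ hτ => (integral_norm_mul_toL2_le (u τ) (v τ)).trans (by
      rw [← e0, ← hcons τ hτ]
      nlinarith [sq_nonneg (‖(u τ).hat‖ - ‖(v τ).hat‖)])) hB hBr h0 hv hσ
  rw [one_mul] at h1
  refine (add_le_add h1 h2).trans (le_of_eq ?_)
  have h3 := hcons σ hσ
  have h4 : |ε| ^ 3 = |ε| * ε ^ 2 := by rw [pow_succ', sq_abs]
  rw [h4]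
  linear_combination h3

/-- The derivative of the second component in the interaction representation is, up to an error of
size `ε^{5/2}`, the one of the second Picard iterate. -/
theorem norm_deriv_sub_le (h : IsSolution α I u v) (hI : IsCompact I) (hI' : Convex ℝ I)
    (hA : IsTest A) (hAr : ∀ ξ, conj (A ξ) = A ξ) (hB : IsTest B) (hBr : ∀ ξ, conj (B ξ) = B ξ)
    (h0 : (0 : ℝ) ∈ I) (hu : (u 0).hat =ᵐ[volume] fun ξ => ε * A ξ)
    (hv : (v 0).hat =ᵐ[volume] fun ξ => ε * B ξ) {σ T : ℝ} (hσ : σ ∈ I) (hT : |σ| ≤ T)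
    {ψ : ℝ → ℂ} (hψ : IsTest ψ) :
    ‖(∫ ξ, (-2 * Real.pi * Complex.I * ξ * (phase (-(α * σ)) ξ * ψ ξ)) *
          𝓕 (fun x => (u σ).toL2 x * (v σ).toL2 x) ξ) -
        ε ^ 2 * ∫ ξ, (-2 * Real.pi * Complex.I * ξ * (phase (-(α * σ)) ξ * ψ ξ)) *
          𝓕 (fun x => hA.free σ x * hB.free (α * σ) x) ξ‖ ≤
      derivNorm ψ * (2 * √(nrm2 A ^ 2 + nrm2 B ^ 2) *
        √(2 * (derivNorm A + derivNorm B) * (nrm2 A ^ 2 + nrm2 B ^ 2) * T)) *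
          (ε ^ 2 * √|ε|) := by
  set E := nrm2 A ^ 2 + nrm2 B ^ 2 with hE
  have hE0 : 0 ≤ E := by positivity
  have hdA := derivNorm_nonneg A
  have hdB := derivNorm_nonneg B
  have hT0 : 0 ≤ T := (abs_nonneg _).trans hT
  have e0 : ‖(u 0).hat‖ ^ 2 + ‖(v 0).hat‖ ^ 2 = ε ^ 2 * E := by
    rw [← nrm2_coeFn, ← nrm2_coeFn, nrm2_congr hu, nrm2_congr hv, nrm2_const_mul, nrm2_const_mul,
      Complex.norm_real, Real.norm_eq_abs, mul_pow, mul_pow, sq_abs]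
    ring
  set U := hA.free σ with hU
  set V := hB.free (α * σ) with hV
  have hdiff := h.nrm2_sub_free_sq_le hI hI' hA hAr hB hBr h0 hu hv hσ
  set δ := √(2 * (derivNorm A + derivNorm B) * E * T) * (|ε| * √|ε|) with hδ
  have hδ0 : 0 ≤ δ := by positivity
  have hδ2 : 2 * (derivNorm A + derivNorm B) * E * |σ| * |ε| ^ 3 ≤ δ ^ 2 := by
    rw [hδ, mul_pow, mul_pow, Real.sq_sqrt (by positivity), Real.sq_sqrt (abs_nonneg ε)]
    rw [show |ε| ^ 2 * |ε| = |ε| ^ 3 by ring]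
    gcongr
  have hu' : nrm2 (fun x => (u σ).toL2 x - ε * U x) ≤ δ := by
    rw [hU, IsTest.free, nrm2_toL2_sub]
    refine le_of_sq_le_sq ?_ hδ0
    nlinarith [sq_nonneg (nrm2 (fun ξ => (v σ).hat ξ - ε * (phase (α * σ) ξ * B ξ)))]
  have hv' : nrm2 (fun x => (v σ).toL2 x - ε * V x) ≤ δ := by
    rw [hV, IsTest.free, nrm2_toL2_sub]
    refine le_of_sq_le_sq ?_ hδ0
    nlinarith [sq_nonneg (nrm2 (fun ξ => (u σ).hat ξ - ε * (phase σ ξ * A ξ)))]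
  have nu : nrm2 (u σ).toL2 ≤ |ε| * √E := by
    rw [nrm2_coeFn, ← H.norm_hat]
    refine le_of_sq_le_sq ?_ (by positivity)
    rw [mul_pow, Real.sq_sqrt hE0, sq_abs, ← e0, ← h.conservation hI hI' hσ h0]
    linarith [sq_nonneg ‖(v σ).hat‖]
  have nV : nrm2 V ≤ √E := by
    rw [hV, IsTest.free, nrm2_fourierInv]
    refine le_of_sq_le_sq ?_ (by positivity)
    rw [Real.sq_sqrt hE0, nrm2_sq (hB.phase_mul _).memLp]
    simp only [norm_mul, norm_phase, one_mul]
    rw [← nrm2_sq hB.memLp]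
    linarith [sq_nonneg (nrm2 A)]
  have mU : MemLp (fun x => (u σ).toL2 x - ε * U x) 2 volume :=
    (Lp.memLp _).sub ((U.memLp 2 volume).const_mul _)
  have mV : MemLp (fun x => (v σ).toL2 x - ε * V x) 2 volume :=
    (Lp.memLp _).sub ((V.memLp 2 volume).const_mul _)
  have iuv := integrable_mul_toL2 (u σ) (v σ)
  have iUV : Integrable (fun x => U x * V x) :=
    integrable_mul_of_memLp (U.memLp 2 volume) (V.memLp 2 volume)
  have i1 := integrable_mul_of_memLp (Lp.memLp (u σ).toL2) mV
  have i2 := integrable_mul_of_memLp mU ((V.memLp 2 volume).const_mul (ε : ℂ))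
  have hL1 : ∫ x, ‖(u σ).toL2 x * (v σ).toL2 x - ε ^ 2 * (U x * V x)‖ ≤
      2 * (|ε| * √E) * δ := by
    have h1 : ∫ x, ‖(u σ).toL2 x * (v σ).toL2 x - ε ^ 2 * (U x * V x)‖ ≤
        ∫ x, (‖(u σ).toL2 x * ((v σ).toL2 x - ε * V x)‖ +
          ‖((u σ).toL2 x - ε * U x) * (ε * V x)‖) := by
      refine integral_mono (iuv.sub (iUV.const_mul _)).norm (i1.norm.add i2.norm) fun x => ?_
      refine le_trans (le_of_eq ?_) (norm_add_le _ _)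
      congr 1
      ring
    rw [integral_add i1.norm i2.norm] at h1
    have h2 := integral_norm_mul_le (Lp.memLp (u σ).toL2) mV
    have h3 := integral_norm_mul_le mU ((V.memLp 2 volume).const_mul (ε : ℂ))
    rw [nrm2_const_mul, Complex.norm_real, Real.norm_eq_abs] at h3
    have h4 : nrm2 (u σ).toL2 * nrm2 (fun x => (v σ).toL2 x - ε * V x) ≤ (|ε| * √E) * δ :=
      mul_le_mul nu hv' (nrm2_nonneg _) (by positivity)
    have h5 : nrm2 (fun x => (u σ).toL2 x - ε * U x) * (|ε| * nrm2 V) ≤ δ * (|ε| * √E) :=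
      mul_le_mul hu' (by gcongr) (mul_nonneg (abs_nonneg _) (nrm2_nonneg _)) hδ0
    linarith
  have hsub : ∀ ξ, 𝓕 (fun x => (u σ).toL2 x * (v σ).toL2 x) ξ -
      ε ^ 2 * 𝓕 (fun x => U x * V x) ξ =
      𝓕 (fun x : ℝ => ((u σ).toL2 x * (v σ).toL2 x - ε ^ 2 * (U x * V x) : ℂ)) ξ := by
    intro ξ
    simp only [Real.fourier_eq]
    rw [← integral_const_mul, ← integral_sub]
    · refine integral_congr_ae (Filter.Eventually.of_forall fun x => ?_)
      simp only [smul_sub]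
      rw [mul_smul_comm]
    · exact (Real.fourierIntegral_convergent_iff ξ).2 iuv
    · exact ((Real.fourierIntegral_convergent_iff ξ).2 iUV).const_mul _
  have hψ' := hψ.phase_mul (-(α * σ))
  have hd := hψ'.mul_left (contDiff_ofReal_mul_const (-2 * Real.pi * Complex.I))
  have it : ∀ {n : ℝ → ℂ}, Integrable n → Integrable (fun ξ : ℝ =>
      (-2 * Real.pi * Complex.I * ξ * (phase (-(α * σ)) ξ * ψ ξ)) * 𝓕 n ξ) := by
    intro n hn
    exact hd.integrable.mul_bdd (c := ∫ x, ‖n x‖) (continuous_fourier hn).aestronglyMeasurable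
      (Filter.Eventually.of_forall fun ξ => norm_fourier_le _ _)
  have e5 : (∫ ξ, (-2 * Real.pi * Complex.I * ξ * (phase (-(α * σ)) ξ * ψ ξ)) *
          𝓕 (fun x => (u σ).toL2 x * (v σ).toL2 x) ξ) -
        ε ^ 2 * ∫ ξ, (-2 * Real.pi * Complex.I * ξ * (phase (-(α * σ)) ξ * ψ ξ)) *
          𝓕 (fun x => U x * V x) ξ =
      ∫ ξ, (-2 * Real.pi * Complex.I * ξ * (phase (-(α * σ)) ξ * ψ ξ)) *
        𝓕 (fun x : ℝ => ((u σ).toL2 x * (v σ).toL2 x - ε ^ 2 * (U x * V x) : ℂ)) ξ := by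
    rw [← integral_const_mul, ← integral_sub (it iuv) ((it iUV).const_mul _)]
    refine integral_congr_ae (Filter.Eventually.of_forall fun ξ => ?_)
    simp only
    rw [← hsub]
    ring
  rw [e5]
  refine (hψ'.norm_integral_deriv_mul_le
    (fun ξ => (norm_fourier_le _ _).trans hL1)).trans (le_of_eq ?_)
  rw [derivNorm_phase, hδ, ← sq_abs ε]
  ring

end IsSolution

/-! ### Sobolev norms on the Fourier side -/

/-- The weight `(1 + ξ²)^{s/2}` of `Hˢ(ℝ)`. -/
def sobWeight (s ξ : ℝ) : ℝ := (1 + ‖ξ‖ ^ 2) ^ (s / 2)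

theorem sobWeight_pos (s ξ : ℝ) : 0 < sobWeight s ξ := Real.rpow_pos_of_pos (by positivity) _

theorem sobWeight_mul_neg (s ξ : ℝ) : sobWeight s ξ * sobWeight (-s) ξ = 1 := by
  rw [sobWeight, sobWeight, ← Real.rpow_add (by positivity)]
  simp [neg_div]

theorem hasTemperateGrowth_sobWeight (s : ℝ) :
    (fun ξ : ℝ => (((1 + ‖ξ‖ ^ 2) ^ (s / 2) : ℝ) : ℂ)).HasTemperateGrowth := by
  fun_prop

namespace H

variable {s : ℝ}

theorem integral_fourier_bessel (f : H s) (ψ : 𝓢(ℝ, ℂ)) :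
    ∫ ξ, ψ ξ * (𝓕 f.bessel : Lp ℂ 2 (volume : Measure ℝ)) ξ =
      f.toDistr (𝓕 (SchwartzMap.smulLeftCLM ℂ
        (fun ξ : ℝ => (((1 + ‖ξ‖ ^ 2) ^ (s / 2) : ℝ) : ℂ)) ψ)) := by
  have h := congrArg (fun T : 𝓢'(ℝ, ℂ) => T ψ)
    (fourier_besselPotential_eq_smulLeftCLM_fourier_apply s f.toDistr)
  simp only [bessel_spec] at h
  rw [Lp.fourier_toTemperedDistribution_eq, smulLeftCLM_apply_apply,
    Lp.toTemperedDistribution_apply] at h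
  exact h

/-- The duality of `Hˢ` and `H⁻ˢ`, on the Fourier side. -/
theorem norm_toDistr_fourier_le (f : H s) {ψ : ℝ → ℂ} (hψ : IsTest ψ) :
    ‖f.toDistr (𝓕 hψ.toSchwartz)‖ ≤ ‖f‖ * nrm2 (fun ξ => sobWeight (-s) ξ * ψ ξ) := by
  have e : SchwartzMap.smulLeftCLM ℂ (fun ξ : ℝ => (((1 + ‖ξ‖ ^ 2) ^ (s / 2) : ℝ) : ℂ))
      (SchwartzMap.smulLeftCLM ℂ (fun ξ : ℝ => (((1 + ‖ξ‖ ^ 2) ^ (-s / 2) : ℝ) : ℂ))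
        hψ.toSchwartz) = hψ.toSchwartz := by
    ext ξ
    rw [SchwartzMap.smulLeftCLM_apply_apply (hasTemperateGrowth_sobWeight s),
      SchwartzMap.smulLeftCLM_apply_apply (hasTemperateGrowth_sobWeight (-s)), smul_smul,
      ← Complex.ofReal_mul]
    have := sobWeight_mul_neg s ξ
    rw [sobWeight, sobWeight] at this
    rw [this, Complex.ofReal_one, one_smul]
  have h := f.integral_fourier_bessel (SchwartzMap.smulLeftCLM ℂ
    (fun ξ : ℝ => (((1 + ‖ξ‖ ^ 2) ^ (-s / 2) : ℝ) : ℂ)) hψ.toSchwartz)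
  rw [e] at h
  rw [← h]
  refine (norm_integral_mul_le (SchwartzMap.memLp _ 2 volume) (Lp.memLp _)).trans (le_of_eq ?_)
  rw [nrm2_coeFn, Lp.norm_fourier_eq, ← norm_eq, mul_comm]
  congr 2
  ext ξ
  rw [SchwartzMap.smulLeftCLM_apply_apply (hasTemperateGrowth_sobWeight (-s))]
  rfl

theorem hat_ae_of_toDistr {f : H 1} {F : ℝ → ℂ} (hF : LocallyIntegrable F)
    (h : ∀ ψ : 𝓢(ℝ, ℂ), f.toDistr (𝓕 ψ) = ∫ ξ, ψ ξ * F ξ) : f.hat =ᵐ[volume] F :=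
  ae_eq_of_forall_schwartz ((Lp.memLp f.hat).locallyIntegrable (by norm_num)) hF
    fun ψ _ => by rw [← toDistr_fourier, h]

end H

theorem integral_mul_fourierInv (ψ A : 𝓢(ℝ, ℂ)) :
    ∫ x, (𝓕 ψ) x * (𝓕⁻ A) x = ∫ ξ, ψ ξ * A ξ := by
  have h := SchwartzMap.integral_fourier_smul_eq ψ (𝓕⁻ A)
  rwa [fourier_fourierInv_eq] at h

/-- The element of `Hˢ(ℝ)` with the Fourier transform `A`; it is real because `A` is real and
even. -/
def ofProfile (s : ℝ) {A : ℝ → ℂ} (hA : IsTest A) (hAr : ∀ ξ, conj (A ξ) = A ξ)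
    (hAe : ∀ ξ, A (-ξ) = A ξ) : H s :=
  ⟨((𝓕⁻ hA.toSchwartz : 𝓢(ℝ, ℂ)) : 𝓢'(ℝ, ℂ)), SchwartzMap.memSobolev _, by
    have hr : ∀ x, conj ((𝓕⁻ hA.toSchwartz : 𝓢(ℝ, ℂ)) x) = (𝓕⁻ hA.toSchwartz : 𝓢(ℝ, ℂ)) x := by
      intro x
      rw [SchwartzMap.fourierInv_coe, Real.fourierInv_eq', ← integral_conj,
        ← integral_neg_eq_self]
      refine integral_congr_ae (Filter.Eventually.of_forall fun ξ => ?_)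
      simp only [smul_eq_mul, map_mul, IsTest.toSchwartz_apply, hAr, hAe, ← Complex.exp_conj,
        Complex.conj_ofReal, Complex.conj_I]
      congr 2
      simp only [RCLike.inner_apply, conj_trivial]
      push_cast
      ring
    intro φ hφ
    rw [SchwartzMap.coe_apply, ← Complex.conj_eq_iff_im, ← integral_conj]
    refine integral_congr_ae (Filter.Eventually.of_forall fun x => ?_)
    simp only [smul_eq_mul, map_mul]
    rw [hr, Complex.conj_eq_iff_im.2 (hφ x)]⟩

section ofProfile

variable {s : ℝ} {A : ℝ → ℂ} (hA : IsTest A) (hAr : ∀ ξ, conj (A ξ) = A ξ)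
  (hAe : ∀ ξ, A (-ξ) = A ξ)

theorem toDistr_ofProfile :
    (ofProfile s hA hAr hAe).toDistr = ((𝓕⁻ hA.toSchwartz : 𝓢(ℝ, ℂ)) : 𝓢'(ℝ, ℂ)) := rfl

theorem toDistr_ofProfile_fourier (ψ : 𝓢(ℝ, ℂ)) :
    (ofProfile s hA hAr hAe).toDistr (𝓕 ψ) = ∫ ξ, ψ ξ * A ξ := by
  rw [toDistr_ofProfile, SchwartzMap.coe_apply]
  exact integral_mul_fourierInv ψ hA.toSchwartz

theorem toDistr_smul_ofProfile_fourier (ε : ℝ) (ψ : 𝓢(ℝ, ℂ)) :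
    (ε • ofProfile s hA hAr hAe).toDistr (𝓕 ψ) = ∫ ξ, ψ ξ * (ε * A ξ) := by
  have h : (ε • ofProfile s hA hAr hAe).toDistr (𝓕 ψ) =
    ε • (ofProfile s hA hAr hAe).toDistr (𝓕 ψ) := rfl
  rw [h, toDistr_ofProfile_fourier, Complex.real_smul, ← integral_const_mul]
  congr 1
  ext ξ
  ring

theorem isSchwartz_smul_ofProfile (ε : ℝ) : (ε • ofProfile s hA hAr hAe).IsSchwartz := by
  refine ⟨(ε : ℂ) • (𝓕⁻ hA.toSchwartz : 𝓢(ℝ, ℂ)), ?_⟩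
  rw [map_smul, ← toDistr_ofProfile (s := s) hA hAr hAe, H.toDistr_smul]
  ext φ
  exact (Complex.coe_smul ε _).symm

theorem norm_ofProfile :
    ‖ofProfile s hA hAr hAe‖ = nrm2 (fun ξ => sobWeight s ξ * A ξ) := by
  rw [H.norm_eq, ← Lp.norm_fourier_eq, ← nrm2_coeFn]
  have hc : Continuous (fun ξ : ℝ => (sobWeight s ξ : ℂ)) :=
    (hasTemperateGrowth_sobWeight s).1.continuous
  refine nrm2_congr (ae_eq_of_forall_schwartz ((Lp.memLp _).locallyIntegrable (by norm_num))
    (hc.mul hA.continuous).locallyIntegrable fun ψ _ => ?_)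
  rw [H.integral_fourier_bessel, toDistr_ofProfile_fourier]
  refine integral_congr_ae (Filter.Eventually.of_forall fun ξ => ?_)
  simp only
  rw [SchwartzMap.smulLeftCLM_apply_apply (hasTemperateGrowth_sobWeight s), smul_eq_mul, sobWeight]
  ring

end ofProfile

/-! ### Second differences of a map of class `C²` -/

/-- The second difference of a map of class `C²` is quadratically small. -/
theorem exists_second_difference_le {E F : Type*} [NormedAddCommGroup E] [NormedSpace ℝ E]
    [NormedAddCommGroup F] [NormedSpace ℝ F] {Φ : E → F} (h : ContDiffAt ℝ 2 Φ 0) :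
    ∃ K r : ℝ, 0 ≤ K ∧ 0 < r ∧ ∀ x : E, ‖x‖ ≤ r →
      ‖Φ x + Φ (-x) - (2 : ℝ) • Φ 0‖ ≤ K * ‖x‖ ^ 2 := by
  obtain ⟨K, S, hS, hK⟩ :=
    (h.fderiv_right (m := 1) (by norm_num)).exists_lipschitzOnWith
  have hd : ∀ᶠ y in nhds (0 : E), DifferentiableAt ℝ Φ y :=
    (h.eventually (by norm_num)).mono fun y hy => hy.differentiableAt (by norm_num)
  obtain ⟨ρ, hρ, hball⟩ := Metric.eventually_nhds_iff_ball.1 (hd.and hS)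
  refine ⟨K, ρ / 3, K.2, by positivity, fun x hx => ?_⟩
  have hmem : ∀ y : E, ‖y‖ ≤ ρ / 3 → y ∈ Metric.ball (0 : E) ρ ∧ y + x ∈ Metric.ball (0 : E) ρ := by
    intro y hy
    rw [mem_ball_zero_iff, mem_ball_zero_iff]
    have := norm_add_le y x
    constructor <;> linarith
  have h1 := Convex.norm_image_sub_le_of_norm_hasFDerivWithin_le (𝕜 := ℝ)
    (s := Metric.closedBall (0 : E) (ρ / 3)) (f := fun y => Φ (y + x) - Φ y)
    (f' := fun y => fderiv ℝ Φ (y + x) - fderiv ℝ Φ y) (C := K * ‖x‖) (x := -x) (y := 0)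
    (fun y hy => by
      obtain ⟨m1, m2⟩ := hmem y (mem_closedBall_zero_iff.1 hy)
      have d1 : HasFDerivAt (fun y => Φ (y + x)) (fderiv ℝ Φ (y + x)) y :=
        (hball _ m2).1.hasFDerivAt.comp y ((hasFDerivAt_id y).add_const x)
      exact (d1.sub (hball _ m1).1.hasFDerivAt).hasFDerivWithinAt)
    (fun y hy => by
      obtain ⟨m1, m2⟩ := hmem y (mem_closedBall_zero_iff.1 hy)
      have := hK.dist_le_mul _ (hball _ m2).2 _ (hball _ m1).2
      rw [dist_eq_norm, dist_eq_norm, add_sub_cancel_left] at this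
      exact this)
    (convex_closedBall _ _) (by rw [mem_closedBall_zero_iff, norm_neg]; exact hx)
    (by rw [mem_closedBall_zero_iff, norm_zero]; positivity)
  simp only [zero_add, neg_add_cancel, sub_neg_eq_add] at h1
  calc ‖Φ x + Φ (-x) - (2 : ℝ) • Φ 0‖ = ‖Φ x - Φ 0 - (Φ 0 - Φ (-x))‖ := by
        rw [two_smul]; congr 1; abel
    _ ≤ K * ‖x‖ ^ 2 := by rw [sq, ← mul_assoc]; exact h1

/-- A real function with derivative at least `m` between `0` and `t` moves by at least `|t| m`. -/
theorem mul_le_abs_sub_of_le_deriv {R R' : ℝ → ℝ} {t m : ℝ} (ht : t ≠ 0)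
    (hR : ∀ σ ∈ Set.uIcc 0 t, HasDerivWithinAt R (R' σ) (Set.uIcc 0 t) σ)
    (hm : ∀ σ ∈ Set.uIcc 0 t, m ≤ R' σ) : |t| * m ≤ |R t - R 0| := by
  rcases lt_or_gt_of_ne ht with h | h
  · rw [Set.uIcc_of_ge h.le] at hR hm
    obtain ⟨ρ, hρ, e⟩ := exists_hasDerivAt_eq_slope R R' h
      (fun σ hσ => (hR σ hσ).continuousWithinAt)
      (fun σ hσ => (hR σ (Set.Ioo_subset_Icc_self hσ)).hasDerivAt (Icc_mem_nhds hσ.1 hσ.2))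
    have h1 := hm ρ (Set.Ioo_subset_Icc_self hρ)
    rw [e, zero_sub, le_div_iff₀ (by linarith)] at h1
    rw [abs_of_neg h, abs_sub_comm]
    exact le_trans (by linarith) (le_abs_self _)
  · rw [Set.uIcc_of_le h.le] at hR hm
    obtain ⟨ρ, hρ, e⟩ := exists_hasDerivAt_eq_slope R R' h
      (fun σ hσ => (hR σ hσ).continuousWithinAt)
      (fun σ hσ => (hR σ (Set.Ioo_subset_Icc_self hσ)).hasDerivAt (Icc_mem_nhds hσ.1 hσ.2))
    have h1 := hm ρ (Set.Ioo_subset_Icc_self hρ)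
    rw [e, sub_zero, le_div_iff₀ h] at h1
    rw [abs_of_pos h]
    exact le_trans (by linarith) (le_abs_self _)

/-! ### The bilinear estimate that a solution map of class `C²` would imply -/

/-- The time derivative, tested with `ψ` in the interaction representation, of the second Picard
iterate of the second component for data with the Fourier profiles `A` and `B`. -/
def picard (α : ℝ) {A B : ℝ → ℂ} (hA : IsTest A) (hB : IsTest B) (ψ : ℝ → ℂ) (σ : ℝ) : ℂ :=
  ∫ ξ, (-2 * Real.pi * Complex.I * ξ * (phase (-(α * σ)) ξ * ψ ξ)) *
    𝓕 (fun x => hA.free σ x * hB.free (α * σ) x) ξ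

variable {α s t : ℝ} {U : Set (H s × H s)} {Φ : H s × H s → H s × H s}

/-- The pairing of the second component of `Φ` with a frequency profile, for data with Fourier
profiles `ε A` and `ε B`, as the value at time `t` of a differentiable function `z` of time. It
starts from `0` because the supports of `ψ` and `B` are disjoint. The constant `K` does not depend
on `ε`. -/
theorem IsSolutionMap.exists_interaction (hΦ : IsSolutionMap α s t U Φ) {A B ψ : ℝ → ℂ}
    (hA : IsTest A) (hAr : ∀ ξ, conj (A ξ) = A ξ) (hAe : ∀ ξ, A (-ξ) = A ξ)
    (hB : IsTest B) (hBr : ∀ ξ, conj (B ξ) = B ξ) (hBe : ∀ ξ, B (-ξ) = B ξ)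
    (hψ : IsTest ψ) (hψB : ∀ ξ, ψ ξ * B ξ = 0) :
    ∃ K : ℝ, ∀ ε : ℝ, ε • (ofProfile s hA hAr hAe, ofProfile s hB hBr hBe) ∈ U →
      ∃ z z' : ℝ → ℂ,
        (∀ σ ∈ Set.uIcc 0 t, HasDerivWithinAt z (z' σ) (Set.uIcc 0 t) σ) ∧
        (∀ σ ∈ Set.uIcc 0 t, ‖z' σ - ε ^ 2 * picard α hA hB ψ σ‖ ≤ K * (ε ^ 2 * √|ε|)) ∧
        z 0 = 0 ∧
        z t = (Φ (ε • (ofProfile s hA hAr hAe, ofProfile s hB hBr hBe))).2.toDistr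
          (𝓕 (hψ.phase_mul (-(α * t))).toSchwartz) := by
  refine ⟨derivNorm ψ * (2 * √(nrm2 A ^ 2 + nrm2 B ^ 2) *
        √(2 * (derivNorm A + derivNorm B) * (nrm2 A ^ 2 + nrm2 B ^ 2) * |t|)), fun ε hε => ?_⟩
  obtain ⟨u, v, h, hu0, hv0, -, hvt⟩ := hΦ.exists_solution _ hε
    (isSchwartz_smul_ofProfile hA hAr hAe ε) (isSchwartz_smul_ofProfile hB hBr hBe ε)
  have hu : (u 0).hat =ᵐ[volume] fun ξ => ε * A ξ :=
    H.hat_ae_of_toDistr (continuous_const.mul hA.continuous).locallyIntegrable fun φ => by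
      rw [hu0]; exact toDistr_smul_ofProfile_fourier hA hAr hAe ε φ
  have hv : (v 0).hat =ᵐ[volume] fun ξ => ε * B ξ :=
    H.hat_ae_of_toDistr (continuous_const.mul hB.continuous).locallyIntegrable fun φ => by
      rw [hv0]; exact toDistr_smul_ofProfile_fourier hB hBr hBe ε φ
  refine ⟨_, _, fun σ hσ => h.weakEvol_snd.hasDerivWithinAt_interaction hψ hσ, fun σ hσ => ?_,
    ?_, ?_⟩
  · refine h.norm_deriv_sub_le isCompact_uIcc (convex_uIcc 0 t) hA hAr hB hBr Set.left_mem_uIcc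
      hu hv hσ ?_ hψ
    simpa using Set.abs_sub_left_of_mem_uIcc hσ
  · refine integral_eq_zero_of_ae ?_
    filter_upwards [hv] with ξ hξ
    rw [hξ, Pi.zero_apply]
    linear_combination phase (-(α * 0)) ξ * ε * hψB ξ
  · rw [← hvt, H.toDistr_fourier]
    rfl

/-- If the solution map is of class `C²`, then the second Picard iterate is bounded in `Hˢ`. The
estimate is stated by duality: `μ` is a lower bound at all times for the time derivative of the
second Picard iterate, tested with `ψ`. The factor `I` makes up for the one in the symbol of
`∂ₓ`. -/
theorem IsSolutionMap.exists_bilinear_bound (ht : t ≠ 0) (hU : IsOpen U) (h0 : 0 ∈ U)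
    (hΦ : IsSolutionMap α s t U Φ) (hC2 : ContDiffOn ℝ 2 Φ U) :
    ∃ K : ℝ, 0 ≤ K ∧ ∀ {A B ψ : ℝ → ℂ} (hA : IsTest A) (_ : ∀ ξ, conj (A ξ) = A ξ)
      (_ : ∀ ξ, A (-ξ) = A ξ) (hB : IsTest B) (_ : ∀ ξ, conj (B ξ) = B ξ)
      (_ : ∀ ξ, B (-ξ) = B ξ) (_ : IsTest ψ) (_ : ∀ ξ, ψ ξ * B ξ = 0) (μ : ℝ),
      (∀ σ ∈ Set.uIcc 0 t, μ ≤ (Complex.I * picard α hA hB ψ σ).re) →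
      |t| * μ ≤ K * (nrm2 (fun ξ => sobWeight s ξ * A ξ) +
        nrm2 (fun ξ => sobWeight s ξ * B ξ)) ^ 2 * nrm2 (fun ξ => sobWeight (-s) ξ * ψ ξ) := by
  obtain ⟨K, r, hK, hr, hsec⟩ :=
    exists_second_difference_le (hC2.contDiffAt (hU.mem_nhds h0))
  obtain ⟨ρ, hρ, hball⟩ := Metric.isOpen_iff.1 hU 0 h0
  refine ⟨K, hK, fun {A B ψ} hA hAr hAe hB hBr hBe hψ hψB μ hμ => ?_⟩
  obtain ⟨K', hK'⟩ := hΦ.exists_interaction hA hAr hAe hB hBr hBe hψ hψB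
  set d : H s × H s := (ofProfile s hA hAr hAe, ofProfile s hB hBr hBe) with hd
  have hψt := hψ.phase_mul (-(α * t))
  set n := nrm2 (fun ξ => sobWeight (-s) ξ * ψ ξ) with hn
  have hn' : nrm2 (fun ξ => sobWeight (-s) ξ * (phase (-(α * t)) ξ * ψ ξ)) = n := by
    have hc : ContDiff ℝ ∞ (fun ξ : ℝ => (sobWeight (-s) ξ : ℂ)) :=
      (hasTemperateGrowth_sobWeight (-s)).1
    have e : nrm2 (fun ξ => sobWeight (-s) ξ * (phase (-(α * t)) ξ * ψ ξ)) ^ 2 = n ^ 2 := by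
      rw [nrm2_sq (hψt.mul_left hc).memLp, nrm2_sq (hψ.mul_left hc).memLp]
      simp only [norm_mul, norm_phase, one_mul]
    exact (pow_left_inj₀ (nrm2_nonneg _) (nrm2_nonneg _) two_ne_zero).1 e
  have hn0 : 0 ≤ n := nrm2_nonneg _
  have hdn : ‖d‖ ≤ nrm2 (fun ξ => sobWeight s ξ * A ξ) + nrm2 (fun ξ => sobWeight s ξ * B ξ) := by
    rw [Prod.norm_def, ← norm_ofProfile hA hAr hAe, ← norm_ofProfile hB hBr hBe]
    exact max_le (le_add_of_nonneg_right (norm_nonneg _)) (le_add_of_nonneg_left (norm_nonneg _))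
  -- the second difference of the component that is tested, for data of size `ε`
  have key : ∀ ε : ℝ, 0 < ε → ‖ε • d‖ ≤ r → ‖ε • d‖ < ρ →
      |t| * (2 * μ - 2 * (K' * √ε)) ≤ K * ‖d‖ ^ 2 * n := by
    intro ε hε h1 h2
    have hin : ∀ e : ℝ, |e| ≤ ε → e • d ∈ U := by
      intro e he
      apply hball
      rw [mem_ball_zero_iff]
      refine lt_of_le_of_lt ?_ h2
      rw [norm_smul, norm_smul, Real.norm_eq_abs, Real.norm_eq_abs, abs_of_pos hε]
      exact mul_le_mul_of_nonneg_right he (norm_nonneg _)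
    obtain ⟨z₁, z₁', hz₁, hb₁, h₁0, h₁t⟩ := hK' ε (hin ε (abs_of_pos hε).le)
    obtain ⟨z₂, z₂', hz₂, hb₂, h₂0, h₂t⟩ := hK' (-ε) (hin (-ε) (by rw [abs_neg, abs_of_pos hε]))
    obtain ⟨z₃, z₃', hz₃, hb₃, h₃0, h₃t⟩ := hK' 0 (hin 0 (by rw [abs_zero]; exact hε.le))
    have hR : ∀ σ ∈ Set.uIcc 0 t, HasDerivWithinAt
        (fun σ => (Complex.I * (z₁ σ + z₂ σ - 2 * z₃ σ)).re)
        (Complex.I * (z₁' σ + z₂' σ - 2 * z₃' σ)).re (Set.uIcc 0 t) σ := by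
      intro σ hσ
      exact Complex.reCLM.hasFDerivAt.comp_hasDerivWithinAt σ
        ((((hz₁ σ hσ).add (hz₂ σ hσ)).sub ((hz₃ σ hσ).const_mul 2)).const_mul Complex.I)
    -- the second Picard iterate is even in `ε`, so it enters twice
    have hm : ∀ σ ∈ Set.uIcc 0 t, ε ^ 2 * (2 * μ - 2 * (K' * √ε)) ≤
        (Complex.I * (z₁' σ + z₂' σ - 2 * z₃' σ)).re := by
      intro σ hσ
      have b1 := hb₁ σ hσ
      have b2 := hb₂ σ hσ
      have b3 := hb₃ σ hσ
      have hz : z₃' σ = 0 := by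
        rw [← norm_le_zero_iff]
        simpa using b3
      rw [abs_of_pos hε] at b1
      rw [abs_neg, abs_of_pos hε, neg_sq] at b2
      have b2' : ‖z₂' σ - ε ^ 2 * picard α hA hB ψ σ‖ ≤ K' * (ε ^ 2 * √ε) := by
        simpa using b2
      have e : (Complex.I * (z₁' σ + z₂' σ - 2 * z₃' σ)).re =
          2 * ε ^ 2 * (Complex.I * picard α hA hB ψ σ).re +
          (Complex.I * (z₁' σ - ε ^ 2 * picard α hA hB ψ σ)).re +
          (Complex.I * (z₂' σ - ε ^ 2 * picard α hA hB ψ σ)).re := by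
        have e1 : (2 * ε ^ 2 * (Complex.I * picard α hA hB ψ σ).re : ℝ) =
            (((2 * ε ^ 2 : ℝ) : ℂ) * (Complex.I * picard α hA hB ψ σ)).re :=
          (Complex.re_ofReal_mul _ _).symm
        rw [e1, ← Complex.add_re, ← Complex.add_re, hz]
        congr 1
        push_cast
        ring
      have c : ∀ {w : ℂ} {b : ℝ}, ‖w‖ ≤ b → -b ≤ (Complex.I * w).re := by
        intro w b hw
        have h3 := (Complex.abs_re_le_norm (Complex.I * w))
        rw [norm_mul, Complex.norm_I, one_mul] at h3
        exact (abs_le.1 (h3.trans hw)).1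
      have c1 := c b1
      have c2 := c b2'
      have c3 := mul_le_mul_of_nonneg_left (hμ σ hσ) (by positivity : 0 ≤ 2 * ε ^ 2)
      rw [e]
      linarith
    have h3 := mul_le_abs_sub_of_le_deriv ht hR hm
    simp only [h₁0, h₂0, h₃0, add_zero, mul_zero, sub_zero, Complex.zero_re] at h3
    have e2 : z₁ t + z₂ t - 2 * z₃ t = (Φ (ε • d) + Φ (-(ε • d)) - (2 : ℝ) • Φ 0).2.toDistr
        (𝓕 hψt.toSchwartz) := by
      rw [h₁t, h₂t, h₃t, zero_smul, neg_smul]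
      have e3 : ∀ (a b c : H s) (φ : 𝓢(ℝ, ℂ)), (a + b - (2 : ℝ) • c).toDistr φ =
          a.toDistr φ + b.toDistr φ - (2 : ℝ) • c.toDistr φ := fun _ _ _ _ => rfl
      rw [Prod.snd_sub, Prod.snd_add, Prod.smul_snd, e3, Complex.real_smul]
      norm_num
    have h4 : |(Complex.I * (z₁ t + z₂ t - 2 * z₃ t)).re| ≤ K * ‖ε • d‖ ^ 2 * n := by
      refine (Complex.abs_re_le_norm _).trans ?_
      rw [norm_mul, Complex.norm_I, one_mul, e2]
      refine (H.norm_toDistr_fourier_le _ hψt).trans ?_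
      rw [hn']
      exact mul_le_mul_of_nonneg_right ((norm_snd_le _).trans (hsec _ h1)) hn0
    rw [norm_smul, Real.norm_eq_abs, abs_of_pos hε] at h4
    have h5 : ε ^ 2 * (|t| * (2 * μ - 2 * (K' * √ε))) ≤ ε ^ 2 * (K * ‖d‖ ^ 2 * n) := by
      have := h3.trans h4
      linarith
    exact le_of_mul_le_mul_left h5 (by positivity)
  have hev : ∀ᶠ ε : ℝ in nhdsWithin 0 (Set.Ioi 0),
      |t| * (2 * μ - 2 * (K' * √ε)) ≤ K * ‖d‖ ^ 2 * n := by
    have hc : Filter.Tendsto (fun ε : ℝ => ‖ε • d‖) (nhdsWithin 0 (Set.Ioi 0)) (nhds 0) := by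
      have : Continuous (fun ε : ℝ => |ε| * ‖d‖) := by fun_prop
      have h := this.tendsto 0
      rw [abs_zero, zero_mul] at h
      simp only [norm_smul, Real.norm_eq_abs]
      exact h.mono_left nhdsWithin_le_nhds
    filter_upwards [hc.eventually (gt_mem_nhds hr), hc.eventually (gt_mem_nhds hρ),
      self_mem_nhdsWithin] with ε h1 h2 h3
    exact key ε h3 h1.le h2
  have hlim : Filter.Tendsto (fun ε : ℝ => |t| * (2 * μ - 2 * (K' * √ε)))
      (nhdsWithin 0 (Set.Ioi 0)) (nhds (|t| * (2 * μ))) := by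
    have : Continuous (fun ε : ℝ => |t| * (2 * μ - 2 * (K' * √ε))) := by fun_prop
    have h := this.tendsto 0
    rw [Real.sqrt_zero, mul_zero, mul_zero, sub_zero] at h
    exact h.mono_left nhdsWithin_le_nhds
  have hfin := le_of_tendsto hlim hev
  have h6 : K * ‖d‖ ^ 2 * n ≤ K * (nrm2 (fun ξ => sobWeight s ξ * A ξ) +
        nrm2 (fun ξ => sobWeight s ξ * B ξ)) ^ 2 * n := by
    gcongr
  have h7 : 0 ≤ K * ‖d‖ ^ 2 * n := by positivity
  linarith

/-! ### The resonant interaction -/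

/-- The Fourier transform of a product, as a convolution. -/
theorem fourier_mul_fourierInv (S R : 𝓢(ℝ, ℂ)) (ξ : ℝ) :
    𝓕 (fun x : ℝ => ((𝓕⁻ S : 𝓢(ℝ, ℂ)) x * (𝓕⁻ R : 𝓢(ℝ, ℂ)) x : ℂ)) ξ =
      ∫ η, S η * R (ξ - η) := by
  set C := SchwartzMap.convolution (ContinuousLinearMap.mul ℂ ℂ) S R with hC
  have e1 : ∀ (T : 𝓢(ℝ, ℂ)) (x : ℝ), (𝓕⁻ T : 𝓢(ℝ, ℂ)) x = (𝓕 T : 𝓢(ℝ, ℂ)) (-x) := by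
    intro T x
    rw [SchwartzMap.fourierInv_coe, SchwartzMap.fourier_coe, Real.fourierInv_eq_fourier_neg]
  have e2 : (fun x : ℝ => ((𝓕⁻ S : 𝓢(ℝ, ℂ)) x * (𝓕⁻ R : 𝓢(ℝ, ℂ)) x : ℂ)) =
      fun x => (𝓕 C : 𝓢(ℝ, ℂ)) (-x) := by
    ext x
    rw [e1, e1, hC, SchwartzMap.fourier_convolution, SchwartzMap.pairing_apply_apply]
    rfl
  rw [e2, ← Real.fourierInv_eq_fourier_comp_neg, ← SchwartzMap.fourierInv_coe,
    fourierInv_fourier_eq, hC, SchwartzMap.convolution_apply]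
  rfl

/-- The resonance function of the interaction of `u` at frequency `η` with `v` at frequency
`ξ - η`, with output in `v` at frequency `ξ`. -/
def resonance (α ξ η : ℝ) : ℝ := η ^ 3 + α * (ξ - η) ^ 3 - α * ξ ^ 3

theorem phase_mul_phase_mul_phase (α σ ξ η : ℝ) :
    phase (-(α * σ)) ξ * (phase σ η * phase (α * σ) (ξ - η)) =
      Complex.exp (((σ * (2 * Real.pi) ^ 3 * resonance α ξ η : ℝ) : ℂ) * Complex.I) := by
  rw [phase, phase, phase, ← Complex.exp_add, ← Complex.exp_add, resonance]
  congr 1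
  push_cast
  ring

theorem integral_indicator_const (y γ c : ℝ) (hγ : 0 ≤ γ) :
    ∫ η, (Set.Icc (y - γ / 2) (y + γ / 2)).indicator (fun _ => c) η = γ * c := by
  rw [MeasureTheory.integral_indicator measurableSet_Icc, setIntegral_const, Measure.real,
    Real.volume_Icc, ENNReal.toReal_ofReal (by linarith), smul_eq_mul]
  ring

theorem integrable_indicator_const (y γ c : ℝ) :
    Integrable ((Set.Icc (y - γ / 2) (y + γ / 2)).indicator (fun _ => c)) :=
  (integrable_indicator_iff measurableSet_Icc).2
    (integrableOn_const (by rw [Real.volume_Icc]; exact ENNReal.ofReal_ne_top))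

/-- Where all interactions are nearly resonant, there is no cancellation in the derivative of
the second Picard iterate. Here `x` and `y` are the centres of windows of width `γ` for the output
frequency and the frequency of the first factor, and `P` is a lower bound for the symbol of the
derivative. -/
theorem le_re_picard {α σ : ℝ} {a b ψ : ℝ → ℝ} (hA : IsTest (fun ξ => (a ξ : ℂ)))
    (hB : IsTest (fun ξ => (b ξ : ℂ))) (hψ : IsTest (fun ξ => (ψ ξ : ℂ)))
    (ha : ∀ ξ, 0 ≤ a ξ) (hb : ∀ ξ, 0 ≤ b ξ) (hψ0 : ∀ ξ, 0 ≤ ψ ξ)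
    (hψpos : ∀ ξ, ψ ξ ≠ 0 → 0 ≤ ξ)
    (hres : ∀ ξ η, ψ ξ ≠ 0 → a η ≠ 0 → b (ξ - η) ≠ 0 →
      |σ * (2 * Real.pi) ^ 3 * resonance α ξ η| ≤ 1)
    {x y γ P : ℝ} (hγ : 0 ≤ γ) (hP : 0 ≤ P)
    (hψ1 : ∀ ξ ∈ Set.Icc (x - γ / 2) (x + γ / 2), 1 ≤ ψ ξ ∧ P ≤ 2 * Real.pi * ξ)
    (ha1 : ∀ η ∈ Set.Icc (y - γ / 2) (y + γ / 2), 1 ≤ a η)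
    (hb1 : ∀ ξ ∈ Set.Icc (x - γ / 2) (x + γ / 2), ∀ η ∈ Set.Icc (y - γ / 2) (y + γ / 2),
      1 ≤ b (ξ - η)) :
    P * γ ^ 2 / 2 ≤ (Complex.I * picard α hA hB (fun ξ => (ψ ξ : ℂ)) σ).re := by
  have hπ := Real.pi_pos
  set F : ℝ → ℂ := fun ξ => (-2 * Real.pi * Complex.I * ξ * (phase (-(α * σ)) ξ * ψ ξ)) *
    𝓕 (fun x => hA.free σ x * hB.free (α * σ) x) ξ with hF
  have hFi : Integrable F := by
    have hn : Integrable (fun x => hA.free σ x * hB.free (α * σ) x) :=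
      integrable_mul_of_memLp ((hA.free σ).memLp 2 volume) ((hB.free (α * σ)).memLp 2 volume)
    exact ((hψ.phase_mul _).mul_left (contDiff_ofReal_mul_const _)).integrable.mul_bdd
      (c := ∫ x, ‖hA.free σ x * hB.free (α * σ) x‖) (continuous_fourier hn).aestronglyMeasurable
      (Filter.Eventually.of_forall fun ξ => norm_fourier_le _ _)
  -- the integrand of the inner integral
  set q : ℝ → ℝ → ℝ := fun ξ η => a η * b (ξ - η) *
    Real.cos (σ * (2 * Real.pi) ^ 3 * resonance α ξ η) with hq
  have hconv : ∀ ξ, (Complex.I * F ξ).re = 2 * Real.pi * ξ * ψ ξ * ∫ η, q ξ η := by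
    intro ξ
    have hi : Integrable (fun η => phase (-(α * σ)) ξ *
        ((phase σ η * a η) * (phase (α * σ) (ξ - η) * b (ξ - η)))) := by
      obtain ⟨C, hC⟩ := (hB.phase_mul (α * σ)).exists_bound
      exact ((hA.phase_mul σ).integrable.mul_bdd (c := C)
        ((hB.phase_mul (α * σ)).continuous.comp
          (continuous_const.sub continuous_id)).aestronglyMeasurable
        (Filter.Eventually.of_forall fun η => hC _)).const_mul _
    have e1 : Complex.I * F ξ = ((2 * Real.pi * ξ * ψ ξ : ℝ) : ℂ) *
        ∫ η, phase (-(α * σ)) ξ *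
          ((phase σ η * a η) * (phase (α * σ) (ξ - η) * b (ξ - η))) := by
      rw [integral_const_mul]
      simp only [hF]
      rw [IsTest.free, IsTest.free, fourier_mul_fourierInv]
      simp only [IsTest.toSchwartz_apply]
      push_cast
      linear_combination (-2 * Real.pi * ξ * phase (-(α * σ)) ξ * ψ ξ *
        ∫ η, (phase σ η * a η) * (phase (α * σ) (ξ - η) * b (ξ - η))) * Complex.I_sq
    rw [e1, Complex.re_ofReal_mul]
    congr 1
    have e2 := integral_re (𝕜 := ℂ) hi
    rw [RCLike.re_eq_complex_re] at e2
    rw [← e2]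
    refine integral_congr_ae (Filter.Eventually.of_forall fun η => ?_)
    have e3 : phase (-(α * σ)) ξ * ((phase σ η * a η) * (phase (α * σ) (ξ - η) * b (ξ - η))) =
        ((a η * b (ξ - η) : ℝ) : ℂ) *
          (phase (-(α * σ)) ξ * (phase σ η * phase (α * σ) (ξ - η))) := by
      push_cast
      ring
    simp only
    rw [e3, phase_mul_phase_mul_phase, Complex.re_ofReal_mul, Complex.exp_ofReal_mul_I_re]
  have hqi : ∀ ξ, Integrable (q ξ) := by
    intro ξ
    obtain ⟨C, hC⟩ := hB.exists_bound
    have hbc : Continuous b := by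
      have := Complex.continuous_re.comp hB.continuous
      exact this
    have hai : Integrable a := by
      have := hA.integrable.re
      exact this
    have h1 : Integrable (fun η => a η * (b (ξ - η) *
        Real.cos (σ * (2 * Real.pi) ^ 3 * resonance α ξ η))) := by
      refine hai.mul_bdd (c := C) ?_ (Filter.Eventually.of_forall fun η => ?_)
      · refine Continuous.aestronglyMeasurable ?_
        unfold resonance
        fun_prop
      · rw [norm_mul]
        have h2 := hC (ξ - η)
        rw [Complex.norm_real] at h2
        have h3 := Real.abs_cos_le_one (σ * (2 * Real.pi) ^ 3 * resonance α ξ η)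
        rw [← Real.norm_eq_abs] at h3
        nlinarith [norm_nonneg (b (ξ - η)),
          norm_nonneg (Real.cos (σ * (2 * Real.pi) ^ 3 * resonance α ξ η))]
    simpa only [hq, mul_assoc] using h1
  -- on the support of the data the cosine is at least one half
  have hqlow : ∀ ξ, ψ ξ ≠ 0 → ∀ η, a η * b (ξ - η) / 2 ≤ q ξ η := by
    intro ξ hξ η
    by_cases h1 : a η = 0
    · simp [hq, h1]
    by_cases h2 : b (ξ - η) = 0
    · simp [hq, h2]
    have h3 := abs_le.1 (hres ξ η hξ h1 h2)
    have h4 := Real.one_sub_sq_div_two_le_cos (x := σ * (2 * Real.pi) ^ 3 * resonance α ξ η)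
    have h5 : (1 : ℝ) / 2 ≤ Real.cos (σ * (2 * Real.pi) ^ 3 * resonance α ξ η) := by
      nlinarith [h3.1, h3.2]
    have h6 := mul_le_mul_of_nonneg_left h5 (mul_nonneg (ha η) (hb (ξ - η)))
    simp only [hq]
    linarith
  have hpoint : ∀ ξ, (Set.Icc (x - γ / 2) (x + γ / 2)).indicator (fun _ => P * (γ / 2)) ξ ≤
      (Complex.I * F ξ).re := by
    intro ξ
    rw [hconv]
    by_cases hξ : ψ ξ = 0
    · rw [hξ, mul_zero, zero_mul]
      refine (Set.indicator_of_notMem (fun h => ?_) _).le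
      have := (hψ1 ξ h).1
      linarith
    have h0 : 0 ≤ ∫ η, q ξ η := integral_nonneg fun η =>
      (div_nonneg (mul_nonneg (ha η) (hb _)) zero_le_two).trans (hqlow ξ hξ η)
    by_cases hmem : ξ ∈ Set.Icc (x - γ / 2) (x + γ / 2)
    · rw [Set.indicator_of_mem hmem]
      obtain ⟨h1, h2⟩ := hψ1 ξ hmem
      have h3 : γ / 2 ≤ ∫ η, q ξ η := by
        have h4 : γ * (1 / 2) = ∫ η, (Set.Icc (y - γ / 2) (y + γ / 2)).indicator
          (fun _ => (1 / 2 : ℝ)) η := (integral_indicator_const y γ _ hγ).symm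
        rw [div_eq_mul_one_div, h4]
        refine integral_mono (integrable_indicator_const y γ _) (hqi ξ) fun η => ?_
        by_cases hη : η ∈ Set.Icc (y - γ / 2) (y + γ / 2)
        · rw [Set.indicator_of_mem hη]
          have h5 := hqlow ξ hξ η
          have h6 := one_le_mul_of_one_le_of_one_le (ha1 η hη) (hb1 ξ hmem η hη)
          linarith
        · rw [Set.indicator_of_notMem hη]
          exact (div_nonneg (mul_nonneg (ha η) (hb _)) zero_le_two).trans (hqlow ξ hξ η)
      have h7 : P ≤ 2 * Real.pi * ξ * ψ ξ := by nlinarith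
      exact mul_le_mul h7 h3 (by positivity) (hP.trans h7)
    · rw [Set.indicator_of_notMem hmem]
      have := hψpos ξ hξ
      have := hψ0 ξ
      positivity
  have e : (Complex.I * picard α hA hB (fun ξ => (ψ ξ : ℂ)) σ).re = ∫ ξ, (Complex.I * F ξ).re := by
    have e2 := integral_re (𝕜 := ℂ) (hFi.const_mul Complex.I)
    rw [integral_const_mul, RCLike.re_eq_complex_re] at e2
    exact e2.symm
  rw [e]
  refine le_trans (le_of_eq ?_) (integral_mono (integrable_indicator_const x γ _)
    (hFi.const_mul Complex.I).re hpoint)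
  rw [integral_indicator_const x γ _ hγ]
  ring

/-! ### Frequency-localized data -/

/-- A smooth bump of height `1` on the interval of radius `γ` around `c`, supported in the interval
of twice this radius. -/
def bump (c γ ξ : ℝ) : ℝ :=
  (⟨1, 2, one_pos, one_lt_two⟩ : ContDiffBump (0 : ℝ)) ((ξ - c) / γ)

theorem bump_nonneg (c γ ξ : ℝ) : 0 ≤ bump c γ ξ := ContDiffBump.nonneg _

theorem bump_neg_neg (c γ ξ : ℝ) : bump (-c) γ (-ξ) = bump c γ ξ := by
  rw [bump, bump, ← ContDiffBump.neg]
  congr 1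
  ring

theorem bump_eq_one {c γ ξ : ℝ} (hγ : 0 < γ) (h : |ξ - c| ≤ γ) : bump c γ ξ = 1 := by
  refine ContDiffBump.one_of_mem_closedBall _ ?_
  rw [mem_closedBall_zero_iff, Real.norm_eq_abs, abs_div, abs_of_pos hγ]
  exact (div_le_one hγ).2 h

theorem abs_lt_of_bump_ne_zero {c γ ξ : ℝ} (hγ : 0 < γ) (h : bump c γ ξ ≠ 0) :
    |ξ - c| < 2 * γ := by
  by_contra hc
  refine h (ContDiffBump.zero_of_le_dist _ ?_)
  rw [dist_zero_right, Real.norm_eq_abs, abs_div, abs_of_pos hγ, le_div_iff₀ hγ]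
  exact not_lt.1 hc

theorem isTest_bump (c : ℝ) {γ : ℝ} (hγ : 0 < γ) : IsTest (fun ξ => (bump c γ ξ : ℂ)) := by
  constructor
  · refine Complex.ofRealCLM.contDiff.comp (g := Complex.ofRealCLM) (f := bump c γ) ?_
    exact (ContDiffBump.contDiff _).comp ((contDiff_id.sub contDiff_const).div_const γ)
  · refine HasCompactSupport.intro (K := Set.Icc (c - 2 * γ) (c + 2 * γ)) isCompact_Icc
      fun ξ hξ => ?_
    by_contra h
    refine hξ ?_
    have h1 := abs_lt.1 (abs_lt_of_bump_ne_zero hγ (fun h0 => h (by rw [h0]; rfl)))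
    constructor <;> linarith [h1.1, h1.2]

theorem nrm2_bump (c : ℝ) {γ : ℝ} (hγ : 0 < γ) :
    nrm2 (fun ξ => (bump c γ ξ : ℂ)) = √γ * nrm2 (fun ξ => (bump 0 1 ξ : ℂ)) := by
  rw [nrm2_eq_sqrt (isTest_bump c hγ).memLp, nrm2_eq_sqrt (isTest_bump 0 one_pos).memLp,
    ← Real.sqrt_mul hγ.le]
  congr 1
  have h1 := integral_sub_right_eq_self (μ := (volume : Measure ℝ))
    (fun ξ => ‖(bump 0 1 (ξ / γ) : ℂ)‖ ^ 2) c
  have h2 := Measure.integral_comp_div (fun ξ => ‖(bump 0 1 ξ : ℂ)‖ ^ 2) γ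
  rw [abs_of_pos hγ, smul_eq_mul] at h2
  rw [← h2, ← h1]
  simp only [bump, sub_zero, div_one]

/-- Two symmetric bumps, at the frequencies `c` and `-c`. -/
def twoBumps (c γ ξ : ℝ) : ℝ := bump c γ ξ + bump (-c) γ ξ

theorem twoBumps_nonneg (c γ ξ : ℝ) : 0 ≤ twoBumps c γ ξ :=
  add_nonneg (bump_nonneg _ _ _) (bump_nonneg _ _ _)

theorem twoBumps_neg (c γ ξ : ℝ) : twoBumps c γ (-ξ) = twoBumps c γ ξ := by
  have h := bump_neg_neg (-c) γ ξ
  rw [neg_neg] at h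
  rw [twoBumps, twoBumps, h, bump_neg_neg, add_comm]

theorem one_le_twoBumps {c γ ξ : ℝ} (hγ : 0 < γ) (h : |ξ - c| ≤ γ) : 1 ≤ twoBumps c γ ξ := by
  rw [twoBumps, bump_eq_one hγ h]
  linarith [bump_nonneg (-c) γ ξ]

theorem abs_lt_of_twoBumps_ne_zero {c γ ξ : ℝ} (hγ : 0 < γ) (h : twoBumps c γ ξ ≠ 0) :
    |ξ - c| < 2 * γ ∨ |ξ + c| < 2 * γ := by
  by_cases h1 : bump c γ ξ = 0
  · rw [twoBumps, h1, zero_add] at h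
    have := abs_lt_of_bump_ne_zero hγ h
    rw [sub_neg_eq_add] at this
    exact Or.inr this
  · exact Or.inl (abs_lt_of_bump_ne_zero hγ h1)

theorem isTest_twoBumps (c : ℝ) {γ : ℝ} (hγ : 0 < γ) :
    IsTest (fun ξ => (twoBumps c γ ξ : ℂ)) := by
  have h1 := isTest_bump c hγ
  have h2 := isTest_bump (-c) hγ
  have e : (fun ξ => (twoBumps c γ ξ : ℂ)) =
      (fun ξ => (bump c γ ξ : ℂ)) + fun ξ => (bump (-c) γ ξ : ℂ) := by
    ext ξ
    simp [twoBumps]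
  rw [e]
  exact ⟨h1.contDiff.add h2.contDiff, h1.hasCompactSupport.add h2.hasCompactSupport⟩

theorem nrm2_twoBumps_le (c : ℝ) {γ : ℝ} (hγ : 0 < γ) :
    nrm2 (fun ξ => (twoBumps c γ ξ : ℂ)) ≤ 2 * √γ * nrm2 (fun ξ => (bump 0 1 ξ : ℂ)) := by
  have h := nrm2_add_le (isTest_bump c hγ).memLp (isTest_bump (-c) hγ).memLp
  rw [nrm2_bump c hγ, nrm2_bump (-c) hγ] at h
  have e : (fun ξ => (twoBumps c γ ξ : ℂ)) =
      fun ξ => (bump c γ ξ : ℂ) + (bump (-c) γ ξ : ℂ) := by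
    ext ξ
    simp [twoBumps]
  rw [e]
  linarith

theorem nrm2_sobWeight_mul_le {A : ℝ → ℂ} (hA : MemLp A 2 volume) {s C : ℝ} (hC : 0 ≤ C)
    (h : ∀ ξ, A ξ ≠ 0 → sobWeight s ξ ≤ C) :
    nrm2 (fun ξ => sobWeight s ξ * A ξ) ≤ C * nrm2 A := by
  have e : C * nrm2 A = nrm2 (fun ξ => (C : ℂ) * A ξ) := by
    rw [nrm2_const_mul, Complex.norm_real, Real.norm_eq_abs, abs_of_nonneg hC]
  rw [e]
  refine nrm2_mono (hA.const_mul _) (Filter.Eventually.of_forall fun ξ => ?_)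
  rw [norm_mul, norm_mul, Complex.norm_real, Complex.norm_real, Real.norm_eq_abs, Real.norm_eq_abs,
    abs_of_nonneg hC, abs_of_pos (sobWeight_pos s ξ)]
  by_cases hξ : A ξ = 0
  · simp [hξ]
  · exact mul_le_mul_of_nonneg_right (h ξ hξ) (norm_nonneg _)

theorem sobWeight_le_of_nonpos {s m ξ : ℝ} (hs : s ≤ 0) (hm : 0 < m) (h : m ≤ |ξ|) :
    sobWeight s ξ ≤ m ^ s := by
  have e : m ^ s = (m ^ 2) ^ (s / 2) := by
    rw [← Real.rpow_natCast, ← Real.rpow_mul hm.le]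
    congr 1
    push_cast
    ring
  rw [e, sobWeight, Real.norm_eq_abs]
  refine Real.rpow_le_rpow_of_nonpos (by positivity) ?_ (by linarith)
  have := pow_le_pow_left₀ hm.le h 2
  linarith

theorem sobWeight_le_of_nonneg {s m ξ : ℝ} (hs : 0 ≤ s) (hm : 0 < m) (h : 1 + |ξ| ^ 2 ≤ m ^ 2) :
    sobWeight s ξ ≤ m ^ s := by
  have e : m ^ s = (m ^ 2) ^ (s / 2) := by
    rw [← Real.rpow_natCast, ← Real.rpow_mul hm.le]
    congr 1
    push_cast
    ring
  rw [e, sobWeight, Real.norm_eq_abs]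
  exact Real.rpow_le_rpow (by positivity) h (by linarith)

theorem abs_cube_sub_le {x y M d : ℝ} (hx : |x| ≤ M) (hy : |y| ≤ M) (hd : |x - y| ≤ d) :
    |x ^ 3 - y ^ 3| ≤ 3 * M ^ 2 * d := by
  have hM : 0 ≤ M := (abs_nonneg _).trans hx
  have e : x ^ 3 - y ^ 3 = (x ^ 2 + x * y + y ^ 2) * (x - y) := by ring
  rw [e, abs_mul]
  have h1 : |x ^ 2 + x * y + y ^ 2| ≤ 3 * M ^ 2 := by
    refine (abs_add_three _ _ _).trans ?_
    rw [abs_pow, abs_pow, abs_mul]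
    have := pow_le_pow_left₀ (abs_nonneg x) hx 2
    have := pow_le_pow_left₀ (abs_nonneg y) hy 2
    have := mul_le_mul hx hy (abs_nonneg _) hM
    nlinarith
  exact mul_le_mul h1 hd (abs_nonneg _) (by positivity)

/-- The relation that makes the frequencies `1`, `κ` and `1 + κ` resonant, solved for positive
`κ`. -/
theorem exists_resonant {α : ℝ} (hα₀ : 0 < α) (hα₁ : α < 1) :
    ∃ κ : ℝ, 0 < κ ∧ 1 + α * κ ^ 3 - α * (1 + κ) ^ 3 = 0 := by
  have hc : 0 < (1 - α) / (3 * α) := div_pos (by linarith) (by linarith)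
  set c := (1 - α) / (3 * α) with hcdef
  have hc' : 3 * α * c = 1 - α := by rw [hcdef]; field_simp
  have hs : √(1 + 4 * c) ^ 2 = 1 + 4 * c := Real.sq_sqrt (by linarith)
  have hs1 : 1 < √(1 + 4 * c) := by
    rw [Real.lt_sqrt (by norm_num)]; linarith
  refine ⟨(√(1 + 4 * c) - 1) / 2, by linarith, ?_⟩
  have h2 : ((√(1 + 4 * c) - 1) / 2) ^ 2 + (√(1 + 4 * c) - 1) / 2 = c := by
    linear_combination hs / 4
  linear_combination -3 * α * h2 - hc'

/-- Near the resonant frequencies the resonance function is small. -/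
theorem abs_resonance_le {α κ N γ ξ η : ℝ} (hα₀ : 0 < α) (hα₁ : α < 1) (hκ : 0 < κ)
    (hres : 1 + α * κ ^ 3 - α * (1 + κ) ^ 3 = 0) (hγ : 0 < γ) (hγN : 4 * γ ≤ N)
    (hξ : |ξ - (1 + κ) * N| ≤ 2 * γ) (hη : |η - N| ≤ 2 * γ) :
    |resonance α ξ η| ≤ 24 * (2 + κ) ^ 2 * (N ^ 2 * γ) := by
  have hN : 0 < N := by linarith
  obtain ⟨ξ1, ξ2⟩ := abs_le.1 hξ
  obtain ⟨η1, η2⟩ := abs_le.1 hη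
  have hκN : 0 < κ * N := mul_pos hκ hN
  have c1 := abs_cube_sub_le (x := η) (y := N) (M := (2 + κ) * N) (d := 2 * γ)
    (abs_le.2 ⟨by nlinarith, by nlinarith⟩) (abs_le.2 ⟨by nlinarith, by nlinarith⟩) hη
  have c2 := abs_cube_sub_le (x := ξ - η) (y := κ * N) (M := (2 + κ) * N) (d := 4 * γ)
    (abs_le.2 ⟨by nlinarith, by nlinarith⟩) (abs_le.2 ⟨by nlinarith, by nlinarith⟩)
    (abs_le.2 ⟨by nlinarith, by nlinarith⟩)
  have c3 := abs_cube_sub_le (x := ξ) (y := (1 + κ) * N) (M := (2 + κ) * N) (d := 2 * γ)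
    (abs_le.2 ⟨by nlinarith, by nlinarith⟩) (abs_le.2 ⟨by nlinarith, by nlinarith⟩) hξ
  have e : resonance α ξ η = (η ^ 3 - N ^ 3) + α * ((ξ - η) ^ 3 - (κ * N) ^ 3) -
      α * (ξ ^ 3 - ((1 + κ) * N) ^ 3) := by
    rw [resonance]
    linear_combination N ^ 3 * hres
  have h2 : |α * ((ξ - η) ^ 3 - (κ * N) ^ 3)| ≤ 3 * ((2 + κ) * N) ^ 2 * (4 * γ) := by
    rw [abs_mul, abs_of_pos hα₀]
    exact (mul_le_of_le_one_left (abs_nonneg _) hα₁.le).trans c2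
  have h3 : |α * (ξ ^ 3 - ((1 + κ) * N) ^ 3)| ≤ 3 * ((2 + κ) * N) ^ 2 * (2 * γ) := by
    rw [abs_mul, abs_of_pos hα₀]
    exact (mul_le_of_le_one_left (abs_nonneg _) hα₁.le).trans c3
  rw [e]
  refine (abs_sub _ _).trans ?_
  refine (add_le_add (abs_add_le _ _) le_rfl).trans ?_
  linarith

/-- With data near the frequencies `N` and `κ N` and output near `(1 + κ) N`, all in windows of
width comparable to `N⁻²`, the derivative of the second Picard iterate is bounded below by the
symbol of `∂ₓ` times the widths of the windows of output and input. -/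
theorem le_re_picard_bumps {α κ N γ σ T : ℝ} (hα₀ : 0 < α) (hα₁ : α < 1) (hκ : 0 < κ)
    (hres : 1 + α * κ ^ 3 - α * (1 + κ) ^ 3 = 0) (hγ : 0 < γ) (hγN : 12 * γ ≤ N)
    (hγκ : 12 * γ ≤ κ * N) (hσ : |σ| ≤ T)
    (hT : T * (2 * Real.pi) ^ 3 * (24 * (2 + κ) ^ 2 * (N ^ 2 * γ)) ≤ 1) :
    N * γ ^ 2 / 2 ≤ (Complex.I * picard α (isTest_twoBumps N hγ) (isTest_twoBumps (κ * N) hγ)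
      (fun ξ => (bump ((1 + κ) * N) γ ξ : ℂ)) σ).re := by
  have hN : 0 < N := by linarith
  refine le_re_picard (x := (1 + κ) * N) (y := N) _ _ (isTest_bump _ hγ) (twoBumps_nonneg _ _)
    (twoBumps_nonneg _ _) (bump_nonneg _ _) (fun ξ hξ => ?_) (fun ξ η hξ hη hξη => ?_) hγ.le hN.le
    (fun ξ hξ => ⟨?_, ?_⟩) (fun η hη => ?_) (fun ξ hξ η hη => ?_)
  · have h1 := abs_lt.1 (abs_lt_of_bump_ne_zero hγ hξ)
    linarith [h1.1]
  · have hξ' := abs_lt_of_bump_ne_zero hγ hξ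
    obtain ⟨ξ1, ξ2⟩ := abs_lt.1 hξ'
    -- only the positive frequencies of both factors can add up to `ξ`
    have hη' : |η - N| < 2 * γ := by
      rcases abs_lt_of_twoBumps_ne_zero hγ hη with h | h
      · exact h
      · obtain ⟨η1, η2⟩ := abs_lt.1 h
        rcases abs_lt_of_twoBumps_ne_zero hγ hξη with h' | h' <;> obtain ⟨d1, d2⟩ := abs_lt.1 h' <;>
          exfalso <;> linarith
    have h1 := abs_resonance_le hα₀ hα₁ hκ hres hγ (by linarith) hξ'.le hη'.le
    rw [abs_mul, abs_mul, abs_of_pos (by positivity : 0 < (2 * Real.pi) ^ 3)]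
    refine le_trans ?_ hT
    have : 0 ≤ T := (abs_nonneg _).trans hσ
    gcongr
  · rw [bump_eq_one hγ]
    exact abs_le.2 ⟨by linarith [hξ.1], by linarith [hξ.2]⟩
  · have h1 : N / 2 ≤ ξ := by nlinarith [hξ.1]
    nlinarith [Real.pi_gt_three]
  · exact one_le_twoBumps hγ (abs_le.2 ⟨by linarith [hη.1], by linarith [hη.2]⟩)
  · refine one_le_twoBumps hγ (abs_le.2 ⟨?_, ?_⟩)
    · linarith [hη.1, hη.2, hξ.1, hξ.2]
    · linarith [hη.1, hη.2, hξ.1, hξ.2]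

theorem nrm2_sobWeight_twoBumps_le {s m N c γ : ℝ} (hs : s < 0) (hγ : 0 < γ) (hm : 0 < m)
    (hN : 0 < N) (h : m * N + 2 * γ ≤ c) :
    nrm2 (fun ξ => sobWeight s ξ * (twoBumps c γ ξ : ℂ)) ≤
      (m * N) ^ s * (2 * √γ * nrm2 (fun ξ => (bump 0 1 ξ : ℂ))) := by
  refine (nrm2_sobWeight_mul_le (isTest_twoBumps c hγ).memLp (C := (m * N) ^ s)
    (by positivity) fun ξ hξ => ?_).trans
    (mul_le_mul_of_nonneg_left (nrm2_twoBumps_le c hγ) (by positivity))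
  refine sobWeight_le_of_nonpos hs.le (by positivity) ?_
  rcases abs_lt_of_twoBumps_ne_zero hγ (fun h0 => hξ (by rw [h0]; rfl)) with h' | h' <;>
    obtain ⟨d1, d2⟩ := abs_lt.1 h'
  · exact le_trans (by linarith) (le_abs_self _)
  · exact le_trans (by linarith) (neg_le_abs _)

theorem nrm2_sobWeight_bump_le {s κ N γ : ℝ} (hs : s < 0) (hγ : 0 < γ) (hκ : 0 < κ)
    (hN : 1 ≤ N) (hγN : 12 * γ ≤ N) :
    nrm2 (fun ξ => sobWeight (-s) ξ * (bump ((1 + κ) * N) γ ξ : ℂ)) ≤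
      ((3 + κ) * N) ^ (-s) * (√γ * nrm2 (fun ξ => (bump 0 1 ξ : ℂ))) := by
  rw [← nrm2_bump ((1 + κ) * N) hγ]
  refine nrm2_sobWeight_mul_le (isTest_bump _ hγ).memLp (by positivity) fun ξ hξ => ?_
  refine sobWeight_le_of_nonneg (by linarith) (by positivity) ?_
  obtain ⟨d1, d2⟩ := abs_lt.1 (abs_lt_of_bump_ne_zero hγ (fun h0 => hξ (by rw [h0]; rfl)))
  have h1 : |ξ| ≤ (2 + κ) * N := abs_le.2 ⟨by nlinarith, by nlinarith⟩
  have h2 := pow_le_pow_left₀ (abs_nonneg _) h1 2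
  have h3 : 1 ≤ N ^ 2 := one_le_pow₀ hN
  have h4 : 0 ≤ κ * N ^ 2 := by positivity
  have h5 : ((3 + κ) * N) ^ 2 = ((2 + κ) * N) ^ 2 + 5 * N ^ 2 + 2 * (κ * N ^ 2) := by ring
  linarith

end MajdaBiello

end

/-! ### Growth of the second Picard iterate with the frequency -/

theorem mainTheorem4 (α : ℝ) (hα₀ : 0 < α) (hα₁ : α < 1) (s : ℝ) (t : ℝ) (ht : t ≠ 0)
    (U : Set (MajdaBiello.H s × MajdaBiello.H s)) (hU : IsOpen U) (h0 : 0 ∈ U)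
    (Φ : MajdaBiello.H s × MajdaBiello.H s → MajdaBiello.H s × MajdaBiello.H s)
    (hΦ : MajdaBiello.IsSolutionMap α s t U Φ) (hC2 : ContDiffOn ℝ 2 Φ U) :
    0 ≤ s := by
  by_contra hs
  push Not at hs
  obtain ⟨K, hK, hbound⟩ := hΦ.exists_bilinear_bound ht hU h0 hC2
  obtain ⟨κ, hκ, hres⟩ := MajdaBiello.exists_resonant hα₀ hα₁
  set β := MajdaBiello.nrm2 (fun ξ => (MajdaBiello.bump 0 1 ξ : ℂ)) with hβ
  have hβ0 : 0 ≤ β := MajdaBiello.nrm2_nonneg _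
  -- `m` bounds the frequencies of the data from below, relative to `N`
  obtain ⟨m, hm, hm1, hmκ⟩ : ∃ m : ℝ, 0 < m ∧ 2 * m ≤ 1 ∧ 2 * m ≤ κ :=
    ⟨min (1 / 2) (κ / 2), by positivity, by linarith [min_le_left (1 / 2) (κ / 2)],
      by linarith [min_le_right (1 / 2) (κ / 2)]⟩
  -- the windows of width `c N⁻²` are so small that the phases do not vary
  set Q : ℝ := |t| * (2 * Real.pi) ^ 3 * (24 * (2 + κ) ^ 2) with hQ
  have hQ0 : 0 ≤ Q := by positivity
  obtain ⟨c, hc, hc1, hcκ, hcQ⟩ : ∃ c : ℝ, 0 < c ∧ 12 * c ≤ 1 ∧ 12 * c ≤ κ ∧ Q * c ≤ 1 := by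
    refine ⟨min (1 / 12) (min (κ / 12) (1 / (Q + 1))), by positivity, ?_, ?_, ?_⟩
    · linarith [min_le_left (1 / 12) (min (κ / 12) (1 / (Q + 1)))]
    · linarith [min_le_right (1 / 12) (min (κ / 12) (1 / (Q + 1))),
        min_le_left (κ / 12) (1 / (Q + 1))]
    · have h1 : min (1 / 12) (min (κ / 12) (1 / (Q + 1))) ≤ 1 / (Q + 1) :=
        (min_le_right _ _).trans (min_le_right _ _)
      calc Q * min (1 / 12) (min (κ / 12) (1 / (Q + 1))) ≤ Q * (1 / (Q + 1)) := by gcongr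
        _ ≤ 1 := by rw [mul_one_div, div_le_one (by positivity)]; linarith
  set L : ℝ := K * (16 * m ^ (2 * s) * (3 + κ) ^ (-s) * β ^ 3) with hL
  have key : ∀ N : ℝ, 1 ≤ N → |t| * √c / 2 ≤ L * N ^ s := by
    intro N hN
    have hN0 : 0 < N := by linarith
    set γ := c / N ^ 2 with hγdef
    have hγ : 0 < γ := by positivity
    have hγc : γ ≤ c := div_le_self hc.le (one_le_pow₀ hN)
    have hNγ : N ^ 2 * γ = c := by rw [hγdef]; field_simp
    have hγN : 12 * γ ≤ N := by linarith
    have hγκ : 12 * γ ≤ κ * N := by nlinarith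
    have hconj : ∀ x : ℝ, (starRingEnd ℂ) (x : ℂ) = x := Complex.conj_ofReal
    have h1 := hbound (MajdaBiello.isTest_twoBumps N hγ) (fun ξ => hconj _)
      (fun ξ => by rw [MajdaBiello.twoBumps_neg]) (MajdaBiello.isTest_twoBumps (κ * N) hγ)
      (fun ξ => hconj _) (fun ξ => by rw [MajdaBiello.twoBumps_neg])
      (MajdaBiello.isTest_bump ((1 + κ) * N) hγ) (fun ξ => by
        by_contra hne
        rw [← Complex.ofReal_mul] at hne
        have hne' := Complex.ofReal_ne_zero.1 hne
        obtain ⟨d1, d2⟩ := abs_lt.1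
          (MajdaBiello.abs_lt_of_bump_ne_zero hγ (left_ne_zero_of_mul hne'))
        rcases MajdaBiello.abs_lt_of_twoBumps_ne_zero hγ
          (right_ne_zero_of_mul hne') with h' | h' <;>
          obtain ⟨e1, e2⟩ := abs_lt.1 h' <;> nlinarith)
      (N * γ ^ 2 / 2) (fun σ hσ => MajdaBiello.le_re_picard_bumps hα₀ hα₁ hκ hres hγ hγN hγκ
        (T := |t|) (by simpa using Set.abs_sub_left_of_mem_uIcc hσ) (by
          rw [hNγ]
          refine le_trans (le_of_eq ?_) hcQ
          rw [hQ]; ring))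
    have n1 := MajdaBiello.nrm2_sobWeight_twoBumps_le (c := N) hs hγ hm hN0 (by nlinarith)
    have n2 := MajdaBiello.nrm2_sobWeight_twoBumps_le (c := κ * N) hs hγ hm hN0
      (by nlinarith)
    have n3 := MajdaBiello.nrm2_sobWeight_bump_le hs hγ hκ hN hγN
    rw [← hβ] at n1 n2 n3
    have p1 := MajdaBiello.nrm2_nonneg (fun ξ => MajdaBiello.sobWeight s ξ *
      (MajdaBiello.twoBumps N γ ξ : ℂ))
    have p2 := MajdaBiello.nrm2_nonneg (fun ξ => MajdaBiello.sobWeight s ξ *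
      (MajdaBiello.twoBumps (κ * N) γ ξ : ℂ))
    have p3 := MajdaBiello.nrm2_nonneg (fun ξ => MajdaBiello.sobWeight (-s) ξ *
      (MajdaBiello.bump ((1 + κ) * N) γ ξ : ℂ))
    have h2 : |t| * (N * γ ^ 2 / 2) ≤ K * ((m * N) ^ s * (2 * √γ * β) +
        (m * N) ^ s * (2 * √γ * β)) ^ 2 * (((3 + κ) * N) ^ (-s) * (√γ * β)) := by
      refine h1.trans ?_
      gcongr
    have hsq : √γ ^ 2 = γ := Real.sq_sqrt hγ.le
    have hsN : √γ * N = √c := by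
      rw [hγdef, Real.sqrt_div hc.le, Real.sqrt_sq hN0.le]
      field_simp
    have e1 : ((m * N) ^ s) ^ 2 = m ^ (2 * s) * (N ^ s * N ^ s) := by
      rw [Real.mul_rpow hm.le hN0.le, mul_pow, ← Real.rpow_natCast (m ^ s), ← Real.rpow_mul hm.le,
        sq (N ^ s)]
      congr 2
      push_cast
      ring
    have e2 : ((3 + κ) * N) ^ (-s) = (3 + κ) ^ (-s) * N ^ (-s) :=
      Real.mul_rpow (by positivity) hN0.le
    have e3 : N ^ s * N ^ (-s) = 1 := by
      rw [← Real.rpow_add hN0, add_neg_cancel, Real.rpow_zero]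
    have e4 : K * ((m * N) ^ s * (2 * √γ * β) + (m * N) ^ s * (2 * √γ * β)) ^ 2 *
        (((3 + κ) * N) ^ (-s) * (√γ * β)) = √γ * γ * (L * N ^ s) := by
      rw [e2, hL]
      calc K * ((m * N) ^ s * (2 * √γ * β) + (m * N) ^ s * (2 * √γ * β)) ^ 2 *
            ((3 + κ) ^ (-s) * N ^ (-s) * (√γ * β)) =
          K * 16 * ((m * N) ^ s) ^ 2 * √γ ^ 2 * β ^ 3 * (3 + κ) ^ (-s) * N ^ (-s) * √γ := by ring
        _ = K * 16 * m ^ (2 * s) * γ * β ^ 3 * (3 + κ) ^ (-s) * √γ * N ^ s *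
            (N ^ s * N ^ (-s)) := by rw [e1, hsq]; ring
        _ = _ := by rw [e3]; ring
    have e5 : |t| * (N * γ ^ 2 / 2) = √γ * γ * (|t| * √c / 2) := by
      calc |t| * (N * γ ^ 2 / 2) = |t| * (N * γ * √γ ^ 2 / 2) := by rw [hsq]; ring
        _ = √γ * γ * (|t| * (√γ * N) / 2) := by ring
        _ = _ := by rw [hsN]
    rw [e4, e5] at h2
    exact le_of_mul_le_mul_left h2 (by positivity)
  have hlim : Filter.Tendsto (fun N : ℝ => L * N ^ s) Filter.atTop (nhds 0) := by
    have h1 := (tendsto_rpow_neg_atTop (y := -s) (by linarith)).const_mul L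
    rwa [neg_neg, mul_zero] at h1
  have h1 := ge_of_tendsto hlim ((Filter.eventually_ge_atTop (1 : ℝ)).mono key)
  have h2 : 0 < |t| * √c / 2 := by positivity
  linarith
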